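/- Let $M$ be a type II von Neumann algebra on a complex Hilbert space $H$, with a faithful normal finite trace $\tau$. Let $S(M,\tau)$ be the $*$-algebra of $\tau$-measurable operators, that is, of the closed operators $x$ on $H$ affiliated with $M$ such that for each $\varepsilon>0$ there is a projection $p\in M$ with $p(H)\subseteq\mathcal D(x)$ and $\tau(\mathbf 1-p)<\varepsilon$, with strong addition and strong multiplication (closures of the algebraic sum and product). A Young function is a function $\phi(t)=\int_0^t f(s)\,ds$, $t\ge 0$, where $f:[0,\infty)\to\mathbb R$ is right continuous, nondecreasing on $(0,\infty)$, $f(0)=0$, $f(s)>0$ for $s>0$, and $f(s)\to\infty$ as $s\to\infty$. Write $\phi_1\prec\phi_2$ if there are $c,T\ge 0$ with $\phi_1(t)\le\phi_2(ct)$ for all $t\ge T$. Let $\Lambda$ be a quadratic family of Young functions: a nonempty set of Young functions such that for all $\phi_1,\phi_2\in\Lambda$ there is $\psi\in\Lambda$ with $\phi_1\prec\psi$ and $\phi_2\prec\psi$, and for every $\phi\in\Lambda$ there are $\psi\in\Lambda$, $c>0$, $T\ge 0$ with $\phi(t^2)\le\psi(ct)$ for all $t\ge T$. Put $$K_\phi=\{x\in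 S(M,\tau):\tau(\phi(|x|))\le 1\},\qquad L_\phi(M,\tau)=\bigcup_{n\ge 1}nK_\phi,\qquad L^\Lambda(M,\tau)=\bigcap_{\phi\in\Lambda}L_\phi(M,\tau);$$ the last set is a subalgebra of $S(M,\tau)$, the generalized Arens algebra. Let $D:L^\Lambda(M,\tau)\to L^\Lambda(M,\tau)$ be an additive derivation, that is, $D(x+y)=D(x)+D(y)$ and $D(xy)=D(x)y+xD(y)$ for all $x,y\in L^\Lambda(M,\tau)$. Then $D(a)=0$ for every $a$ in the center of $L^\Lambda(M,\tau)$. In particular, $D$ is ($\mathbb C$-)linear. -/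

import Mathlib

open Set Filter Topology MeasureTheory
open scoped InnerProductSpace ENNReal ComplexOrder

noncomputable section

namespace ArensAlgebra

universe u

variable {H : Type u} [NormedAddCommGroup H] [InnerProductSpace ℂ H] [CompleteSpace H]

/-! ### Von Neumann algebras of type II and finite traces -/

/-- A projection of `M`. -/
def IsProj (M : VonNeumannAlgebra H) (p : M.toStarSubalgebra) : Prop := IsStarProjection p

/-- Murray-von Neumann equivalence of `p` and `q` in `M`: `p = v* v`, `q = v v*`, `v ∈ M`. -/
def MvNEquiv (M : VonNeumannAlgebra H) (p q : M.toStarSubalgebra) : Prop :=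
  ∃ v : M.toStarSubalgebra, star v * v = p ∧ v * star v = q

/-- A finite projection: it is not equivalent to a proper subprojection of itself. -/
def IsFiniteProj (M : VonNeumannAlgebra H) (p : M.toStarSubalgebra) : Prop :=
  IsProj M p ∧ ∀ q, IsProj M q → q ≤ p → MvNEquiv M p q → q = p

/-- An abelian projection: the reduced algebra `pMp` is commutative. -/
def IsAbelianProj (M : VonNeumannAlgebra H) (p : M.toStarSubalgebra) : Prop :=
  IsProj M p ∧ ∀ x y : M.toStarSubalgebra, (p * x * p) * (p * y * p) = (p * y * p) * (p * x * p)

/-- The projection `p` has central cover `1`: the only central projection above `p` is `1`. -/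
def HasCentralCoverOne (M : VonNeumannAlgebra H) (p : M.toStarSubalgebra) : Prop :=
  ∀ z, IsProj M z → (∀ x : M.toStarSubalgebra, z * x = x * z) → p ≤ z → z = 1

/-- `M` is of type II: it has no nonzero abelian projection, but it has a finite projection with
central cover `1`. -/
def IsTypeII (M : VonNeumannAlgebra H) : Prop :=
  (∀ p, IsAbelianProj M p → p = 0) ∧ ∃ p, IsFiniteProj M p ∧ HasCentralCoverOne M p

/-- A faithful normal finite trace on `M`. As the trace is finite, it is given by its linear
extension to all of `M`. -/
structure FiniteTrace (M : VonNeumannAlgebra H) where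
  /-- the trace as a linear functional -/
  toFun : M.toStarSubalgebra →ₗ[ℂ] ℂ
  nonneg : ∀ a, 0 ≤ a → 0 ≤ toFun a
  tracial : ∀ a b, toFun (a * b) = toFun (b * a)
  faithful : ∀ a, 0 ≤ a → toFun a = 0 → a = 0
  /-- the trace preserves suprema of bounded increasing nets of positive elements -/
  normal : ∀ (S : Set M.toStarSubalgebra) (a : M.toStarSubalgebra), S.Nonempty →
    DirectedOn (· ≤ ·) S → (∀ x ∈ S, 0 ≤ x) → IsLUB S a →
    IsLUB ((fun x => (toFun x).re) '' S) (toFun a).re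

/-- The real number `τ(a)`, for self-adjoint `a ∈ M`. -/
def FiniteTrace.val {M : VonNeumannAlgebra H} (τ : FiniteTrace M) (a : M.toStarSubalgebra) : ℝ :=
  (τ.toFun a).re

/-! ### Measurable operators -/

/-- The product `x y` of partially defined operators, on its natural domain
`{ξ ∈ 𝒟(y) : y ξ ∈ 𝒟(x)}`. -/
def pmul (x y : H →ₗ.[ℂ] H) : H →ₗ.[ℂ] H where
  domain := (x.domain.comap y.toFun).map y.domain.subtype
  toFun :=
    { toFun := fun ξ => x ⟨y ⟨ξ, by obtain ⟨_, η, _, rfl⟩ := ξ; exact η.2⟩, by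
        obtain ⟨_, η, h, rfl⟩ := ξ; exact h⟩
      map_add' := fun ξ η => by
        rw [← LinearPMap.map_add]
        congr 1
        apply Subtype.ext
        change y _ = y _ + y _
        rw [← LinearPMap.map_add]
        rfl
      map_smul' := fun c ξ => by
        rw [RingHom.id_apply, ← LinearPMap.map_smul]
        congr 1
        apply Subtype.ext
        change y _ = c • y _
        rw [← LinearPMap.map_smul]
        rfl }

/-- Strong sum: the closure of the sum on `𝒟(x) ∩ 𝒟(y)`. -/
def sadd (x y : H →ₗ.[ℂ] H) : H →ₗ.[ℂ] H := (x + y).closure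

/-- Strong product: the closure of the product on its natural domain. -/
def sprod (x y : H →ₗ.[ℂ] H) : H →ₗ.[ℂ] H := (pmul x y).closure

/-- Multiplication by a scalar: the closure of `c • x`. -/
def sscal (c : ℂ) (x : H →ₗ.[ℂ] H) : H →ₗ.[ℂ] H := (c • x).closure

/-- The operator `x` is affiliated with `M`: for every unitary `w` of the commutant of `M` one has
`w 𝒟(x) ⊆ 𝒟(x)` and `w x ξ = x w ξ` for all `ξ ∈ 𝒟(x)`. -/
def IsAffiliated (M : VonNeumannAlgebra H) (x : H →ₗ.[ℂ] H) : Prop :=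
  ∀ w ∈ M.commutant, w ∈ unitary (H →L[ℂ] H) →
    ∀ ξ : x.domain, ∃ h : w ξ ∈ x.domain, w (x ξ) = x ⟨w ξ, h⟩

/-- The set `S(M, τ)` of `τ`-measurable operators: closed operators affiliated with `M` whose
domain is `τ`-dense. -/
def measurableOps (M : VonNeumannAlgebra H) (τ : FiniteTrace M) : Set (H →ₗ.[ℂ] H) :=
  {x | x.IsClosed ∧ IsAffiliated M x ∧ ∀ ε : ℝ, 0 < ε →
    ∃ p : M.toStarSubalgebra, IsProj M p ∧ (∀ ξ : H, (p : H →L[ℂ] H) ξ ∈ x.domain) ∧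
      τ.val (1 - p) < ε}

/-! ### Functional calculus of the modulus, and its trace -/

/-- `a = |x|`: the operator `a` is positive and self-adjoint, and `a² = x* x`
(with equality of domains). -/
def IsModulus (x a : H →ₗ.[ℂ] H) : Prop :=
  IsSelfAdjoint a ∧ (∀ ξ : a.domain, 0 ≤ (⟪a ξ, (ξ : H)⟫_ℂ).re) ∧
    pmul a a = pmul x.adjoint x

/-- A spectral family (resolution of the identity) in `M`. -/
structure SpectralFamily (M : VonNeumannAlgebra H) where
  /-- the projections `e t`, `t ∈ ℝ` -/
  e : ℝ → M.toStarSubalgebra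
  isProj : ∀ t, IsProj M (e t)
  mono : Monotone e
  right_cont : ∀ t ξ, Tendsto (fun s => (e s : H →L[ℂ] H) ξ) (𝓝[>] t) (𝓝 ((e t : H →L[ℂ] H) ξ))
  atBot : ∀ ξ, Tendsto (fun s => (e s : H →L[ℂ] H) ξ) atBot (𝓝 0)
  atTop : ∀ ξ, Tendsto (fun s => (e s : H →L[ℂ] H) ξ) atTop (𝓝 ξ)

theorem SpectralFamily.form_mono {M : VonNeumannAlgebra H} (E : SpectralFamily M) (ξ : H) :
    Monotone fun t => (⟪(E.e t : H →L[ℂ] H) ξ, ξ⟫_ℂ).re := by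
  intro s t hst
  have h : ((E.e s : H →L[ℂ] H)) ≤ (E.e t : H →L[ℂ] H) := E.mono hst
  have h2 := ((ContinuousLinearMap.le_def _ _).1 h).re_inner_nonneg_left ξ
  simpa [inner_sub_left] using h2

/-- The monotone right continuous function `t ↦ ⟨e_t ξ, ξ⟩`. -/
def SpectralFamily.form {M : VonNeumannAlgebra H} (E : SpectralFamily M) (ξ : H) :
    StieltjesFunction ℝ where
  toFun t := (⟪(E.e t : H →L[ℂ] H) ξ, ξ⟫_ℂ).re
  mono' := E.form_mono ξ
  right_continuous' t := by
    rw [← continuousWithinAt_Ioi_iff_Ici]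
    exact (Complex.continuous_re.tendsto _).comp
      ((E.right_cont t ξ).inner tendsto_const_nhds)

theorem SpectralFamily.isLUB_compl {M : VonNeumannAlgebra H} (E : SpectralFamily M) (t : ℝ) :
    IsLUB ((fun s => 1 - E.e s) '' Ioi t) (1 - E.e t) := by
  constructor
  · rintro _ ⟨s, hs, rfl⟩
    exact sub_le_sub_left (E.mono (le_of_lt hs)) 1
  · intro b hb
    have hb' : ∀ s, t < s → (((1 - E.e s : M.toStarSubalgebra) : H →L[ℂ] H)) ≤ (b : H →L[ℂ] H) :=
      fun s hs => hb ⟨s, hs, rfl⟩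
    change ((1 - E.e t : M.toStarSubalgebra) : H →L[ℂ] H) ≤ (b : H →L[ℂ] H)
    have hsa : ∀ s, IsSelfAdjoint (((1 - E.e s : M.toStarSubalgebra) : H →L[ℂ] H)) := fun s =>
      congrArg Subtype.val ((IsSelfAdjoint.one _).sub (E.isProj s).isSelfAdjoint)
    have hbsa : IsSelfAdjoint (b : H →L[ℂ] H) := by
      have := ((ContinuousLinearMap.le_def _ _).1 (hb' (t + 1) (by linarith))).isSelfAdjoint
      simpa using this.add (hsa (t + 1))
    rw [ContinuousLinearMap.le_def, ContinuousLinearMap.isPositive_def']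
    refine ⟨hbsa.sub (hsa t), fun ξ => ?_⟩
    have hlim : Tendsto (fun s => (⟪((b : H →L[ℂ] H)
        - ((1 - E.e s : M.toStarSubalgebra) : H →L[ℂ] H)) ξ, ξ⟫_ℂ).re) (𝓝[>] t)
        (𝓝 (⟪((b : H →L[ℂ] H) - ((1 - E.e t : M.toStarSubalgebra) : H →L[ℂ] H)) ξ, ξ⟫_ℂ).re) := by
      refine (Complex.continuous_re.tendsto _).comp (Tendsto.inner ?_ tendsto_const_nhds)
      simp only [AddSubgroupClass.coe_sub, OneMemClass.coe_one, _root_.sub_apply]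
      exact tendsto_const_nhds.sub (tendsto_const_nhds.sub (E.right_cont t ξ))
    refine ge_of_tendsto hlim ?_
    filter_upwards [self_mem_nhdsWithin] with s hs
    exact ((ContinuousLinearMap.le_def _ _).1 (hb' s hs)).re_inner_nonneg_left ξ

theorem FiniteTrace.val_mono {M : VonNeumannAlgebra H} (τ : FiniteTrace M)
    {a b : M.toStarSubalgebra} (h : a ≤ b) : τ.val a ≤ τ.val b := by
  have := (Complex.le_def.1 (τ.nonneg (b - a) (sub_nonneg.2 h))).1
  simpa [FiniteTrace.val] using this

theorem FiniteTrace.val_sub {M : VonNeumannAlgebra H} (τ : FiniteTrace M)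
    (a b : M.toStarSubalgebra) : τ.val (a - b) = τ.val a - τ.val b := by
  simp [FiniteTrace.val]

/-- The monotone right continuous function `t ↦ τ(e_t)`. -/
def SpectralFamily.trace {M : VonNeumannAlgebra H} (τ : FiniteTrace M) (E : SpectralFamily M) :
    StieltjesFunction ℝ where
  toFun t := τ.val (E.e t)
  mono' := fun _ _ hst => τ.val_mono (E.mono hst)
  right_continuous' t := by
    have hm : Monotone fun t => τ.val (E.e t) := fun _ _ hst => τ.val_mono (E.mono hst)
    rw [← continuousWithinAt_Ioi_iff_Ici]
    have h1 := hm.tendsto_nhdsGT t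
    have hpos : ∀ s, (0 : M.toStarSubalgebra) ≤ 1 - E.e s := fun s => by
      change (0 : H →L[ℂ] H) ≤ ((1 - E.e s : M.toStarSubalgebra) : H →L[ℂ] H)
      have hp : IsStarProjection (((1 - E.e s : M.toStarSubalgebra) : H →L[ℂ] H)) :=
        ⟨congrArg Subtype.val (E.isProj s).one_sub.isIdempotentElem,
          congrArg Subtype.val (E.isProj s).one_sub.isSelfAdjoint⟩
      exact hp.nonneg
    have hlub := τ.normal _ _ ((nonempty_Ioi (a := t)).image fun s => 1 - E.e s)
      (by
        rintro _ ⟨s, hs, rfl⟩ _ ⟨s', hs', rfl⟩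
        exact ⟨1 - E.e (min s s'), ⟨_, mem_Ioi.2 (lt_min (mem_Ioi.1 hs) (mem_Ioi.1 hs')), rfl⟩,
          sub_le_sub_left (E.mono (min_le_left _ _)) 1,
          sub_le_sub_left (E.mono (min_le_right _ _)) 1⟩)
      (by rintro _ ⟨s, _, rfl⟩; exact hpos s) (E.isLUB_compl t)
    have hglb : IsGLB ((fun s => τ.val (E.e s)) '' Ioi t) (τ.val (E.e t)) := by
      constructor
      · rintro _ ⟨s, hs, rfl⟩
        exact hm (le_of_lt hs)
      · intro b hb
        have h3 : τ.val (1 - E.e t) ≤ τ.val 1 - b := by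
          apply hlub.2
          rintro _ ⟨_, ⟨s, hs, rfl⟩, rfl⟩
          have h4 : b ≤ τ.val (E.e s) := hb ⟨s, hs, rfl⟩
          have h5 := τ.val_sub 1 (E.e s)
          change τ.val (1 - E.e s) ≤ _
          linarith
        have h5 := τ.val_sub 1 (E.e t)
        linarith
    rw [hglb.csInf_eq (nonempty_Ioi.image _)] at h1
    exact h1

/-- `a = ∫ t d e_t`: the domain of `a` is `{ξ : ∫ t² d⟨e_t ξ, ξ⟩ < ∞}`, and
`⟨a ξ, ξ⟩ = ∫ t d⟨e_t ξ, ξ⟩` there. Every self-adjoint `a` affiliated with `M` has exactly one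
such family, and its projections lie in `M`. -/
def IsSpectralFamilyOf {M : VonNeumannAlgebra H} (E : SpectralFamily M) (a : H →ₗ.[ℂ] H) : Prop :=
  (∀ ξ : H, ξ ∈ a.domain ↔ ∫⁻ t, ENNReal.ofReal (t ^ 2) ∂(E.form ξ).measure < ∞) ∧
    ∀ ξ : a.domain, ⟪a ξ, (ξ : H)⟫_ℂ = ((∫ t, t ∂(E.form ξ).measure : ℝ) : ℂ)

/-- `τ(φ(a)) = ∫ φ(t) dτ(e_t)` for a positive self-adjoint `a = ∫ t d e_t` affiliated with `M`,
and a nonnegative function `φ` on `[0, ∞)`. -/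
def traceFun {M : VonNeumannAlgebra H} (τ : FiniteTrace M) (φ : ℝ → ℝ) (E : SpectralFamily M) :
    ℝ≥0∞ :=
  ∫⁻ t in Ici (0 : ℝ), ENNReal.ofReal (φ t) ∂(E.trace τ).measure

/-! ### Young functions and generalized Arens algebras -/

/-- A Young function: `φ(t) = ∫₀ᵗ f(s) ds` for `t ≥ 0`, with `f(0) = 0`, `f > 0` on `(0, ∞)`,
`f(s) → ∞`, and `f` right continuous and nondecreasing. The values of `φ` on `(-∞, 0)` do not
matter. -/
def IsYoung (φ : ℝ → ℝ) : Prop :=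
  ∃ f : ℝ → ℝ, f 0 = 0 ∧ (∀ s, 0 < s → 0 < f s) ∧ Tendsto f atTop atTop ∧
    (∀ s, 0 ≤ s → ContinuousWithinAt f (Ici s) s) ∧ MonotoneOn f (Ioi 0) ∧
    ∀ t, 0 ≤ t → φ t = ∫ s in (0 : ℝ)..t, f s

/-- `φ₁ ≺ φ₂`. -/
def Prec (φ₁ φ₂ : ℝ → ℝ) : Prop :=
  ∃ c T : ℝ, 0 ≤ c ∧ 0 ≤ T ∧ ∀ t, T ≤ t → φ₁ t ≤ φ₂ (c * t)

/-- A quadratic (generating) family of Young functions. -/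
structure IsQuadraticFamily (Λ : Set (ℝ → ℝ)) : Prop where
  nonempty : Λ.Nonempty
  young : ∀ φ ∈ Λ, IsYoung φ
  generating : ∀ φ₁ ∈ Λ, ∀ φ₂ ∈ Λ, ∃ ψ ∈ Λ, Prec φ₁ ψ ∧ Prec φ₂ ψ
  quadratic : ∀ φ ∈ Λ, ∃ ψ ∈ Λ, ∃ c T : ℝ, 0 < c ∧ 0 ≤ T ∧ ∀ t, T ≤ t → φ (t ^ 2) ≤ ψ (c * t)

/-- `K_φ = {x ∈ S(M, τ) : τ(φ(|x|)) ≤ 1}`. -/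
def orliczBall (M : VonNeumannAlgebra H) (τ : FiniteTrace M) (φ : ℝ → ℝ) : Set (H →ₗ.[ℂ] H) :=
  {x | x ∈ measurableOps M τ ∧ ∃ a, IsModulus x a ∧
    ∃ E : SpectralFamily M, IsSpectralFamilyOf E a ∧ traceFun τ φ E ≤ 1}

/-- `L_φ(M, τ) = ⋃_{n ≥ 1} n K_φ`. -/
def orliczSpace (M : VonNeumannAlgebra H) (τ : FiniteTrace M) (φ : ℝ → ℝ) : Set (H →ₗ.[ℂ] H) :=
  {x | ∃ n : ℕ, 1 ≤ n ∧ ∃ y ∈ orliczBall M τ φ, x = sscal (n : ℂ) y}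

/-- The generalized Arens algebra `L^Λ(M, τ) = ⋂_{φ ∈ Λ} L_φ(M, τ)`, with strong addition and
strong multiplication. -/
def arens (M : VonNeumannAlgebra H) (τ : FiniteTrace M) (Λ : Set (ℝ → ℝ)) : Set (H →ₗ.[ℂ] H) :=
  ⋂ φ ∈ Λ, orliczSpace M τ φ

/-- The center of an algebra `A` of operators under the strong product. -/
def centerOf (A : Set (H →ₗ.[ℂ] H)) : Set (H →ₗ.[ℂ] H) :=
  {a | a ∈ A ∧ ∀ x ∈ A, sprod a x = sprod x a}

/-- `D` is an additive derivation of the algebra `A` of operators, with the strong operations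
(the values of `D` outside `A` do not matter). -/
structure IsAdditiveDerivation (A : Set (H →ₗ.[ℂ] H)) (D : (H →ₗ.[ℂ] H) → (H →ₗ.[ℂ] H)) :
    Prop where
  mapsTo : MapsTo D A A
  map_add : ∀ x ∈ A, ∀ y ∈ A, D (sadd x y) = sadd (D x) (D y)
  leibniz : ∀ x ∈ A, ∀ y ∈ A, D (sprod x y) = sadd (sprod (D x) y) (sprod x (D y))

/-- `D` is a linear operator on `A`, with the strong operations. -/
structure IsLinearOperator (A : Set (H →ₗ.[ℂ] H)) (D : (H →ₗ.[ℂ] H) → (H →ₗ.[ℂ] H)) :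
    Prop where
  mapsTo : MapsTo D A A
  map_add : ∀ x ∈ A, ∀ y ∈ A, D (sadd x y) = sadd (D x) (D y)
  map_smul : ∀ c : ℂ, ∀ x ∈ A, D (sscal c x) = sscal c (D x)

end ArensAlgebra

end

noncomputable section

set_option linter.unusedSectionVars false

namespace ArensAlgebra

variable {H : Type*} [NormedAddCommGroup H] [InnerProductSpace ℂ H] [CompleteSpace H]

/-! The heart of the matter is that `D` vanishes on bounded central elements. A central projection e
satisfies e = e², so De = 2eDe and hence De = 0. Let T be central in `M` with 0 ≤ T ≤ 1. Stripping
binary digits, T₀ = T and Tₙ₊₁ = 2Tₙ − eₙ with eₙ the spectral projection of Tₙ for (1/2, ∞), keeps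
all Tₙ central and between 0 and 1. Since D(eₙ) = 0, one gets D(Tₙ) = 2ⁿ D(T)
(`mem_graph_map_dyadic`). So if D(T) ≠ 0, then `D` is arbitrarily large on central contractions.

This is turned into a contradiction by gluing (`kills_of_positive`). A nonzero D(T) is bounded below
by some β > 0 on the range of a nonzero projection (`exists_bounded_below`). As `M` has no abelian
projection, this range contains infinitely many orthogonal nonzero ranges of projections pₙ of `M`
(`exists_orthogonal_seq`). Let X = ∑ T_{k(n)} pₙ, a bounded operator of `M` (`exists_strong_sum`),
with k(n) growing fast. Comparing D(T_{k(n)} pₙ) with D(pₙ X) shows that D(X), compressed by pₙ,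
acts on pₙ as 2^{k(n)} D(T). For one φ ∈ Λ the element D(X) is N times an element of the unit ball,
and Chebyshev's inequality for its spectral family is violated on p_N.

Self-adjoint and then arbitrary bounded central elements follow by algebra: `D` is only additive,
but it kills the integers, 1/2 and i (`kills_of_mem_commutant`). For an unbounded central a, the
projection onto its graph yields bounded central R = (1 + a*a)⁻¹ and S = aR. From D(R) = D(S) = 0
and the Leibniz rule, D(a)R = 0, and R is injective, so D(a) = 0. Linearity follows, because the
scalar operators are central.

Unbounded operators are handled through their graphs, and "up to a subspace of small codimension"
through the dimension function K ↦ τ(P_K) on the ranges of projections of `M`. The comparison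
principle is `rank_le_of_injOn`: an element of `M` that is injective on K and maps it into L forces
dim K ≤ dim L. It replaces polar decomposition and the usual comparison of projections. -/

/-! ### Closed subspaces invariant under the commutant -/

/-- A closed subspace invariant under the commutant of `M`, that is, the range of a projection
of `M`. -/
structure InvSubspace (M : VonNeumannAlgebra H) where
  /-- the underlying subspace -/
  space : Submodule ℂ H
  isClosed : IsClosed (space : Set H)
  inv : ∀ w ∈ M.commutant, ∀ ξ ∈ space, w ξ ∈ space

namespace InvSubspace

variable {M : VonNeumannAlgebra H}

instance (K : InvSubspace M) : CompleteSpace K.space := K.isClosed.completeSpace_coe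

/-- The orthogonal projection onto `K`, as an element of `M`. -/
def proj (K : InvSubspace M) : M.toStarSubalgebra :=
  ⟨K.space.starProjection, (VonNeumannAlgebra.IsStarProjection.mem_iff
    (isStarProjection_starProjection) M).2 fun w hw => by
      rw [Submodule.range_starProjection]
      exact K.inv w hw⟩

theorem coe_proj (K : InvSubspace M) : (K.proj : H →L[ℂ] H) = K.space.starProjection := rfl

theorem isProj (K : InvSubspace M) : IsProj M K.proj :=
  ⟨Subtype.ext isStarProjection_starProjection.isIdempotentElem,
    Subtype.ext isStarProjection_starProjection.isSelfAdjoint⟩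

theorem proj_apply_mem (K : InvSubspace M) (ξ : H) : (K.proj : H →L[ℂ] H) ξ ∈ K.space :=
  K.space.starProjection_apply_mem ξ

theorem proj_apply_eq_self_iff (K : InvSubspace M) {ξ : H} :
    (K.proj : H →L[ℂ] H) ξ = ξ ↔ ξ ∈ K.space := Submodule.starProjection_eq_self_iff

/-- The orthogonal complement. -/
def compl (K : InvSubspace M) : InvSubspace M where
  space := K.spaceᗮ
  isClosed := K.space.isClosed_orthogonal
  inv w hw ξ hξ := by
    rw [Submodule.mem_orthogonal] at hξ ⊢
    intro η hη
    rw [← ContinuousLinearMap.adjoint_inner_left]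
    exact hξ _ (K.inv _ (star_mem hw) _ hη)

/-- The intersection. -/
def inf (K L : InvSubspace M) : InvSubspace M where
  space := K.space ⊓ L.space
  isClosed := K.isClosed.inter L.isClosed
  inv w hw ξ hξ := ⟨K.inv w hw ξ hξ.1, L.inv w hw ξ hξ.2⟩

/-- The preimage under an element of `M`. -/
def comap (K : InvSubspace M) (T : M.toStarSubalgebra) : InvSubspace M where
  space := K.space.comap ((T : H →L[ℂ] H) : H →ₗ[ℂ] H)
  isClosed := K.isClosed.preimage (T : H →L[ℂ] H).continuous
  inv w hw ξ hξ := by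
    have h := VonNeumannAlgebra.mem_commutant_iff.1 hw T T.2
    have h2 : (T : H →L[ℂ] H) (w ξ) = w ((T : H →L[ℂ] H) ξ) := congrArg (fun X => X ξ) h
    change (T : H →L[ℂ] H) (w ξ) ∈ K.space
    rw [h2]
    exact K.inv w hw _ hξ

theorem mem_comap {K : InvSubspace M} {T : M.toStarSubalgebra} {ξ : H} :
    ξ ∈ (K.comap T).space ↔ (T : H →L[ℂ] H) ξ ∈ K.space := Iff.rfl

/-- The zero subspace. -/
def bot (M : VonNeumannAlgebra H) : InvSubspace M where
  space := ⊥
  isClosed := by simp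
  inv w _ ξ hξ := by simp_all

/-- The kernel of an element of `M`. -/
def ker (T : M.toStarSubalgebra) : InvSubspace M := (bot M).comap T

theorem mem_ker {T : M.toStarSubalgebra} {ξ : H} :
    ξ ∈ (ker T).space ↔ (T : H →L[ℂ] H) ξ = 0 := Iff.rfl

/-- The range of a projection of `M`. -/
def ofProj (p : M.toStarSubalgebra) : InvSubspace M := ker (1 - p)

theorem mem_ofProj {p : M.toStarSubalgebra} {ξ : H} :
    ξ ∈ (ofProj p).space ↔ (p : H →L[ℂ] H) ξ = ξ := by
  rw [ofProj, mem_ker]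
  change ξ - (p : H →L[ℂ] H) ξ = 0 ↔ _
  rw [sub_eq_zero, eq_comm]

theorem proj_ofProj {p : M.toStarSubalgebra} (hp : IsProj M p) : (ofProj p).proj = p := by
  apply Subtype.ext
  have hp' : IsStarProjection (p : H →L[ℂ] H) :=
    ⟨congrArg Subtype.val hp.isIdempotentElem, congrArg Subtype.val hp.isSelfAdjoint⟩
  rw [coe_proj]
  ext ξ
  apply Submodule.eq_starProjection_of_mem_of_inner_eq_zero
  · rw [mem_ofProj]
    exact congrArg (fun X => X ξ) hp'.isIdempotentElem.eq
  · intro η hη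
    rw [mem_ofProj] at hη
    have h2 := ContinuousLinearMap.adjoint_inner_left (p : H →L[ℂ] H) η ξ
    have h3 : ContinuousLinearMap.adjoint (p : H →L[ℂ] H) = p := hp'.isSelfAdjoint
    rw [h3, hη] at h2
    rw [inner_sub_left, h2, sub_self]

theorem proj_compl (K : InvSubspace M) : K.compl.proj = 1 - K.proj := by
  apply Subtype.ext
  change K.spaceᗮ.starProjection = 1 - K.space.starProjection
  rw [Submodule.starProjection_orthogonal]
  rfl

theorem compl_compl_space (K : InvSubspace M) : K.compl.compl.space = K.space :=
  Submodule.orthogonal_orthogonal _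

theorem proj_le_proj {K L : InvSubspace M} (h : K.space ≤ L.space) : K.proj ≤ L.proj :=
  Submodule.starProjection_le_starProjection_iff.2 h

theorem proj_congr {K L : InvSubspace M} (h : K.space = L.space) : K.proj = L.proj :=
  le_antisymm (proj_le_proj h.le) (proj_le_proj h.ge)

theorem proj_nonneg (K : InvSubspace M) : 0 ≤ K.proj :=
  (isStarProjection_starProjection (U := K.space)).nonneg (R := H →L[ℂ] H)

theorem proj_eq_zero_iff (K : InvSubspace M) : K.proj = 0 ↔ K.space = ⊥ := by
  constructor
  · intro h
    rw [eq_bot_iff]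
    intro ξ hξ
    rw [← K.proj_apply_eq_self_iff, h] at hξ
    simpa using hξ.symm
  · intro h
    apply Subtype.ext
    ext ξ
    have := K.proj_apply_mem ξ
    rw [h] at this
    simpa using this

end InvSubspace

/-! ### The dimension function given by the trace -/

section Rank

variable {M : VonNeumannAlgebra H} (τ : FiniteTrace M)

/-- The trace of the projection onto `K`. -/
def rank (K : InvSubspace M) : ℝ := τ.val K.proj

theorem FiniteTrace.val_nonneg {a : M.toStarSubalgebra} (h : 0 ≤ a) : 0 ≤ τ.val a :=
  (Complex.le_def.1 (τ.nonneg a h)).1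

theorem FiniteTrace.eq_zero_of_val {a : M.toStarSubalgebra} (h : 0 ≤ a) (h0 : τ.val a = 0) :
    a = 0 := by
  refine τ.faithful a h (Complex.ext h0 ?_)
  exact (Complex.le_def.1 (τ.nonneg a h)).2.symm

theorem FiniteTrace.val_add (a b : M.toStarSubalgebra) :
    τ.val (a + b) = τ.val a + τ.val b := by
  simp [FiniteTrace.val]

theorem rank_nonneg (K : InvSubspace M) : 0 ≤ rank τ K := τ.val_nonneg K.proj_nonneg

theorem rank_mono {K L : InvSubspace M} (h : K.space ≤ L.space) : rank τ K ≤ rank τ L :=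
  τ.val_mono (InvSubspace.proj_le_proj h)

theorem rank_compl (K : InvSubspace M) : rank τ K.compl = τ.val 1 - rank τ K := by
  rw [rank, InvSubspace.proj_compl, τ.val_sub, rank]

theorem rank_eq_zero_iff (K : InvSubspace M) : rank τ K = 0 ↔ K.space = ⊥ := by
  rw [← K.proj_eq_zero_iff]
  constructor
  · exact τ.eq_zero_of_val K.proj_nonneg
  · intro h
    rw [rank, h]
    simp [FiniteTrace.val]

theorem rank_eq_add {K L : InvSubspace M} (h : K.space ≤ L.space) :
    rank τ L = rank τ K + rank τ (L.inf K.compl) := by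
  have : L.proj = K.proj + (L.inf K.compl).proj := by
    apply Subtype.ext
    ext ξ
    apply Submodule.eq_starProjection_of_mem_of_inner_eq_zero
    · exact add_mem (h (K.proj_apply_mem ξ)) ((L.inf K.compl).proj_apply_mem ξ).1
    · intro η hη
      change ⟪ξ - ((K.proj : H →L[ℂ] H) ξ + ((L.inf K.compl).proj : H →L[ℂ] H) ξ), η⟫_ℂ = 0
      set ζ := (K.proj : H →L[ℂ] H) η
      have hζ : ζ ∈ K.space := K.proj_apply_mem η
      have hη2 : η - ζ ∈ (L.inf K.compl).space :=
        ⟨sub_mem hη (h hζ), K.space.sub_starProjection_mem_orthogonal η⟩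
      have e1 : ⟪ξ - (K.proj : H →L[ℂ] H) ξ, ζ⟫_ℂ = 0 :=
        K.space.starProjection_inner_eq_zero _ _ hζ
      have e2 : ⟪((L.inf K.compl).proj : H →L[ℂ] H) ξ, ζ⟫_ℂ = 0 :=
        Submodule.inner_left_of_mem_orthogonal hζ ((L.inf K.compl).proj_apply_mem ξ).2
      have e3 : ⟪ξ - ((L.inf K.compl).proj : H →L[ℂ] H) ξ, η - ζ⟫_ℂ = 0 :=
        (L.inf K.compl).space.starProjection_inner_eq_zero _ _ hη2
      have e4 : ⟪(K.proj : H →L[ℂ] H) ξ, η - ζ⟫_ℂ = 0 :=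
        Submodule.inner_right_of_mem_orthogonal (K.proj_apply_mem ξ) hη2.2
      rw [inner_sub_left] at e1 e3
      rw [inner_sub_left, inner_add_left]
      have h5 : ∀ x : H, ⟪x, η⟫_ℂ = ⟪x, η - ζ⟫_ℂ + ⟪x, ζ⟫_ℂ := fun x => by
        rw [← inner_add_right, sub_add_cancel]
      rw [h5 ξ, h5 (((K.proj : H →L[ℂ] H)) ξ), h5 (((L.inf K.compl).proj : H →L[ℂ] H) ξ)]
      linear_combination e1 - e2 + e3 - e4
  rw [rank, this, τ.val_add]
  rfl

/-- With P the projection onto K, one has Pa = a = aP, so (1 − a)ⁿ is the identity on the complement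
of K. Therefore P − (1 − (1 − a)ⁿ) = P(1 − a)ⁿP, which is positive. -/
theorem one_sub_pow_le_starProjection {K : Submodule ℂ H} [K.HasOrthogonalProjection]
    {a : H →L[ℂ] H} (ha : 0 ≤ a) (ha1 : a ≤ 1) (hK : ∀ ξ, a ξ ∈ K) (n : ℕ) :
    1 - (1 - a) ^ n ≤ K.starProjection := by
  set P := K.starProjection
  have hP : IsStarProjection P := isStarProjection_starProjection
  have hPa : P * a = a := by
    ext ξ
    exact Submodule.starProjection_eq_self_iff.2 (hK ξ)
  have haP : a * P = a := by
    have h := congrArg star hPa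
    rwa [star_mul, hP.isSelfAdjoint.star_eq, (IsSelfAdjoint.of_nonneg ha).star_eq] at h
  have h1 : (1 - P) * (1 - a) ^ n = 1 - P := by
    induction n with
    | zero => simp
    | succ n ih => rw [pow_succ, ← mul_assoc, ih, mul_sub, sub_mul, sub_mul, hPa]; simp
  have h2 : (1 - a) ^ n * (1 - P) = 1 - P := by
    clear h1
    induction n with
    | zero => simp
    | succ n ih => rw [pow_succ', mul_assoc, ih, sub_mul, mul_sub a, haP]; simp
  have hB : 0 ≤ (1 - a) ^ n := CStarAlgebra.pow_nonneg (sub_nonneg.2 ha1) n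
  have h3 := hP.isSelfAdjoint.conjugate_nonneg hB
  have h4 : P * (1 - a) ^ n * P = P - (1 - (1 - a) ^ n) := by
    have e1 : P * (1 - a) ^ n = (1 - a) ^ n - (1 - P) := by
      rw [← h1, sub_mul, one_mul]
      abel
    have e2 : (1 - a) ^ n * P = (1 - a) ^ n - (1 - P) := by
      rw [← h2, mul_sub, mul_one]
      abel
    rw [e1, sub_mul, e2, sub_mul, hP.isIdempotentElem.eq]
    simp
    abel
  rw [h4] at h3
  exact sub_nonneg.1 h3

theorem FiniteTrace.val_mul_comm (a b : M.toStarSubalgebra) : τ.val (a * b) = τ.val (b * a) := by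
  simp [FiniteTrace.val, τ.tracial]

/-- The increments of 1 − (1 − b)ⁿ are (1 − b)ⁿb. For b = X*X the factor X is cycled under the trace
and moved through by X(1 − X*X)ⁿ = (1 − XX*)ⁿX. -/
theorem FiniteTrace.val_one_sub_pow (X : M.toStarSubalgebra) (n : ℕ) :
    τ.val (1 - (1 - star X * X) ^ n) = τ.val (1 - (1 - X * star X) ^ n) := by
  have hX : ∀ n : ℕ, X * (1 - star X * X) ^ n = (1 - X * star X) ^ n * X := by
    intro n
    induction n with
    | zero => simp
    | succ n ih =>
      rw [pow_succ, ← mul_assoc, ih, pow_succ, mul_assoc, mul_assoc]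
      congr 1
      simp [mul_sub, sub_mul, mul_assoc]
  induction n with
  | zero => simp
  | succ n ih =>
    have e1 : ∀ b : M.toStarSubalgebra, 1 - (1 - b) ^ (n + 1)
        = (1 - (1 - b) ^ n) + (1 - b) ^ n * b := fun b => by
      rw [pow_succ, mul_sub, mul_one]
      abel
    rw [e1, e1, τ.val_add, τ.val_add, ih]
    congr 1
    rw [← mul_assoc, τ.val_mul_comm, ← mul_assoc, hX, mul_assoc]

/-- The operators 1 − (1 − a)ⁿ increase to the support projection of a, which is the projection onto
K, and normality of the trace carries the bound over to the supremum. -/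
theorem val_starProjection_le_of_forall_pow {K : InvSubspace M} {a : M.toStarSubalgebra}
    (ha : 0 ≤ a) (ha1 : a ≤ 1) (hK : ∀ ξ, (a : H →L[ℂ] H) ξ = 0 ↔ ξ ∈ K.spaceᗮ) {c : ℝ}
    (hc : ∀ n : ℕ, τ.val (1 - (1 - a) ^ n) ≤ c) : rank τ K ≤ c := by
  have ha' : (0 : H →L[ℂ] H) ≤ (a : H →L[ℂ] H) := ha
  have ha1' : (a : H →L[ℂ] H) ≤ 1 := ha1
  have hb : (0 : H →L[ℂ] H) ≤ 1 - (a : H →L[ℂ] H) := sub_nonneg.2 ha1'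
  have hmem : ∀ ξ, (a : H →L[ℂ] H) ξ ∈ K.space := fun ξ => by
    rw [← K.compl_compl_space]
    change _ ∈ K.spaceᗮᗮ
    rw [Submodule.mem_orthogonal]
    intro η hη
    rw [← hK] at hη
    rw [← ((ContinuousLinearMap.nonneg_iff_isPositive _).1 ha').inner_left_eq_inner_right, hη,
      inner_zero_left]
  have hstep : ∀ n : ℕ, (1 - (a : H →L[ℂ] H)) ^ (n + 1) ≤ (1 - (a : H →L[ℂ] H)) ^ n := fun n => by
    have h : 0 ≤ (1 - (a : H →L[ℂ] H)) ^ n * (a : H →L[ℂ] H) :=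
      Commute.mul_nonneg (CStarAlgebra.pow_nonneg hb n) ha'
        (Commute.pow_left ((Commute.one_left _).sub_left (Commute.refl _)) n)
    rw [pow_succ, mul_sub, mul_one]
    exact sub_le_self _ h
  have hanti : Antitone fun n : ℕ => (1 - (a : H →L[ℂ] H)) ^ n := antitone_nat_of_succ_le hstep
  have hmono : Monotone fun n : ℕ => (1 - (1 - a) ^ n : M.toStarSubalgebra) := fun m n hmn =>
    sub_le_sub_left (hanti hmn) (1 : H →L[ℂ] H)
  have hlub : IsLUB (range fun n : ℕ => (1 - (1 - a) ^ n : M.toStarSubalgebra)) K.proj := by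
    constructor
    · rintro _ ⟨n, rfl⟩
      exact one_sub_pow_le_starProjection ha' ha1' hmem n
    · intro d hd
      have hd' : ∀ n : ℕ, 1 - (1 - (a : H →L[ℂ] H)) ^ n ≤ (d : H →L[ℂ] H) := fun n =>
        hd ⟨n, rfl⟩
      change K.space.starProjection ≤ (d : H →L[ℂ] H)
      set b : H →L[ℂ] H := 1 - (a : H →L[ℂ] H) with hbdef
      have hdsa : IsSelfAdjoint (d : H →L[ℂ] H) := by
        have h0 := hd' 0
        rw [pow_zero, sub_self] at h0
        exact IsSelfAdjoint.of_nonneg h0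
      have hbn : ‖b‖ ≤ 1 := by
        rw [CStarAlgebra.norm_le_one_iff_of_nonneg b hb]
        exact sub_le_self _ ha'
      rw [ContinuousLinearMap.le_def, ContinuousLinearMap.isPositive_def']
      refine ⟨hdsa.sub isStarProjection_starProjection.isSelfAdjoint, fun ξ => ?_⟩
      -- Mean ergodic theorem: the averages of the powers of b = 1 − a converge strongly to the
      -- projection onto the fixed vectors of b, that is, onto ker a = Kᗮ. Averages suffice, because
      -- every single power satisfies the inequality `hk` below.
      have hlim := ContinuousLinearMap.tendsto_birkhoffAverage_orthogonalProjection b hbn ξ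
      have hfix : ((b.eqLocus (1 : H →L[ℂ] H)).orthogonalProjectionOnto ξ : H)
          = ξ - K.space.starProjection ξ := by
        have h1 : b.eqLocus (1 : H →L[ℂ] H) = K.spaceᗮ := by
          ext η
          rw [← hK]
          change (b η = (1 : H →L[ℂ] H) η) ↔ _
          simp [hbdef]
        have h2 : (b.eqLocus (1 : H →L[ℂ] H)).starProjection ξ = K.spaceᗮ.starProjection ξ := by
          congr 2
        rw [Submodule.starProjection_orthogonal] at h2
        exact h2
      rw [hfix] at hlim
      have hlim2 : Tendsto (fun n : ℕ => (⟪(d : H →L[ℂ] H) ξ, ξ⟫_ℂ).re - (⟪ξ, ξ⟫_ℂ).re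
          + (⟪birkhoffAverage ℂ b _root_.id n ξ, ξ⟫_ℂ).re) Filter.atTop
          (𝓝 ((⟪(d : H →L[ℂ] H) ξ, ξ⟫_ℂ).re - (⟪ξ, ξ⟫_ℂ).re
            + (⟪ξ - K.space.starProjection ξ, ξ⟫_ℂ).re)) :=
        tendsto_const_nhds.add ((Complex.continuous_re.tendsto _).comp
          (hlim.inner tendsto_const_nhds))
      have hval : ((d : H →L[ℂ] H) - K.space.starProjection).reApplyInnerSelf ξ =
          (⟪(d : H →L[ℂ] H) ξ, ξ⟫_ℂ).re - (⟪ξ, ξ⟫_ℂ).re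
            + (⟪ξ - K.space.starProjection ξ, ξ⟫_ℂ).re := by
        simp [ContinuousLinearMap.reApplyInnerSelf, inner_sub_left]
      rw [hval]
      refine ge_of_tendsto hlim2 ?_
      -- The average over zero terms is excluded.
      filter_upwards [eventually_ge_atTop 1] with n hn
      have hk : ∀ k : ℕ, (⟪ξ, ξ⟫_ℂ).re - (⟪(d : H →L[ℂ] H) ξ, ξ⟫_ℂ).re
          ≤ (⟪b^[k] ξ, ξ⟫_ℂ).re := fun k => by
        have h := ((ContinuousLinearMap.le_def _ _).1 (hd' k)).re_inner_nonneg_left ξ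
        have e : (b ^ k) ξ = b^[k] ξ := by rw [FunLike.coe_pow_eq_iterate]
        simp only [_root_.sub_apply, inner_sub_left, one_apply_eq_self, e] at h
        simp at h ⊢
        linarith
      have hn' : (0 : ℝ) < n := by exact_mod_cast hn
      have hsum : (⟪birkhoffAverage ℂ b _root_.id n ξ, ξ⟫_ℂ).re
          = (n : ℝ)⁻¹ * ∑ k ∈ Finset.range n, (⟪b^[k] ξ, ξ⟫_ℂ).re := by
        rw [birkhoffAverage, birkhoffSum, inner_smul_left, sum_inner]
        have : (starRingEnd ℂ) ((n : ℂ)⁻¹) = (((n : ℝ)⁻¹ : ℝ) : ℂ) := by simp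
        rw [this, Complex.re_ofReal_mul, Complex.re_sum]
        rfl
      rw [hsum]
      have hge := Finset.card_nsmul_le_sum (Finset.range n)
        (fun k => (⟪b^[k] ξ, ξ⟫_ℂ).re) _ (fun k _ => hk k)
      rw [Finset.card_range, nsmul_eq_mul] at hge
      have := mul_le_mul_of_nonneg_left hge (inv_nonneg.2 hn'.le)
      rw [← mul_assoc, inv_mul_cancel₀ hn'.ne', one_mul] at this
      linarith
  have hnorm := τ.normal _ _ (range_nonempty _) hmono.directed_le.directedOn_range
    (by
      rintro _ ⟨n, rfl⟩
      have h := hmono (Nat.zero_le n)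
      simpa using h) hlub
  refine hnorm.2 ?_
  rintro _ ⟨_, ⟨n, rfl⟩, rfl⟩
  exact hc n

/-- If an element of `M` maps `K` injectively into `L`, then the dimension of `K` is at most the
dimension of `L`. -/
theorem rank_le_of_injOn {K L : InvSubspace M} (T : M.toStarSubalgebra)
    (hinj : ∀ ξ ∈ K.space, (T : H →L[ℂ] H) ξ = 0 → ξ = 0)
    (hmaps : ∀ ξ ∈ K.space, (T : H →L[ℂ] H) ξ ∈ L.space) : rank τ K ≤ rank τ L := by
  -- A multiple X of T P_K is a contraction whose range lies in L and whose kernel is exactly the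
  -- complement of K, by injectivity. Hence the support of X*X is K, while XX* has range in L; the
  -- trace identity `val_one_sub_pow` links the two.
  obtain ⟨c, hc0, hc⟩ : ∃ c : ℝ, 0 < c ∧ ‖(c : ℂ) • ((T * K.proj : M.toStarSubalgebra) : H →L[ℂ] H)‖ ≤ 1 := by
    set r := ‖((T * K.proj : M.toStarSubalgebra) : H →L[ℂ] H)‖ with hr
    have hr0 : 0 ≤ r := norm_nonneg _
    refine ⟨(r + 1)⁻¹, by positivity, ?_⟩
    rw [norm_smul, ← hr, Complex.norm_real, Real.norm_of_nonneg (by positivity),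
      inv_mul_le_iff₀ (by positivity)]
    linarith
  set X : M.toStarSubalgebra := (c : ℂ) • (T * K.proj) with hX
  have hXnorm : ‖(X : H →L[ℂ] H)‖ ≤ 1 := hc
  have hXapp : ∀ ξ, (X : H →L[ℂ] H) ξ = (c : ℂ) • (T : H →L[ℂ] H) ((K.proj : H →L[ℂ] H) ξ) :=
    fun ξ => rfl
  have hXL : ∀ ξ, (X : H →L[ℂ] H) ξ ∈ L.space := fun ξ => by
    rw [hXapp]
    exact L.space.smul_mem _ (hmaps _ (K.proj_apply_mem ξ))
  have hXker : ∀ ξ, (X : H →L[ℂ] H) ξ = 0 ↔ ξ ∈ K.spaceᗮ := fun ξ => by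
    rw [hXapp, smul_eq_zero_iff_right (by exact_mod_cast hc0.ne'),
      ← Submodule.starProjection_apply_eq_zero_iff]
    constructor
    · exact hinj _ (K.proj_apply_mem ξ)
    · intro h
      change (T : H →L[ℂ] H) (K.space.starProjection ξ) = 0
      rw [h, map_zero]
  have hn1 : ∀ Y : H →L[ℂ] H, ‖Y‖ ≤ 1 → star Y * Y ≤ 1 := fun Y hY => by
    rw [← CStarAlgebra.norm_le_one_iff_of_nonneg _ (star_mul_self_nonneg Y),
      CStarRing.norm_star_mul_self]
    nlinarith [norm_nonneg Y]
  have hn2 : ∀ Y : H →L[ℂ] H, ‖Y‖ ≤ 1 → Y * star Y ≤ 1 := fun Y hY => by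
    have := hn1 (star Y) (by rwa [norm_star])
    rwa [star_star] at this
  refine val_starProjection_le_of_forall_pow τ (a := star X * X)
    (star_mul_self_nonneg (X : H →L[ℂ] H)) (hn1 _ hXnorm) ?_ ?_
  · intro ξ
    rw [← hXker]
    constructor
    · intro h
      have h2 : ⟪ContinuousLinearMap.adjoint (X : H →L[ℂ] H) ((X : H →L[ℂ] H) ξ), ξ⟫_ℂ = 0 := by
        change ⟪((star X * X : M.toStarSubalgebra) : H →L[ℂ] H) ξ, ξ⟫_ℂ = 0
        rw [h, inner_zero_left]
      rwa [ContinuousLinearMap.adjoint_inner_left, inner_self_eq_zero] at h2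
    · intro h
      change star (X : H →L[ℂ] H) ((X : H →L[ℂ] H) ξ) = 0
      rw [h, map_zero]
  · intro n
    rw [τ.val_one_sub_pow]
    refine τ.val_mono ?_
    exact one_sub_pow_le_starProjection (mul_star_self_nonneg (X : H →L[ℂ] H))
      (hn2 _ hXnorm) (fun ξ => hXL _) n

/-- The projection onto the complement of L has kernel L, so it is injective on K. -/
theorem rank_le_compl_of_disjoint {K L : InvSubspace M}
    (h : ∀ ξ ∈ K.space, ξ ∈ L.space → ξ = 0) : rank τ K ≤ rank τ L.compl := by
  refine rank_le_of_injOn τ L.compl.proj (fun ξ hξ h0 => h ξ hξ ?_)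
    fun ξ _ => L.compl.proj_apply_mem ξ
  have h1 : ξ ∈ L.spaceᗮᗮ := (Submodule.starProjection_apply_eq_zero_iff L.spaceᗮ).1 h0
  rwa [← L.compl_compl_space]

/-- T followed by the projection onto Kᗮ has kernel `K.comap T`, hence is injective on the
complement of that preimage. -/
theorem rank_compl_comap_le (K : InvSubspace M) (T : M.toStarSubalgebra) :
    rank τ (K.comap T).compl ≤ rank τ K.compl := by
  have key : ∀ ξ, ((K.compl.proj * T : M.toStarSubalgebra) : H →L[ℂ] H) ξ = 0 →
      ξ ∈ (K.comap T).space := fun ξ h0 => by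
    have h1 : (T : H →L[ℂ] H) ξ ∈ K.spaceᗮᗮ :=
      (Submodule.starProjection_apply_eq_zero_iff K.spaceᗮ).1 h0
    rw [InvSubspace.mem_comap, ← K.compl_compl_space]
    exact h1
  refine rank_le_of_injOn τ (K.compl.proj * T) (fun ξ hξ h0 => ?_)
    fun ξ _ => K.compl.proj_apply_mem _
  exact inner_self_eq_zero.1 (Submodule.inner_right_of_mem_orthogonal (key ξ h0) hξ)

/-- If `K ⊓ L` meets `N` only in zero, the dimension of `K` is at most the sum of the codimensions
of `L` and `N`. -/
theorem rank_le_add_of_disjoint {K L N : InvSubspace M}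
    (h : ∀ ξ ∈ K.space, ξ ∈ L.space → ξ ∈ N.space → ξ = 0) :
    rank τ K ≤ rank τ L.compl + rank τ N.compl := by
  rw [rank_eq_add τ (K := K.inf L) (L := K) inf_le_left, add_comm]
  refine add_le_add (rank_le_compl_of_disjoint τ fun ξ hξ hL => ?_)
    (rank_le_compl_of_disjoint τ fun ξ hξ hN => h ξ hξ.1 hξ.2 hN)
  exact inner_self_eq_zero.1 (Submodule.inner_right_of_mem_orthogonal
    (show ξ ∈ (K.inf L).space from ⟨hξ.1, hL⟩) hξ.2)

end Rank

/-! ### Spectral subspaces of bounded self-adjoint operators -/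

theorem re_inner_le_of_le {A B : H →L[ℂ] H} (h : A ≤ B) (ξ : H) :
    (⟪A ξ, ξ⟫_ℂ).re ≤ (⟪B ξ, ξ⟫_ℂ).re := by
  have h2 := ((ContinuousLinearMap.le_def _ _).1 h).re_inner_nonneg_left ξ
  simpa [inner_sub_left] using h2

theorem le_of_re_inner_le {A B : H →L[ℂ] H} (hA : IsSelfAdjoint A) (hB : IsSelfAdjoint B)
    (h : ∀ ξ, (⟪A ξ, ξ⟫_ℂ).re ≤ (⟪B ξ, ξ⟫_ℂ).re) : A ≤ B := by
  rw [ContinuousLinearMap.le_def, ContinuousLinearMap.isPositive_def']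
  refine ⟨hB.sub hA, fun ξ => ?_⟩
  simpa [ContinuousLinearMap.reApplyInnerSelf, inner_sub_left] using h ξ

theorem re_inner_self (ξ : H) : (⟪ξ, ξ⟫_ℂ).re = ‖ξ‖ ^ 2 := by
  rw [inner_self_eq_norm_sq_to_K]
  norm_cast

theorem apply_eq_zero_of_re_inner_nonpos {A : H →L[ℂ] H} (hA : 0 ≤ A) {ξ : H}
    (h : (⟪A ξ, ξ⟫_ℂ).re ≤ 0) : A ξ = 0 := by
  obtain ⟨S, rfl⟩ := CStarAlgebra.nonneg_iff_eq_star_mul_self.1 hA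
  have h1 : ⟪(star S * S) ξ, ξ⟫_ℂ = ⟪S ξ, S ξ⟫_ℂ :=
    ContinuousLinearMap.adjoint_inner_left S ξ (S ξ)
  rw [h1, re_inner_self] at h
  have h2 : S ξ = 0 := by
    rw [← norm_eq_zero]
    nlinarith [norm_nonneg (S ξ)]
  change star S (S ξ) = 0
  rw [h2, map_zero]

theorem adjoint_inner_eq_of_isSelfAdjoint {A : H →L[ℂ] H} (hA : IsSelfAdjoint A) (ξ η : H) :
    ⟪A ξ, η⟫_ℂ = ⟪ξ, A η⟫_ℂ := by
  have h := ContinuousLinearMap.adjoint_inner_left A η ξ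
  have h2 : ContinuousLinearMap.adjoint A = A := hA
  rwa [h2] at h

/-- The positive part of `a - t`. -/
def posCut (a : H →L[ℂ] H) (t : ℝ) : H →L[ℂ] H := cfc (fun x : ℝ => max (x - t) 0) a

theorem posCut_nonneg (a : H →L[ℂ] H) (t : ℝ) : 0 ≤ posCut a t :=
  cfc_nonneg fun _ _ => le_max_right _ _

theorem cfc_sub_const {a : H →L[ℂ] H} (ha : IsSelfAdjoint a) (t : ℝ) :
    cfc (fun x : ℝ => x - t) a = a - (t : ℂ) • 1 := by
  rw [cfc_sub (fun x : ℝ => x) (fun _ => t) a, cfc_id' ℝ a, cfc_const t a]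
  congr 1

theorem sub_le_posCut {a : H →L[ℂ] H} (ha : IsSelfAdjoint a) (t : ℝ) :
    a - (t : ℂ) • 1 ≤ posCut a t := by
  rw [← cfc_sub_const ha]
  exact cfc_mono fun _ _ => le_max_left _ _

theorem posCut_anti (a : H →L[ℂ] H) {s t : ℝ} (h : s ≤ t) : posCut a t ≤ posCut a s :=
  cfc_mono fun _ _ => max_le_max_right _ (by linarith)

theorem posCut_le_add {a : H →L[ℂ] H} (ha : IsSelfAdjoint a) {s t : ℝ} (h : s ≤ t) :
    posCut a s ≤ posCut a t + ((t - s : ℝ) : ℂ) • 1 := by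
  have h1 : cfc (fun x : ℝ => max (x - t) 0 + (t - s)) a
      = posCut a t + ((t - s : ℝ) : ℂ) • 1 := by
    rw [cfc_add a (fun x : ℝ => max (x - t) 0) (fun _ => t - s), cfc_const (t - s) a]
    congr 1
  rw [← h1]
  refine cfc_mono fun x _ => max_le ?_ ?_
  · have := le_max_left (x - t) 0
    linarith
  · have := le_max_right (x - t) 0
    linarith

/-- N is the positive part of t − a. It annihilates the positive part of a − t, and t − N = min(t,
a) ≤ a. -/
theorem exists_negPart {a : H →L[ℂ] H} (ha : IsSelfAdjoint a) (t : ℝ) :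
    ∃ N : H →L[ℂ] H, N * posCut a t = 0 ∧ (t : ℂ) • 1 - N ≤ a := by
  refine ⟨cfc (fun x : ℝ => max (t - x) 0) a, ?_, ?_⟩
  · rw [posCut, ← cfc_mul (fun x : ℝ => max (t - x) 0) (fun x : ℝ => max (x - t) 0) a]
    have : (fun x : ℝ => max (t - x) 0 * max (x - t) 0) = fun _ => 0 := by
      funext x
      rcases le_total x t with h | h
      · rw [max_eq_right (sub_nonpos.2 h), mul_zero]
      · rw [max_eq_right (a := t - x) (sub_nonpos.2 h), zero_mul]
    rw [this, cfc_const_zero ℝ a]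
  · have h1 : cfc (fun x : ℝ => x - t) a ≥ cfc (fun x : ℝ => - max (t - x) 0) a :=
      cfc_mono fun x _ => by
        have := le_max_left (t - x) 0
        linarith
    rw [cfc_sub_const ha, cfc_neg] at h1
    rw [ge_iff_le, neg_le_sub_iff_le_add] at h1
    rw [sub_le_iff_le_add]
    exact h1

theorem cfc_mem (M : VonNeumannAlgebra H) {a : H →L[ℂ] H} (ha : a ∈ M) (f : ℝ → ℝ) :
    cfc f a ∈ M := by
  rw [← M.commutant_commutant, VonNeumannAlgebra.mem_commutant_iff]
  intro w hw
  have h1 : Commute a w := VonNeumannAlgebra.mem_commutant_iff.1 hw a ha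
  exact (Commute.cfc_real h1 f).symm.eq

section SpecSpace

variable {M : VonNeumannAlgebra H}

/-- The spectral subspace of `a` for `(-∞, t]`. -/
def specSpace (a : M.toStarSubalgebra) (t : ℝ) : InvSubspace M :=
  InvSubspace.ker ⟨posCut a t, cfc_mem M a.2 _⟩

theorem mem_specSpace {a : M.toStarSubalgebra} {t : ℝ} {ξ : H} :
    ξ ∈ (specSpace a t).space ↔ posCut (a : H →L[ℂ] H) t ξ = 0 := Iff.rfl

theorem specSpace_mono (a : M.toStarSubalgebra) {s t : ℝ} (h : s ≤ t) :
    (specSpace a s).space ≤ (specSpace a t).space := fun ξ hξ => by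
  rw [mem_specSpace] at hξ ⊢
  refine apply_eq_zero_of_re_inner_nonpos (posCut_nonneg _ _) ?_
  refine (re_inner_le_of_le (posCut_anti _ h) ξ).trans ?_
  simp [hξ]

theorem re_inner_le_of_mem_specSpace {a : M.toStarSubalgebra}
    (ha : IsSelfAdjoint (a : H →L[ℂ] H)) {t : ℝ} {ξ : H} (hξ : ξ ∈ (specSpace a t).space) :
    (⟪(a : H →L[ℂ] H) ξ, ξ⟫_ℂ).re ≤ t * ‖ξ‖ ^ 2 := by
  have h := re_inner_le_of_le (sub_le_posCut ha t) ξ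
  rw [mem_specSpace.1 hξ] at h
  have e : (⟪((t : ℂ) • (1 : H →L[ℂ] H)) ξ, ξ⟫_ℂ).re = t * ‖ξ‖ ^ 2 := by
    rw [_root_.smul_apply, one_apply_eq_self, inner_smul_left, Complex.conj_ofReal,
      Complex.re_ofReal_mul, re_inner_self]
  rw [_root_.sub_apply, inner_sub_left, Complex.sub_re, e, inner_zero_left] at h
  simpa using h

/-- With N the positive part of t − a, the range of N* lies in the kernel of the positive part of a
− t. So N vanishes on the complement of that kernel, where t − N ≤ a becomes a lower bound by t. -/
theorem le_re_inner_of_mem_compl_specSpace {a : M.toStarSubalgebra}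
    (ha : IsSelfAdjoint (a : H →L[ℂ] H)) {t : ℝ} {ξ : H}
    (hξ : ξ ∈ (specSpace a t).compl.space) :
    t * ‖ξ‖ ^ 2 ≤ (⟪(a : H →L[ℂ] H) ξ, ξ⟫_ℂ).re := by
  obtain ⟨N, hN, hle⟩ := exists_negPart ha t
  have hsa : IsSelfAdjoint (posCut (a : H →L[ℂ] H) t) := .of_nonneg (posCut_nonneg _ _)
  have hN0 : N ξ = 0 := by
    have h1 : ContinuousLinearMap.adjoint N ((N ξ)) ∈ (specSpace a t).space := by
      rw [mem_specSpace]
      have h2 : posCut (a : H →L[ℂ] H) t * star N = 0 := by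
        have := congrArg star hN
        rwa [star_mul, hsa.star_eq, star_zero] at this
      exact congrArg (fun X => X (N ξ)) h2
    have h3 := Submodule.inner_right_of_mem_orthogonal h1 hξ
    rwa [ContinuousLinearMap.adjoint_inner_left, inner_self_eq_zero] at h3
  have h := re_inner_le_of_le hle ξ
  have e : (⟪((t : ℂ) • (1 : H →L[ℂ] H)) ξ, ξ⟫_ℂ).re = t * ‖ξ‖ ^ 2 := by
    rw [_root_.smul_apply, one_apply_eq_self, inner_smul_left, Complex.conj_ofReal,
      Complex.re_ofReal_mul, re_inner_self]
  rw [_root_.sub_apply, hN0, sub_zero, e] at h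
  exact h

theorem apply_mem_specSpace {a : M.toStarSubalgebra}
    (t : ℝ) {ξ : H} (hξ : ξ ∈ (specSpace a t).space) :
    (a : H →L[ℂ] H) ξ ∈ (specSpace a t).space := by
  rw [mem_specSpace] at hξ ⊢
  have h : Commute (posCut (a : H →L[ℂ] H) t) (a : H →L[ℂ] H) :=
    Commute.cfc_real (Commute.refl _) _
  have h2 : (posCut (a : H →L[ℂ] H) t) ((a : H →L[ℂ] H) ξ)
      = (a : H →L[ℂ] H) ((posCut (a : H →L[ℂ] H) t) ξ) := congrArg (fun X => X ξ) h.eq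
  rw [h2, hξ, map_zero]

/-- Right continuity of the spectral subspaces, from (a − t)₊ ≤ (a − s)₊ + (s − t) as s decreases to
t. -/
theorem mem_specSpace_of_forall_gt {a : M.toStarSubalgebra}
    (ha : IsSelfAdjoint (a : H →L[ℂ] H)) {t : ℝ} {ξ : H}
    (hξ : ∀ s, t < s → ξ ∈ (specSpace a s).space) : ξ ∈ (specSpace a t).space := by
  rw [mem_specSpace]
  refine apply_eq_zero_of_re_inner_nonpos (posCut_nonneg _ _) ?_
  have h1 : ∀ s, t < s → (⟪posCut (a : H →L[ℂ] H) t ξ, ξ⟫_ℂ).re ≤ (s - t) * ‖ξ‖ ^ 2 := by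
    intro s hs
    have h := re_inner_le_of_le (posCut_le_add ha hs.le) ξ
    rw [_root_.add_apply, mem_specSpace.1 (hξ s hs), zero_add, _root_.smul_apply,
      one_apply_eq_self, inner_smul_left, Complex.conj_ofReal, Complex.re_ofReal_mul,
      re_inner_self] at h
    exact h
  have h2 : Tendsto (fun s : ℝ => (s - t) * ‖ξ‖ ^ 2) (𝓝[>] t) (𝓝 ((t - t) * ‖ξ‖ ^ 2)) :=
    (((continuous_id.sub continuous_const).mul continuous_const).tendsto t).mono_left
      nhdsWithin_le_nhds
  rw [sub_self, zero_mul] at h2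
  refine ge_of_tendsto h2 ?_
  filter_upwards [self_mem_nhdsWithin] with s hs using h1 s hs

/-- The dyadic step: a self-adjoint contraction `0 ≤ T ≤ 1` is half of a projection plus half of
an operator of the same kind. -/
theorem dyadic_step {T : M.toStarSubalgebra} (h0 : 0 ≤ T) (h1 : T ≤ 1) :
    0 ≤ T + T - (specSpace T (1 / 2)).compl.proj ∧
      T + T - (specSpace T (1 / 2)).compl.proj ≤ 1 := by
  set K := specSpace T (1 / 2)
  have hT : IsSelfAdjoint (T : H →L[ℂ] H) := .of_nonneg (show 0 ≤ (T : H →L[ℂ] H) from h0)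
  have he : IsSelfAdjoint (K.compl.proj : H →L[ℂ] H) :=
    isStarProjection_starProjection.isSelfAdjoint
  have hsa : IsSelfAdjoint ((T + T - K.compl.proj : M.toStarSubalgebra) : H →L[ℂ] H) :=
    (hT.add hT).sub he
  -- Split ξ along the spectral subspace K and its complement, which T leaves invariant. Then x and
  -- y are the values of the form of T on the two parts: x is at most half the squared norm, y lies
  -- between half and all of it. Doubling and subtracting the digit on the second part keeps both
  -- inside the unit range.
  have key : ∀ ξ, ∃ x y : ℝ, (⟪((T + T - K.compl.proj : M.toStarSubalgebra) : H →L[ℂ] H) ξ, ξ⟫_ℂ).re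
      = 2 * x + (2 * y - ‖(K.compl.proj : H →L[ℂ] H) ξ‖ ^ 2) ∧ 0 ≤ x ∧
      x ≤ 1 / 2 * ‖(K.proj : H →L[ℂ] H) ξ‖ ^ 2 ∧
      1 / 2 * ‖(K.compl.proj : H →L[ℂ] H) ξ‖ ^ 2 ≤ y ∧
      y ≤ ‖(K.compl.proj : H →L[ℂ] H) ξ‖ ^ 2 ∧
      ‖ξ‖ ^ 2 = ‖(K.proj : H →L[ℂ] H) ξ‖ ^ 2 + ‖(K.compl.proj : H →L[ℂ] H) ξ‖ ^ 2 := by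
    intro ξ
    set η := (K.proj : H →L[ℂ] H) ξ
    set ζ := (K.compl.proj : H →L[ℂ] H) ξ
    have hη : η ∈ K.space := K.proj_apply_mem ξ
    have hζ : ζ ∈ K.spaceᗮ := K.compl.proj_apply_mem ξ
    have hξ : ξ = η + ζ := by
      have : ζ = ξ - η := by
        change (K.compl.proj : H →L[ℂ] H) ξ = _
        rw [InvSubspace.proj_compl]
        rfl
      rw [this]
      abel
    have c1 : ⟪η, ζ⟫_ℂ = 0 := Submodule.inner_right_of_mem_orthogonal hη hζ
    have c1' : ⟪ζ, η⟫_ℂ = 0 := Submodule.inner_left_of_mem_orthogonal hη hζ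
    have c2 : ⟪(T : H →L[ℂ] H) η, ζ⟫_ℂ = 0 :=
      Submodule.inner_right_of_mem_orthogonal (apply_mem_specSpace _ hη) hζ
    have c3 : ⟪(T : H →L[ℂ] H) ζ, η⟫_ℂ = 0 := by
      rw [adjoint_inner_eq_of_isSelfAdjoint hT]
      exact Submodule.inner_left_of_mem_orthogonal (apply_mem_specSpace _ hη) hζ
    refine ⟨(⟪(T : H →L[ℂ] H) η, η⟫_ℂ).re, (⟪(T : H →L[ℂ] H) ζ, ζ⟫_ℂ).re, ?_, ?_, ?_, ?_, ?_, ?_⟩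
    · change (⟪(T : H →L[ℂ] H) ξ + (T : H →L[ℂ] H) ξ - ζ, ξ⟫_ℂ).re = _
      rw [hξ, ← re_inner_self]
      simp only [map_add, inner_sub_left, inner_add_left, inner_add_right, c1', c2, c3,
        Complex.add_re, Complex.sub_re, Complex.zero_re]
      ring
    · have := re_inner_le_of_le (show (0 : H →L[ℂ] H) ≤ T from h0) η
      simpa using this
    · exact re_inner_le_of_mem_specSpace hT hη
    · exact le_re_inner_of_mem_compl_specSpace hT hζ
    · have := re_inner_le_of_le (show (T : H →L[ℂ] H) ≤ 1 from h1) ζ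
      rwa [one_apply_eq_self, re_inner_self] at this
    · rw [← re_inner_self, hξ]
      simp only [inner_add_left, inner_add_right, c1, c1', Complex.add_re, re_inner_self]
      simp
  constructor
  · refine le_of_re_inner_le (A := (0 : H →L[ℂ] H)) (.zero _) hsa fun ξ => ?_
    obtain ⟨x, y, e, i1, i2, i3, i4, i5⟩ := key ξ
    rw [e]
    simp only [_root_.zero_apply, inner_zero_left, Complex.zero_re]
    linarith
  · refine le_of_re_inner_le (B := (1 : H →L[ℂ] H)) hsa (.one _) fun ξ => ?_
    obtain ⟨x, y, e, i1, i2, i3, i4, i5⟩ := key ξ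
    rw [e, one_apply_eq_self, re_inner_self, i5]
    linarith

theorem specSpace_proj_tendsto {a : M.toStarSubalgebra} (ha : IsSelfAdjoint (a : H →L[ℂ] H))
    (t : ℝ) (ξ : H) :
    Tendsto (fun s => ((specSpace a s).proj : H →L[ℂ] H) ξ) (𝓝[>] t)
      (𝓝 (((specSpace a t).proj : H →L[ℂ] H) ξ)) := by
  -- The complements of the spectral subspaces grow as s decreases to t, so the order is reversed to
  -- apply monotone convergence of projections.
  let U : (Ioi t)ᵒᵈ → Submodule ℂ H := fun i => (specSpace a (OrderDual.ofDual i : Ioi t)).compl.space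
  have hU : Monotone U := fun i j hij =>
    Submodule.orthogonal_le (specSpace_mono a (show ((OrderDual.ofDual j : Ioi t) : ℝ) ≤ _ from hij))
  have h := Submodule.starProjection_tendsto_closure_iSup U hU ξ
  have hspace : (⨆ i, U i).topologicalClosure = (specSpace a t).spaceᗮ := by
    rw [← Submodule.orthogonal_orthogonal_eq_closure]
    congr 1
    apply le_antisymm
    · intro η hη
      refine mem_specSpace_of_forall_gt ha fun s hs => ?_
      rw [← InvSubspace.compl_compl_space]
      exact Submodule.orthogonal_le (le_iSup U (OrderDual.toDual ⟨s, hs⟩)) hη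
    · intro η hη
      rw [Submodule.mem_orthogonal]
      intro ζ hζ
      have : (⨆ i, U i) ≤ (specSpace a t).spaceᗮ :=
        iSup_le fun i => Submodule.orthogonal_le (specSpace_mono a (OrderDual.ofDual i : Ioi t).2.le)
      exact Submodule.inner_left_of_mem_orthogonal hη (this hζ)
  have hval : (⨆ i, U i).topologicalClosure.starProjection ξ = (specSpace a t).spaceᗮ.starProjection ξ := by
    congr 2
  rw [hval, Submodule.starProjection_orthogonal] at h
  have h2 : Tendsto (fun s : Ioi t => ((specSpace a s).proj : H →L[ℂ] H) ξ) Filter.atBot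
      (𝓝 (((specSpace a t).proj : H →L[ℂ] H) ξ)) := by
    have h3 : Tendsto (fun s : Ioi t => ξ - (specSpace a s).compl.space.starProjection ξ)
        Filter.atBot (𝓝 (ξ - (ξ - (specSpace a t).space.starProjection ξ))) :=
      tendsto_const_nhds.sub h
    rw [sub_sub_cancel] at h3
    refine h3.congr fun s => ?_
    change ξ - (specSpace a s).spaceᗮ.starProjection ξ = _
    rw [Submodule.starProjection_orthogonal]
    exact sub_sub_cancel _ _
  exact (tendsto_comp_coe_Ioi_atBot (Order.IsPredPrelimit.of_dense t)).1 h2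

theorem specSpace_eq_bot {a : M.toStarSubalgebra} (h0 : 0 ≤ a) {t : ℝ} (ht : t < 0) :
    (specSpace a t).space = ⊥ := by
  have hsa : IsSelfAdjoint (a : H →L[ℂ] H) := .of_nonneg (show 0 ≤ (a : H →L[ℂ] H) from h0)
  rw [eq_bot_iff]
  intro ξ hξ
  have h1 := re_inner_le_of_mem_specSpace hsa hξ
  have h2 := re_inner_le_of_le (show (0 : H →L[ℂ] H) ≤ a from h0) ξ
  simp only [_root_.zero_apply, inner_zero_left, Complex.zero_re] at h2
  rw [Submodule.mem_bot, ← norm_eq_zero]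
  have h3 : 0 ≤ t * ‖ξ‖ ^ 2 := h2.trans h1
  by_contra h
  have h4 : 0 < ‖ξ‖ ^ 2 := by positivity
  nlinarith

theorem specSpace_eq_top {a : M.toStarSubalgebra} (ha : IsSelfAdjoint (a : H →L[ℂ] H)) {t : ℝ}
    (ht : ‖(a : H →L[ℂ] H)‖ < t) : (specSpace a t).space = ⊤ := by
  rw [← Submodule.orthogonal_eq_bot_iff, eq_bot_iff]
  intro ξ hξ
  have h1 := le_re_inner_of_mem_compl_specSpace ha hξ
  have h2 : (⟪(a : H →L[ℂ] H) ξ, ξ⟫_ℂ).re ≤ ‖(a : H →L[ℂ] H)‖ * ‖ξ‖ ^ 2 := by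
    refine (Complex.re_le_norm _).trans ((norm_inner_le_norm _ _).trans ?_)
    rw [sq, ← mul_assoc]
    exact mul_le_mul_of_nonneg_right ((a : H →L[ℂ] H).le_opNorm ξ) (norm_nonneg _)
  rw [Submodule.mem_bot, ← norm_eq_zero]
  by_contra h
  have h4 : 0 < ‖ξ‖ ^ 2 := by positivity
  nlinarith

end SpecSpace

/-! ### Spectral families -/

/-- Over a partition into n + 1 equal steps the bounds telescope to (y − x)(m y − m x)/(n + 1),
which tends to 0. The hypothesis holds for the difference of two functions whose increments both lie
between s·Δm and t·Δm; this identifies a quadratic form with its Stieltjes integral. -/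
theorem eq_of_abs_sub_le_mul {d m : ℝ → ℝ} {x y : ℝ} (hxy : x ≤ y)
    (h : ∀ s t, s ≤ t → |d t - d s| ≤ (t - s) * (m t - m s)) : d x = d y := by
  have hn : ∀ n : ℕ, |d y - d x| ≤ (y - x) * (m y - m x) / ((n : ℝ) + 1) := by
    intro n
    have hn0 : (0 : ℝ) < (n : ℝ) + 1 := by positivity
    set p : ℕ → ℝ := fun k => x + k * ((y - x) / ((n : ℝ) + 1)) with hp
    have hstep : ∀ k, p (k + 1) - p k = (y - x) / ((n : ℝ) + 1) := fun k => by
      simp only [hp]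
      push_cast
      ring
    have hle : ∀ k, p k ≤ p (k + 1) := fun k => by
      have : 0 ≤ (y - x) / ((n : ℝ) + 1) := div_nonneg (sub_nonneg.2 hxy) hn0.le
      linarith [hstep k]
    have h0 : p 0 = x := by simp [hp]
    have h1 : p (n + 1) = y := by
      simp only [hp]
      push_cast
      field_simp
      ring
    have hsum : ∀ g : ℝ → ℝ, ∑ k ∈ Finset.range (n + 1), (g (p (k + 1)) - g (p k))
        = g y - g x := fun g => by
      rw [Finset.sum_range_sub (fun k => g (p k)), h0, h1]
    calc |d y - d x| = |∑ k ∈ Finset.range (n + 1), (d (p (k + 1)) - d (p k))| := by rw [hsum d]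
      _ ≤ ∑ k ∈ Finset.range (n + 1), |d (p (k + 1)) - d (p k)| := Finset.abs_sum_le_sum_abs _ _
      _ ≤ ∑ k ∈ Finset.range (n + 1), (y - x) / ((n : ℝ) + 1) * (m (p (k + 1)) - m (p k)) :=
          Finset.sum_le_sum fun k _ => by
            have := h _ _ (hle k)
            rwa [hstep] at this
      _ = _ := by
          rw [← Finset.mul_sum, hsum m]
          ring
  have hlim : Tendsto (fun n : ℕ => (y - x) * (m y - m x) / ((n : ℝ) + 1)) Filter.atTop (𝓝 0) := by
    have := (tendsto_one_div_add_atTop_nhds_zero_nat (𝕜 := ℝ)).const_mul ((y - x) * (m y - m x))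
    rw [mul_zero] at this
    refine this.congr fun n => by ring
  have h0 : |d y - d x| ≤ 0 := ge_of_tendsto' hlim hn
  have := abs_eq_zero.1 (le_antisymm h0 (abs_nonneg _))
  linarith

namespace SpectralFamily

variable {M : VonNeumannAlgebra H} (E : SpectralFamily M)

theorem form_apply (ξ : H) (t : ℝ) : E.form ξ t = (⟪(E.e t : H →L[ℂ] H) ξ, ξ⟫_ℂ).re := rfl

theorem form_eq_norm_sq (ξ : H) (t : ℝ) : E.form ξ t = ‖(E.e t : H →L[ℂ] H) ξ‖ ^ 2 := by
  have h1 : (E.e t : H →L[ℂ] H) ((E.e t : H →L[ℂ] H) ξ) = (E.e t : H →L[ℂ] H) ξ :=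
    congrArg (fun X : M.toStarSubalgebra => (X : H →L[ℂ] H) ξ) (E.isProj t).isIdempotentElem.eq
  have h2 : IsSelfAdjoint (E.e t : H →L[ℂ] H) :=
    congrArg Subtype.val (E.isProj t).isSelfAdjoint
  rw [form_apply, ← re_inner_self, ← adjoint_inner_eq_of_isSelfAdjoint h2, h1]

theorem e_mul_of_le {s t : ℝ} (h : s ≤ t) (ξ : H) :
    (E.e t : H →L[ℂ] H) ((E.e s : H →L[ℂ] H) ξ) = (E.e s : H →L[ℂ] H) ξ := by
  have hle : (InvSubspace.ofProj (E.e s)).proj ≤ (InvSubspace.ofProj (E.e t)).proj := by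
    rw [InvSubspace.proj_ofProj (E.isProj s), InvSubspace.proj_ofProj (E.isProj t)]
    exact E.mono h
  have h2 := Submodule.starProjection_le_starProjection_iff.1
    (show (InvSubspace.ofProj (E.e s)).space.starProjection
      ≤ (InvSubspace.ofProj (E.e t)).space.starProjection from hle)
  rw [← InvSubspace.mem_ofProj]
  refine h2 ?_
  rw [InvSubspace.mem_ofProj]
  exact congrArg (fun X : M.toStarSubalgebra => (X : H →L[ℂ] H) ξ) (E.isProj s).isIdempotentElem.eq

theorem form_tendsto_atBot (ξ : H) : Tendsto (E.form ξ) Filter.atBot (𝓝 0) := by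
  have h := (Complex.continuous_re.tendsto _).comp
    ((E.atBot ξ).inner (tendsto_const_nhds (x := ξ) (f := Filter.atBot)) (𝕜 := ℂ))
  rw [inner_zero_left] at h
  exact h

theorem form_tendsto_atTop (ξ : H) : Tendsto (E.form ξ) Filter.atTop (𝓝 (‖ξ‖ ^ 2)) := by
  have h := (Complex.continuous_re.tendsto _).comp
    ((E.atTop ξ).inner (tendsto_const_nhds (x := ξ) (f := Filter.atTop)) (𝕜 := ℂ))
  rw [re_inner_self] at h
  exact h

theorem form_measure_univ (ξ : H) :
    (E.form ξ).measure univ = ENNReal.ofReal (‖ξ‖ ^ 2) := by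
  rw [StieltjesFunction.measure_univ _ (E.form_tendsto_atBot ξ) (E.form_tendsto_atTop ξ), sub_zero]

instance (ξ : H) : IsFiniteMeasure (E.form ξ).measure :=
  ⟨by rw [form_measure_univ]; exact ENNReal.ofReal_lt_top⟩

theorem form_measure_Iic {ξ : H} {t : ℝ} (h : (E.e t : H →L[ℂ] H) ξ = 0) :
    (E.form ξ).measure (Iic t) = 0 := by
  rw [StieltjesFunction.measure_Iic _ (E.form_tendsto_atBot ξ), form_eq_norm_sq, h]
  simp

theorem form_measure_Ioi {ξ : H} {t : ℝ} (h : (E.e t : H →L[ℂ] H) ξ = ξ) :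
    (E.form ξ).measure (Ioi t) = 0 := by
  rw [StieltjesFunction.measure_Ioi _ (E.form_tendsto_atTop ξ), form_eq_norm_sq, h]
  simp

theorem ae_mem_Ioc {ξ : H} {s t : ℝ} (h0 : (E.e s : H →L[ℂ] H) ξ = 0)
    (h : (E.e t : H →L[ℂ] H) ξ = ξ) : ∀ᵐ u ∂(E.form ξ).measure, u ∈ Ioc s t := by
  have h1 : ∀ᵐ u ∂(E.form ξ).measure, u ∉ Iic s :=
    measure_eq_zero_iff_ae_notMem.1 (E.form_measure_Iic h0)
  have h2 : ∀ᵐ u ∂(E.form ξ).measure, u ∉ Ioi t :=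
    measure_eq_zero_iff_ae_notMem.1 (E.form_measure_Ioi h)
  filter_upwards [h1, h2] with u hu1 hu2
  exact ⟨not_le.1 hu1, not_lt.1 hu2⟩

theorem integrable_of_ae_mem_Ioc {ξ : H} {s t : ℝ}
    (h : ∀ᵐ u ∂(E.form ξ).measure, u ∈ Ioc s t) :
    Integrable (fun u : ℝ => u) (E.form ξ).measure := by
  refine Integrable.of_bound measurable_id.aestronglyMeasurable (max |s| |t|) ?_
  filter_upwards [h] with u hu
  exact abs_le_max_abs_abs hu.1.le hu.2

theorem integral_const_form (ξ : H) (c : ℝ) :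
    ∫ _, c ∂(E.form ξ).measure = c * ‖ξ‖ ^ 2 := by
  rw [integral_const, Measure.real, form_measure_univ, ENNReal.toReal_ofReal (by positivity),
    smul_eq_mul, mul_comm]

theorem integral_mem_Icc {ξ : H} {s t : ℝ} (h0 : (E.e s : H →L[ℂ] H) ξ = 0)
    (h : (E.e t : H →L[ℂ] H) ξ = ξ) :
    ∫ u, u ∂(E.form ξ).measure ∈ Icc (s * ‖ξ‖ ^ 2) (t * ‖ξ‖ ^ 2) := by
  have hae := E.ae_mem_Ioc h0 h
  rw [← E.integral_const_form ξ s, ← E.integral_const_form ξ t]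
  constructor
  · refine integral_mono_ae (integrable_const s) (E.integrable_of_ae_mem_Ioc hae) ?_
    filter_upwards [hae] with u hu using hu.1.le
  · refine integral_mono_ae (E.integrable_of_ae_mem_Ioc hae) (integrable_const t) ?_
    filter_upwards [hae] with u hu using hu.2

theorem lintegral_sq_lt_top {ξ : H} {s t : ℝ} (h0 : (E.e s : H →L[ℂ] H) ξ = 0)
    (h : (E.e t : H →L[ℂ] H) ξ = ξ) :
    ∫⁻ u, ENNReal.ofReal (u ^ 2) ∂(E.form ξ).measure < ∞ := by
  have hae := E.ae_mem_Ioc h0 h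
  refine lt_of_le_of_lt (lintegral_mono_ae (g := fun _ => ENNReal.ofReal ((max |s| |t|) ^ 2)) ?_) ?_
  · filter_upwards [hae] with u hu
    refine ENNReal.ofReal_le_ofReal ?_
    rw [← sq_abs u]
    exact pow_le_pow_left₀ (abs_nonneg _) (abs_le_max_abs_abs hu.1.le hu.2) 2
  · rw [lintegral_const]
    exact ENNReal.mul_lt_top ENNReal.ofReal_lt_top (measure_lt_top _ _)

end SpectralFamily

/-! ### Bounded operators as elements of the Arens algebra -/

section Bounded

variable {M : VonNeumannAlgebra H}

/-- The spectral family of a positive element of `M`. -/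
def specFamily (a : M.toStarSubalgebra) (h0 : 0 ≤ a) : SpectralFamily M where
  e t := (specSpace a t).proj
  isProj t := (specSpace a t).isProj
  mono _ _ h := InvSubspace.proj_le_proj (specSpace_mono a h)
  right_cont t ξ := specSpace_proj_tendsto
    (.of_nonneg (show 0 ≤ (a : H →L[ℂ] H) from h0)) t ξ
  atBot ξ := by
    refine tendsto_const_nhds.congr' ?_
    filter_upwards [eventually_lt_atBot 0] with t ht
    rw [(InvSubspace.proj_eq_zero_iff _).2 (specSpace_eq_bot h0 ht)]
    simp
  atTop ξ := by
    refine tendsto_const_nhds.congr' ?_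
    filter_upwards [eventually_gt_atTop ‖(a : H →L[ℂ] H)‖] with t ht
    symm
    rw [InvSubspace.proj_apply_eq_self_iff,
      specSpace_eq_top (.of_nonneg (show 0 ≤ (a : H →L[ℂ] H) from h0)) ht]
    trivial

theorem specFamily_e (a : M.toStarSubalgebra) (h0 : 0 ≤ a) (t : ℝ) :
    (specFamily a h0).e t = (specSpace a t).proj := rfl

theorem specFamily_e_eq_zero {a : M.toStarSubalgebra} (h0 : 0 ≤ a) {t : ℝ} (ht : t < 0) :
    (specFamily a h0).e t = 0 :=
  (InvSubspace.proj_eq_zero_iff _).2 (specSpace_eq_bot h0 ht)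

theorem specFamily_e_eq_one {a : M.toStarSubalgebra} (h0 : 0 ≤ a) {t : ℝ}
    (ht : ‖(a : H →L[ℂ] H)‖ < t) : (specFamily a h0).e t = 1 := by
  apply Subtype.ext
  ext ξ
  refine (InvSubspace.proj_apply_eq_self_iff _).2 ?_
  rw [specSpace_eq_top (.of_nonneg (show 0 ≤ (a : H →L[ℂ] H) from h0)) ht]
  trivial

theorem specSpace_proj_commute {a : M.toStarSubalgebra} (ha : IsSelfAdjoint (a : H →L[ℂ] H))
    (t : ℝ) (ξ : H) : (a : H →L[ℂ] H) (((specSpace a t).proj : H →L[ℂ] H) ξ)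
      = ((specSpace a t).proj : H →L[ℂ] H) ((a : H →L[ℂ] H) ξ) := by
  symm
  apply Submodule.eq_starProjection_of_mem_of_inner_eq_zero
  · exact apply_mem_specSpace t (InvSubspace.proj_apply_mem _ _)
  · intro η hη
    rw [← map_sub, adjoint_inner_eq_of_isSelfAdjoint ha]
    exact (specSpace a t).space.starProjection_inner_eq_zero _ _ (apply_mem_specSpace t hη)

theorem re_inner_eq_integral {a : M.toStarSubalgebra} (h0 : 0 ≤ a) (ξ : H) :
    (⟪(a : H →L[ℂ] H) ξ, ξ⟫_ℂ).re = ∫ t, t ∂((specFamily a h0).form ξ).measure := by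
  have hsa : IsSelfAdjoint (a : H →L[ℂ] H) := .of_nonneg (show 0 ≤ (a : H →L[ℂ] H) from h0)
  set E := specFamily a h0 with hE
  set R : ℝ := ‖(a : H →L[ℂ] H)‖ + 1
  have hR : ‖(a : H →L[ℂ] H)‖ < R := lt_add_one _
  have hR0 : -1 ≤ R := by linarith [norm_nonneg (a : H →L[ℂ] H)]
  have hb : (E.e (-1) : H →L[ℂ] H) ξ = 0 := by
    rw [hE, specFamily_e_eq_zero h0 (by norm_num)]
    rfl
  have ht : (E.e R : H →L[ℂ] H) ξ = ξ := by
    rw [hE, specFamily_e_eq_one h0 hR]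
    rfl
  have hint : Integrable (fun u : ℝ => u) (E.form ξ).measure :=
    E.integrable_of_ae_mem_Ioc (E.ae_mem_Ioc hb ht)
  let k : ℝ → ℝ := fun t => (⟪(a : H →L[ℂ] H) ((E.e t : H →L[ℂ] H) ξ), ξ⟫_ℂ).re
  let J : ℝ → ℝ := fun t => ∫ u in Ioc (-1) t, u ∂(E.form ξ).measure
  let m : ℝ → ℝ := fun t => E.form ξ t
  -- The increment of k is the form of a at ζ = (e_t − e_s)ξ, on which the spectral subspaces bound
  -- a between s and t; the increment of m is the squared norm of ζ.
  have hk : ∀ s t, s ≤ t → k t - k s ∈ Icc (s * (m t - m s)) (t * (m t - m s)) := by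
    intro s t hst
    set ζ := (E.e t : H →L[ℂ] H) ξ - (E.e s : H →L[ℂ] H) ξ with hζ
    have hcomp : (E.e s : H →L[ℂ] H) ζ = 0 := by
      rw [hζ, map_sub, sub_eq_zero, E.e_mul_of_le le_rfl]
      have h3 : E.e s * E.e t = E.e s := by
        have h4 : E.e t * E.e s = E.e s := by
          apply Subtype.ext
          ext η
          exact E.e_mul_of_le hst η
        have := congrArg star h4
        rwa [star_mul, (E.isProj s).isSelfAdjoint.star_eq,
          (E.isProj t).isSelfAdjoint.star_eq] at this
      exact congrArg (fun X : M.toStarSubalgebra => (X : H →L[ℂ] H) ξ) h3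
    have hcomp' : (E.e t : H →L[ℂ] H) ζ = ζ := by
      rw [hζ, map_sub, E.e_mul_of_le le_rfl, E.e_mul_of_le hst]
    have hmem : ζ ∈ (specSpace a t).space :=
      (InvSubspace.proj_apply_eq_self_iff _).1 hcomp'
    have hmem' : ζ ∈ (specSpace a s).compl.space :=
      (Submodule.starProjection_apply_eq_zero_iff _).1 hcomp
    have hsat : IsSelfAdjoint (E.e t : H →L[ℂ] H) :=
      congrArg Subtype.val (E.isProj t).isSelfAdjoint
    have hsas : IsSelfAdjoint (E.e s : H →L[ℂ] H) :=
      congrArg Subtype.val (E.isProj s).isSelfAdjoint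
    have hζξ : ∀ x : H, (E.e t : H →L[ℂ] H) x = x → (E.e s : H →L[ℂ] H) x = 0 →
        ⟪x, ξ⟫_ℂ = ⟪x, ζ⟫_ℂ := fun x hx hx' => by
      rw [hζ, inner_sub_right, ← adjoint_inner_eq_of_isSelfAdjoint hsat,
        ← adjoint_inner_eq_of_isSelfAdjoint hsas, hx, hx', inner_zero_left, sub_zero]
    have e1 : k t - k s = (⟪(a : H →L[ℂ] H) ζ, ζ⟫_ℂ).re := by
      rw [← hζξ, hζ, map_sub, inner_sub_left, Complex.sub_re]
      · rw [hE, specFamily_e, ← specSpace_proj_commute hsa]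
        exact congrArg _ hcomp'
      · rw [hE, specFamily_e, ← specSpace_proj_commute hsa]
        exact (congrArg _ hcomp).trans (map_zero _)
    have e2 : m t - m s = ‖ζ‖ ^ 2 := by
      rw [← re_inner_self, ← hζξ ζ hcomp' hcomp, hζ, inner_sub_left, Complex.sub_re]
      rfl
    rw [e1, e2]
    exact ⟨le_re_inner_of_mem_compl_specSpace hsa hmem', re_inner_le_of_mem_specSpace hsa hmem⟩
  have hJ : ∀ s t, -1 ≤ s → s ≤ t → J t - J s ∈ Icc (s * (m t - m s)) (t * (m t - m s)) := by
    intro s t hs hst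
    have hu : Ioc (-1) t = Ioc (-1) s ∪ Ioc s t := (Ioc_union_Ioc_eq_Ioc hs hst).symm
    have e1 : J t - J s = ∫ u in Ioc s t, u ∂(E.form ξ).measure := by
      simp only [J]
      rw [hu, setIntegral_union (by
          rw [Set.disjoint_left]
          intro u h1 h2
          exact absurd h1.2 (not_le.2 h2.1)) measurableSet_Ioc hint.integrableOn
        hint.integrableOn]
      ring
    have hconst : ∀ c : ℝ, ∫ _ in Ioc s t, c ∂(E.form ξ).measure = c * (m t - m s) := fun c => by
      rw [setIntegral_const, Measure.real, StieltjesFunction.measure_Ioc, ENNReal.toReal_ofReal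
        (sub_nonneg.2 ((E.form ξ).mono hst)), smul_eq_mul, mul_comm]
    rw [e1, ← hconst s, ← hconst t]
    exact ⟨setIntegral_mono_on (integrable_const s).integrableOn hint.integrableOn
        measurableSet_Ioc fun u hu => hu.1.le,
      setIntegral_mono_on hint.integrableOn (integrable_const t).integrableOn
        measurableSet_Ioc fun u hu => hu.2⟩
  -- Both k and J have increments between s·Δm and t·Δm, so k − J is constant on [−1, R]. Truncating
  -- at −1 makes the estimate global, since J is controlled only from −1 on. At −1 both functions
  -- vanish; at R they are the two sides of the claim.
  have hd : (fun t => k (max t (-1)) - J (max t (-1))) (-1) =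
      (fun t => k (max t (-1)) - J (max t (-1))) R := by
    refine eq_of_abs_sub_le_mul (d := fun t => k (max t (-1)) - J (max t (-1))) (m := fun t => m (max t (-1))) hR0 fun s t hst => ?_
    have hst' : max s (-1) ≤ max t (-1) := max_le_max_right _ hst
    obtain ⟨h1, h2⟩ := hk _ _ hst'
    obtain ⟨h3, h4⟩ := hJ _ _ (le_max_right s (-1)) hst'
    have h5 : max t (-1) - max s (-1) ≤ t - s := by
      rcases le_total s (-1) with h | h
      · rcases le_total t (-1) with h' | h'
        · rw [max_eq_right h, max_eq_right h']
          linarith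
        · rw [max_eq_right h, max_eq_left h']
          linarith
      · rw [max_eq_left h, max_eq_left (h.trans hst)]
    have h6 : 0 ≤ m (max t (-1)) - m (max s (-1)) := sub_nonneg.2 ((E.form ξ).mono hst')
    have h7 := mul_le_mul_of_nonneg_right h5 h6
    rw [abs_le]
    constructor <;> nlinarith
  have hk1 : k (-1) = 0 := by simp only [k, hb, map_zero, inner_zero_left, Complex.zero_re]
  have hJ1 : J (-1) = 0 := by simp [J]
  have hkR : k R = (⟪(a : H →L[ℂ] H) ξ, ξ⟫_ℂ).re := by simp only [k, ht]
  have hJR : J R = ∫ t, t ∂(E.form ξ).measure := by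
    simp only [J]
    rw [setIntegral_eq_integral_of_ae_compl_eq_zero]
    filter_upwards [E.ae_mem_Ioc hb ht] with u hu hu'
    exact absurd hu hu'
  simp only [max_self, max_eq_left hR0, hk1, hJ1, hkR, hJR] at hd
  linarith

/-- A bounded operator as a partially defined operator. -/
def ofOp (T : H →L[ℂ] H) : H →ₗ.[ℂ] H := (T : H →ₗ[ℂ] H).toPMap ⊤

theorem ofOp_apply (T : H →L[ℂ] H) (ξ : (ofOp T).domain) : ofOp T ξ = T ξ := rfl

theorem ofOp_isClosed (T : H →L[ℂ] H) : (ofOp T).IsClosed := by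
  have : ((ofOp T).graph : Set (H × H)) = {x | T x.1 = x.2} := by
    ext x
    rw [SetLike.mem_coe, LinearPMap.mem_graph_iff]
    constructor
    · rintro ⟨y, h1, h2⟩
      rw [Set.mem_ofPred_eq, ← h1, ← h2]
      rfl
    · intro h
      exact ⟨⟨x.1, trivial⟩, rfl, h⟩
  rw [LinearPMap.IsClosed, this]
  exact isClosed_eq (T.continuous.comp continuous_fst) continuous_snd

theorem closure_eq_of_isClosed {x : H →ₗ.[ℂ] H} (h : x.IsClosed) : x.closure = x := by
  apply LinearPMap.eq_of_eq_graph
  rw [← h.isClosable.graph_closure_eq_closure_graph]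
  exact IsClosed.submodule_topologicalClosure_eq h

theorem ofOp_adjoint (T : H →L[ℂ] H) : (ofOp T).adjoint = ofOp (star T) :=
  ContinuousLinearMap.toPMap_adjoint_eq_adjoint_toPMap_of_dense T (by simp)

theorem pmul_ofOp (S T : H →L[ℂ] H) : pmul (ofOp S) (ofOp T) = ofOp (S * T) := by
  refine LinearPMap.ext ?_ fun ξ _ _ => rfl
  exact eq_top_iff.2 fun ξ _ => ⟨⟨ξ, trivial⟩, trivial, rfl⟩

theorem add_ofOp (S T : H →L[ℂ] H) : ofOp S + ofOp T = ofOp (S + T) := by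
  refine LinearPMap.ext ?_ fun ξ _ _ => rfl
  exact inf_idem ⊤

theorem smul_ofOp (c : ℂ) (T : H →L[ℂ] H) : c • ofOp T = ofOp (c • T) := rfl

theorem isSpectralFamilyOf_specFamily {a : M.toStarSubalgebra} (h0 : 0 ≤ a) :
    IsSpectralFamilyOf (specFamily a h0) (ofOp (a : H →L[ℂ] H)) := by
  have hsa : IsSelfAdjoint (a : H →L[ℂ] H) := .of_nonneg (show 0 ≤ (a : H →L[ℂ] H) from h0)
  refine ⟨fun ξ => ⟨fun _ => ?_, fun _ => trivial⟩, fun ξ => ?_⟩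
  · refine (specFamily a h0).lintegral_sq_lt_top (s := -1) (t := ‖(a : H →L[ℂ] H)‖ + 1) ?_ ?_
    · rw [specFamily_e_eq_zero h0 (by norm_num)]
      rfl
    · rw [specFamily_e_eq_one h0 (lt_add_one _)]
      rfl
  · rw [← re_inner_eq_integral h0, ofOp_apply]
    apply Complex.ext
    · simp
    · rw [Complex.ofReal_im]
      have h := inner_conj_symm (𝕜 := ℂ) ((a : H →L[ℂ] H) ξ) (ξ : H)
      rw [← adjoint_inner_eq_of_isSelfAdjoint hsa] at h
      exact Complex.conj_eq_iff_im.1 h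

theorem exists_modulus (T : M.toStarSubalgebra) : ∃ a : M.toStarSubalgebra, 0 ≤ a ∧
    a * a = star T * T := by
  have hpos : (0 : H →L[ℂ] H) ≤ ((star T * T : M.toStarSubalgebra) : H →L[ℂ] H) :=
    star_mul_self_nonneg (T : H →L[ℂ] H)
  refine ⟨⟨cfc Real.sqrt ((star T * T : M.toStarSubalgebra) : H →L[ℂ] H),
    cfc_mem M (star T * T).2 _⟩, ?_, ?_⟩
  · exact cfc_nonneg (R := ℝ) (A := H →L[ℂ] H) fun x _ => Real.sqrt_nonneg x
  · apply Subtype.ext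
    change cfc Real.sqrt _ * cfc Real.sqrt _ = ((star T * T : M.toStarSubalgebra) : H →L[ℂ] H)
    rw [← cfc_mul Real.sqrt Real.sqrt _]
    conv_rhs => rw [← cfc_id ℝ ((star T * T : M.toStarSubalgebra) : H →L[ℂ] H)]
    refine cfc_congr fun x hx => ?_
    exact Real.mul_self_sqrt (spectrum_nonneg_of_nonneg hpos hx)

theorem isModulus_ofOp {T a : M.toStarSubalgebra} (h0 : 0 ≤ a) (h : a * a = star T * T) :
    IsModulus (ofOp (T : H →L[ℂ] H)) (ofOp (a : H →L[ℂ] H)) := by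
  have hsa : IsSelfAdjoint (a : H →L[ℂ] H) := .of_nonneg (show 0 ≤ (a : H →L[ℂ] H) from h0)
  refine ⟨?_, fun ξ => ?_, ?_⟩
  · rw [LinearPMap.isSelfAdjoint_def, ofOp_adjoint, hsa.star_eq]
  · have := re_inner_le_of_le (show (0 : H →L[ℂ] H) ≤ a from h0) (ξ : H)
    rw [ofOp_apply]
    simpa using this
  · rw [ofOp_adjoint, pmul_ofOp, pmul_ofOp]
    exact congrArg (fun X : M.toStarSubalgebra => ofOp (X : H →L[ℂ] H)) h

theorem ofOp_mem_measurableOps (τ : FiniteTrace M) (T : M.toStarSubalgebra) :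
    ofOp (T : H →L[ℂ] H) ∈ measurableOps M τ := by
  refine ⟨ofOp_isClosed _, fun w hw _ ξ => ⟨trivial, ?_⟩, fun ε hε => ⟨1, ?_, fun _ => trivial, ?_⟩⟩
  · have h := VonNeumannAlgebra.mem_commutant_iff.1 hw T T.2
    exact (congrArg (fun X => X (ξ : H)) h).symm
  · exact IsStarProjection.one _
  · simpa [FiniteTrace.val] using hε

/-! ### Elementary estimates for Young functions -/

theorem Young.monotoneOn_density {f : ℝ → ℝ} (h0 : f 0 = 0) (hpos : ∀ s, 0 < s → 0 < f s)
    (hmono : MonotoneOn f (Ioi 0)) : MonotoneOn f (Ici 0) := by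
  intro s hs t ht hst
  rcases (mem_Ici.1 hs).eq_or_lt with rfl | hs'
  · rcases (mem_Ici.1 ht).eq_or_lt with rfl | ht'
    · exact le_rfl
    · rw [h0]
      exact (hpos t ht').le
  · exact hmono hs' (hs'.trans_le hst) hst

theorem Young.intervalIntegrable {f : ℝ → ℝ} (hf : MonotoneOn f (Ici 0)) {s t : ℝ} (hs : 0 ≤ s)
    (ht : 0 ≤ t) : IntervalIntegrable f volume s t :=
  (hf.mono fun _ hx => (le_min hs ht).trans hx.1).intervalIntegrable

theorem IsYoung.monotoneOn {φ : ℝ → ℝ} (h : IsYoung φ) : MonotoneOn φ (Ici 0) := by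
  obtain ⟨f, h0, hpos, -, -, hmono, hφ⟩ := h
  have hf := Young.monotoneOn_density h0 hpos hmono
  intro s hs t ht hst
  rw [hφ s hs, hφ t ht, ← intervalIntegral.integral_add_adjacent_intervals
    (Young.intervalIntegrable hf le_rfl hs) (Young.intervalIntegrable hf hs ht)]
  refine le_add_of_nonneg_right (intervalIntegral.integral_nonneg hst fun u hu => ?_)
  have := hf (mem_Ici.2 le_rfl) (mem_Ici.2 ((mem_Ici.1 hs).trans hu.1)) ((mem_Ici.1 hs).trans hu.1)
  rwa [h0] at this

/-- For r ≤ 1 one has φ(r) ≤ r f(1). -/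
theorem IsYoung.exists_small {φ : ℝ → ℝ} (h : IsYoung φ) {ε : ℝ} (hε : 0 < ε) :
    ∃ r, 0 < r ∧ φ r ≤ ε := by
  obtain ⟨f, h0, hpos, -, -, hmono, hφ⟩ := h
  have hf := Young.monotoneOn_density h0 hpos hmono
  have h1 := hpos 1 one_pos
  refine ⟨min 1 (ε / f 1), lt_min one_pos (div_pos hε h1), ?_⟩
  set r := min 1 (ε / f 1)
  have hr : 0 ≤ r := (lt_min one_pos (div_pos hε h1)).le
  rw [hφ r hr]
  calc ∫ s in (0 : ℝ)..r, f s ≤ ∫ _ in (0 : ℝ)..r, f 1 :=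
        intervalIntegral.integral_mono_on hr (Young.intervalIntegrable hf le_rfl hr)
          (by simp) fun u hu => hf (mem_Ici.2 hu.1) (mem_Ici.2 zero_le_one)
            (hu.2.trans (min_le_left _ _))
    _ = r * f 1 := by simp
    _ ≤ ε / f 1 * f 1 := mul_le_mul_of_nonneg_right (min_le_right _ _) h1.le
    _ = ε := div_mul_cancel₀ _ h1.ne'

/-- For t ≥ 1 one has φ(t) ≥ (t − 1) f(1). -/
theorem IsYoung.tendsto_atTop {φ : ℝ → ℝ} (h : IsYoung φ) :
    Tendsto φ Filter.atTop Filter.atTop := by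
  obtain ⟨f, h0, hpos, htop, -, hmono, hφ⟩ := h
  have hf := Young.monotoneOn_density h0 hpos hmono
  have h1 := hpos 1 one_pos
  refine tendsto_atTop_mono' _ (f₁ := fun t => (t - 1) * f 1) ?_
    ((tendsto_atTop_add_const_right _ (-1 : ℝ) tendsto_id).atTop_mul_const h1)
  filter_upwards [eventually_ge_atTop 1] with t ht
  have ht0 : (0 : ℝ) ≤ t := zero_le_one.trans ht
  rw [hφ t ht0, ← intervalIntegral.integral_add_adjacent_intervals
    (Young.intervalIntegrable hf le_rfl zero_le_one) (Young.intervalIntegrable hf zero_le_one ht0)]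
  have e1 : 0 ≤ ∫ s in (0 : ℝ)..1, f s := intervalIntegral.integral_nonneg zero_le_one
    fun u hu => by
      have := hf (mem_Ici.2 le_rfl) (mem_Ici.2 hu.1) hu.1
      rwa [h0] at this
  have e2 : (t - 1) * f 1 ≤ ∫ s in (1 : ℝ)..t, f s := by
    calc (t - 1) * f 1 = ∫ _ in (1 : ℝ)..t, f 1 := by simp
      _ ≤ _ := intervalIntegral.integral_mono_on ht (by simp)
        (Young.intervalIntegrable hf zero_le_one ht0) fun u hu =>
          hf (mem_Ici.2 zero_le_one) (mem_Ici.2 (zero_le_one.trans hu.1)) hu.1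
  linarith

/-- The measure dτ(e_t) has total mass τ(1) and does not charge (r, ∞), and φ ≤ φ(r) on [0, r]. -/
theorem traceFun_specFamily_le (τ : FiniteTrace M) {a : M.toStarSubalgebra} (h0 : 0 ≤ a)
    {φ : ℝ → ℝ} (hφ : MonotoneOn φ (Ici 0)) {r : ℝ} (hr : ‖(a : H →L[ℂ] H)‖ < r) :
    traceFun τ φ (specFamily a h0) ≤ ENNReal.ofReal (φ r) * ENNReal.ofReal (τ.val 1) := by
  have hbot : Tendsto ((specFamily a h0).trace τ) Filter.atBot (𝓝 0) := by
    refine tendsto_const_nhds.congr' ?_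
    filter_upwards [eventually_lt_atBot 0] with t ht
    change 0 = τ.val ((specFamily a h0).e t)
    rw [specFamily_e_eq_zero h0 ht]
    simp [FiniteTrace.val]
  have htop : Tendsto ((specFamily a h0).trace τ) Filter.atTop (𝓝 (τ.val 1)) := by
    refine tendsto_const_nhds.congr' ?_
    filter_upwards [eventually_gt_atTop ‖(a : H →L[ℂ] H)‖] with t ht
    change τ.val 1 = τ.val ((specFamily a h0).e t)
    rw [specFamily_e_eq_one h0 ht]
  have hioi : ((specFamily a h0).trace τ).measure (Ioi r) = 0 := by
    rw [StieltjesFunction.measure_Ioi _ htop]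
    change ENNReal.ofReal (τ.val 1 - τ.val ((specFamily a h0).e r)) = 0
    rw [specFamily_e_eq_one h0 hr, sub_self, ENNReal.ofReal_zero]
  rw [traceFun]
  calc ∫⁻ t in Ici (0 : ℝ), ENNReal.ofReal (φ t) ∂((specFamily a h0).trace τ).measure
      ≤ ∫⁻ _ in Ici (0 : ℝ), ENNReal.ofReal (φ r) ∂((specFamily a h0).trace τ).measure := by
        refine lintegral_mono_ae ?_
        filter_upwards [ae_restrict_mem measurableSet_Ici,
          ae_restrict_of_ae (measure_eq_zero_iff_ae_notMem.1 hioi)] with t ht ht'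
        exact ENNReal.ofReal_le_ofReal
          (hφ ht (mem_Ici.2 ((norm_nonneg _).trans hr.le)) (not_lt.1 ht'))
    _ = ENNReal.ofReal (φ r) * ((specFamily a h0).trace τ).measure (Ici 0) := by
        rw [lintegral_const, Measure.restrict_apply_univ]
    _ ≤ ENNReal.ofReal (φ r) * ENNReal.ofReal (τ.val 1) := by
        gcongr
        refine (measure_mono (subset_univ _)).trans_eq ?_
        rw [StieltjesFunction.measure_univ _ hbot htop, sub_zero]

theorem closure_ofOp (T : H →L[ℂ] H) : (ofOp T).closure = ofOp T :=
  closure_eq_of_isClosed (ofOp_isClosed T)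

theorem FiniteTrace.val_one_nonneg (τ : FiniteTrace M) : 0 ≤ τ.val 1 :=
  τ.val_nonneg (show (0 : H →L[ℂ] H) ≤ 1 from zero_le_one' (H →L[ℂ] H))

theorem ofOp_mem_arens (τ : FiniteTrace M) {Λ : Set (ℝ → ℝ)} (hΛ : ∀ φ ∈ Λ, IsYoung φ)
    (T : M.toStarSubalgebra) : ofOp (T : H →L[ℂ] H) ∈ arens M τ Λ := by
  refine mem_iInter₂.2 fun φ hφ => ?_
  obtain ⟨a, ha0, ha⟩ := exists_modulus T
  -- After division by n the modulus has norm below r, and φ(r)τ(1) ≤ τ(1)/(τ(1) + 1) ≤ 1 puts T/n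
  -- in the unit ball.
  obtain ⟨r, hr, hφr⟩ := (hΛ φ hφ).exists_small (ε := 1 / (τ.val 1 + 1))
    (by have := τ.val_one_nonneg; positivity)
  obtain ⟨n, hn⟩ := exists_nat_gt (‖(a : H →L[ℂ] H)‖ / r)
  have hn0 : (0 : ℝ) < n := (div_nonneg (norm_nonneg _) hr.le).trans_lt hn
  have hnC : (n : ℂ) ≠ 0 := by exact_mod_cast hn0.ne'
  have h1 := τ.val_one_nonneg
  set c : ℂ := (((n : ℝ)⁻¹ : ℝ) : ℂ) with hc
  have hcn : (n : ℂ) * c = 1 := by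
    rw [hc]
    push_cast
    exact mul_inv_cancel₀ hnC
  have hc0 : (0 : ℂ) ≤ c := by
    rw [hc]
    exact_mod_cast inv_nonneg.2 hn0.le
  refine ⟨n, by exact_mod_cast hn0, ofOp ((c • T : M.toStarSubalgebra) : H →L[ℂ] H),
    ⟨ofOp_mem_measurableOps τ _, ofOp ((c • a : M.toStarSubalgebra) : H →L[ℂ] H), ?_⟩, ?_⟩
  · have hca0 : 0 ≤ c • a := by
      change (0 : H →L[ℂ] H) ≤ c • (a : H →L[ℂ] H)
      exact smul_nonneg hc0 (show (0 : H →L[ℂ] H) ≤ a from ha0)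
    refine ⟨isModulus_ofOp hca0 ?_, specFamily _ hca0, isSpectralFamilyOf_specFamily hca0, ?_⟩
    · rw [star_smul, smul_mul_smul_comm, smul_mul_smul_comm, ha, hc]
      simp
    · refine (traceFun_specFamily_le τ hca0 (hΛ φ hφ).monotoneOn (r := r) ?_).trans ?_
      · change ‖c • (a : H →L[ℂ] H)‖ < r
        rw [norm_smul, hc, Complex.norm_real, Real.norm_of_nonneg (inv_nonneg.2 hn0.le),
          inv_mul_lt_iff₀ hn0]
        rwa [div_lt_iff₀ hr] at hn
      · rw [← ENNReal.ofReal_mul' h1, ENNReal.ofReal_le_one]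
        calc φ r * τ.val 1 ≤ 1 / (τ.val 1 + 1) * τ.val 1 := mul_le_mul_of_nonneg_right hφr h1
          _ ≤ 1 := by
            rw [one_div, inv_mul_le_iff₀ (by positivity)]
            linarith
  · rw [sscal, smul_ofOp, closure_ofOp]
    congr 1
    change _ = (n : ℂ) • c • (T : H →L[ℂ] H)
    rw [smul_smul, hcn, one_smul]

end Bounded

/-! ### Graphs of the operations on partially defined operators -/

theorem mem_graph_pmul {x y : H →ₗ.[ℂ] H} {ξ ζ : H} :
    (ξ, ζ) ∈ (pmul x y).graph ↔ ∃ η, (ξ, η) ∈ y.graph ∧ (η, ζ) ∈ x.graph := by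
  constructor
  · intro h
    obtain ⟨⟨_, ξ', hξ', rfl⟩, rfl, h2⟩ := (LinearPMap.mem_graph_iff _).1 h
    refine ⟨y ξ', y.mem_graph ξ', ?_⟩
    exact (LinearPMap.mem_graph_iff _).2 ⟨⟨y ξ', hξ'⟩, rfl, h2⟩
  · rintro ⟨η, h1, h2⟩
    obtain ⟨ξ', rfl, rfl⟩ := (LinearPMap.mem_graph_iff _).1 h1
    obtain ⟨η', h3, rfl⟩ := (LinearPMap.mem_graph_iff _).1 h2
    have hη : y ξ' ∈ x.domain := by
      have := η'.2
      rwa [h3] at this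
    refine (LinearPMap.mem_graph_iff _).2 ⟨⟨ξ', ξ', hη, rfl⟩, rfl, ?_⟩
    exact congrArg x (Subtype.ext h3.symm)

theorem mem_graph_add {x y : H →ₗ.[ℂ] H} {ξ ζ : H} :
    (ξ, ζ) ∈ (x + y).graph ↔ ∃ a b, (ξ, a) ∈ x.graph ∧ (ξ, b) ∈ y.graph ∧ ζ = a + b := by
  constructor
  · intro h
    obtain ⟨ξ', rfl, h2⟩ := (LinearPMap.mem_graph_iff _).1 h
    exact ⟨_, _, x.mem_graph ⟨ξ', ξ'.2.1⟩, y.mem_graph ⟨ξ', ξ'.2.2⟩, h2.symm⟩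
  · rintro ⟨a, b, h1, h2, rfl⟩
    obtain ⟨ξ', rfl, rfl⟩ := (LinearPMap.mem_graph_iff _).1 h1
    obtain ⟨ξ'', h3, rfl⟩ := (LinearPMap.mem_graph_iff _).1 h2
    have h4 : (ξ' : H) ∈ y.domain := by
      have := ξ''.2
      rwa [show (ξ'' : H) = ξ' from h3] at this
    refine (LinearPMap.mem_graph_iff _).2 ⟨⟨ξ', ξ'.2, h4⟩, rfl, ?_⟩
    have : ξ'' = ⟨ξ', h4⟩ := Subtype.ext h3
    rw [this]
    rfl

theorem mem_graph_smul {x : H →ₗ.[ℂ] H} {c : ℂ} {ξ ζ : H} :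
    (ξ, ζ) ∈ (c • x).graph ↔ ∃ a, (ξ, a) ∈ x.graph ∧ ζ = c • a := by
  constructor
  · intro h
    obtain ⟨ξ', rfl, h2⟩ := (LinearPMap.mem_graph_iff _).1 h
    exact ⟨_, x.mem_graph ξ', h2.symm⟩
  · rintro ⟨a, h1, rfl⟩
    obtain ⟨ξ', rfl, rfl⟩ := (LinearPMap.mem_graph_iff _).1 h1
    exact (LinearPMap.mem_graph_iff _).2 ⟨ξ', rfl, rfl⟩

theorem mem_graph_ofOp {T : H →L[ℂ] H} {ξ ζ : H} : (ξ, ζ) ∈ (ofOp T).graph ↔ ζ = T ξ := by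
  rw [LinearPMap.mem_graph_iff]
  constructor
  · rintro ⟨ξ', rfl, rfl⟩
    rfl
  · rintro rfl
    exact ⟨⟨ξ, trivial⟩, rfl, rfl⟩

theorem mem_graph_closure {x : H →ₗ.[ℂ] H} {p : H × H} (h : p ∈ x.graph) :
    p ∈ x.closure.graph := LinearPMap.le_graph_of_le x.le_closure h

theorem mem_graph_sprod {x y : H →ₗ.[ℂ] H} {ξ η ζ : H} (h1 : (ξ, η) ∈ y.graph)
    (h2 : (η, ζ) ∈ x.graph) : (ξ, ζ) ∈ (sprod x y).graph :=
  mem_graph_closure (mem_graph_pmul.2 ⟨η, h1, h2⟩)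

theorem mem_graph_sadd {x y : H →ₗ.[ℂ] H} {ξ a b : H} (h1 : (ξ, a) ∈ x.graph)
    (h2 : (ξ, b) ∈ y.graph) : (ξ, a + b) ∈ (sadd x y).graph :=
  mem_graph_closure (mem_graph_add.2 ⟨a, b, h1, h2, rfl⟩)

theorem graph_unique {x : H →ₗ.[ℂ] H} {ξ a b : H} (h1 : (ξ, a) ∈ x.graph)
    (h2 : (ξ, b) ∈ x.graph) : a = b := x.mem_graph_snd_inj h1 h2 rfl

theorem eq_zero_of_forall_mem_graph {x : H →ₗ.[ℂ] H} (h : ∀ ξ, (ξ, (0 : H)) ∈ x.graph) :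
    x = 0 := by
  refine LinearPMap.ext ?_ fun ξ h1 h2 => ?_
  · exact eq_top_iff.2 fun ξ _ => LinearPMap.mem_domain_of_mem_graph (h ξ)
  · exact graph_unique (x.mem_graph ⟨ξ, h1⟩) (h ξ)

theorem zero_eq_ofOp : (0 : H →ₗ.[ℂ] H) = ofOp 0 := by
  symm
  exact eq_zero_of_forall_mem_graph fun ξ => mem_graph_ofOp.2 rfl

/-! ### Measurable operators -/

section Measurable

variable {M : VonNeumannAlgebra H} {τ : FiniteTrace M} {x : H →ₗ.[ℂ] H}

theorem isClosed_of_mem (hx : x ∈ measurableOps M τ) : IsClosed (x.graph : Set (H × H)) := hx.1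

theorem closure_of_mem (hx : x ∈ measurableOps M τ) : x.closure = x :=
  closure_eq_of_isClosed hx.1

/-- For a self-adjoint contraction v the element u = v + i√(1 − v²) is unitary and u + u* = 2v. Here
v = w/r with r = ‖w‖ + 1, whence the scalar r/2. -/
theorem exists_unitary_add (N : VonNeumannAlgebra H) {w : H →L[ℂ] H} (hw : w ∈ N)
    (hsa : IsSelfAdjoint w) : ∃ u ∈ N, u ∈ unitary (H →L[ℂ] H) ∧
      ∃ c : ℂ, w = c • (u + star u) := by
  set r : ℝ := ‖w‖ + 1
  have hr : 0 < r := by positivity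
  set v : H →L[ℂ] H := ((r⁻¹ : ℝ) : ℂ) • w
  have hvN : v ∈ N := N.toStarSubalgebra.smul_mem hw _
  have hvsa : IsSelfAdjoint v := by
    have h : star ((r⁻¹ : ℝ) : ℂ) = ((r⁻¹ : ℝ) : ℂ) := Complex.conj_ofReal _
    rw [IsSelfAdjoint, star_smul, hsa.star_eq, h]
  have hvn : ‖v‖ ≤ 1 := by
    rw [norm_smul, Complex.norm_real, Real.norm_of_nonneg (inv_nonneg.2 hr.le),
      inv_mul_le_iff₀ hr]
    linarith
  have hpos : 0 ≤ 1 - v ^ 2 := by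
    rwa [sub_nonneg, ← CStarAlgebra.norm_le_one_iff_of_nonneg (v ^ 2) hvsa.sq_nonneg, sq,
      hvsa.norm_mul_self, sq_le_one_iff₀ (norm_nonneg _)]
  have hs : CFC.sqrt (1 - v ^ 2) = cfc Real.sqrt (1 - v ^ 2) := by
    rw [CFC.sqrt_eq_real_sqrt (1 - v ^ 2) hpos, cfcₙ_eq_cfc]
  have hsN : CFC.sqrt (1 - v ^ 2) ∈ N := by
    rw [hs]
    exact cfc_mem N (sub_mem (one_mem N) (pow_mem hvN 2)) _
  have hssa : IsSelfAdjoint (CFC.sqrt (1 - v ^ 2)) := .of_nonneg (CFC.sqrt_nonneg _)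
  refine ⟨v + Complex.I • CFC.sqrt (1 - v ^ 2),
    add_mem hvN (N.toStarSubalgebra.smul_mem hsN _),
    hvsa.self_add_I_smul_cfcSqrt_sub_sq_mem_unitary v hvn, (r / 2 : ℝ), ?_⟩
  have hst : star (v + Complex.I • CFC.sqrt (1 - v ^ 2))
      = v + star Complex.I • CFC.sqrt (1 - v ^ 2) :=
    (star_add _ _).trans (congrArg₂ (· + ·) hvsa.star_eq
      ((star_smul _ _).trans (congrArg _ hssa.star_eq)))
  rw [hst]
  have e : v + Complex.I • CFC.sqrt (1 - v ^ 2) + (v + star Complex.I • CFC.sqrt (1 - v ^ 2))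
      = (2 : ℂ) • v := by
    rw [two_smul]
    have : star Complex.I = -Complex.I := Complex.conj_I
    rw [this, neg_smul]
    abel
  rw [e, smul_smul, smul_smul]
  have : ((r / 2 : ℝ) : ℂ) * 2 * ((r⁻¹ : ℝ) : ℂ) = 1 := by
    push_cast
    have : (r : ℂ) ≠ 0 := by exact_mod_cast hr.ne'
    field_simp
  rw [this, one_smul]

/-- A property stable under linear combinations that holds for the self-adjoint elements of a
star subalgebra holds for all its elements. -/
theorem selfAdjoint_induction (N : StarSubalgebra ℂ (H →L[ℂ] H)) {P : (H →L[ℂ] H) → Prop}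
    (hsa : ∀ v ∈ N, IsSelfAdjoint v → P v) (hadd : ∀ u v, P u → P v → P (u + v))
    (hsmul : ∀ (c : ℂ) u, P u → P (c • u)) {w : H →L[ℂ] H} (hw : w ∈ N) : P w := by
  have e : w = (2⁻¹ : ℂ) • ((w + star w) + Complex.I • (Complex.I • (star w - w))) := by
    rw [smul_smul Complex.I, Complex.I_mul_I, neg_one_smul, neg_sub]
    have : w + star w + (w - star w) = (2 : ℂ) • w := by
      rw [two_smul]
      abel
    rw [this, smul_smul]
    norm_num
  rw [e]
  refine hsmul _ _ (hadd _ _ (hsa _ (add_mem hw (star_mem hw)) ?_) (hsmul _ _ (hsa _ ?_ ?_)))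
  · rw [IsSelfAdjoint, star_add, star_star, add_comm]
  · exact N.smul_mem (sub_mem (star_mem hw) hw) _
  · rw [IsSelfAdjoint, star_smul, star_sub, star_star]
    have : star Complex.I = -Complex.I := Complex.conj_I
    rw [this, neg_smul, ← smul_neg, neg_sub]

/-- A property stable under linear combinations that holds for the unitaries of a von Neumann
algebra holds for all its elements. -/
theorem unitary_induction (N : VonNeumannAlgebra H) {P : (H →L[ℂ] H) → Prop}
    (hu : ∀ u ∈ N, u ∈ unitary (H →L[ℂ] H) → P u) (hadd : ∀ u v, P u → P v → P (u + v))
    (hsmul : ∀ (c : ℂ) u, P u → P (c • u)) {w : H →L[ℂ] H} (hw : w ∈ N) : P w := by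
  refine selfAdjoint_induction N.toStarSubalgebra (fun v hv hvsa => ?_) hadd hsmul hw
  obtain ⟨u, huN, huU, c, rfl⟩ := exists_unitary_add N hv hvsa
  exact hsmul _ _ (hadd _ _ (hu u huN huU) (hu _ (star_mem huN) (Unitary.star_mem huU)))

/-- A self-adjoint operator is an affine image of a positive contraction. -/
theorem exists_affine_positive (N : StarSubalgebra ℂ (H →L[ℂ] H)) {w : H →L[ℂ] H} (hw : w ∈ N)
    (hsa : IsSelfAdjoint w) {n : ℕ} (hn : ‖w‖ ≤ n) (hn0 : 0 < n) :
    ∃ T ∈ N, 0 ≤ T ∧ T ≤ 1 ∧ w = (n : ℂ) • (T + T - 1) := by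
  have hnC : (n : ℂ) ≠ 0 := by exact_mod_cast hn0.ne'
  have hnR : (0 : ℝ) < n := by exact_mod_cast hn0
  -- T = w/(2n) + 1/2: as ‖w‖ ≤ n, the form of w/(2n) is at most 1/2 in modulus on unit vectors.
  set T : H →L[ℂ] H := (((2 * n : ℝ)⁻¹ : ℝ) : ℂ) • w + (2⁻¹ : ℂ) • 1 with hT
  have hTsa : IsSelfAdjoint T := by
    have h1 : star (((2 * n : ℝ)⁻¹ : ℝ) : ℂ) = (((2 * n : ℝ)⁻¹ : ℝ) : ℂ) := Complex.conj_ofReal _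
    have h2 : star (2⁻¹ : ℂ) = 2⁻¹ := by simp
    rw [IsSelfAdjoint, hT, star_add, star_smul, star_smul, hsa.star_eq, star_one, h1, h2]
  have hform : ∀ ξ, (⟪T ξ, ξ⟫_ℂ).re = (2 * n : ℝ)⁻¹ * (⟪w ξ, ξ⟫_ℂ).re + 2⁻¹ * ‖ξ‖ ^ 2 := fun ξ => by
    have h2 : (2⁻¹ : ℂ) = ((2⁻¹ : ℝ) : ℂ) := by push_cast; rfl
    rw [hT, h2, _root_.add_apply, _root_.smul_apply, _root_.smul_apply, one_apply_eq_self,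
      inner_add_left, inner_smul_left, inner_smul_left, Complex.conj_ofReal, Complex.conj_ofReal,
      Complex.add_re, Complex.re_ofReal_mul, Complex.re_ofReal_mul, re_inner_self]
  have hbd : ∀ ξ, |(2 * n : ℝ)⁻¹ * (⟪w ξ, ξ⟫_ℂ).re| ≤ 2⁻¹ * ‖ξ‖ ^ 2 := fun ξ => by
    have h1 : |(⟪w ξ, ξ⟫_ℂ).re| ≤ n * ‖ξ‖ ^ 2 := by
      refine (Complex.abs_re_le_norm _).trans ((norm_inner_le_norm _ _).trans ?_)
      rw [sq, ← mul_assoc]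
      exact mul_le_mul_of_nonneg_right ((w.le_opNorm ξ).trans
        (mul_le_mul_of_nonneg_right hn (norm_nonneg _))) (norm_nonneg _)
    rw [abs_mul, abs_of_pos (by positivity)]
    refine (mul_le_mul_of_nonneg_left h1 (by positivity)).trans_eq ?_
    field_simp
  refine ⟨T, add_mem (N.smul_mem hw _) (N.smul_mem (one_mem N) _), ?_, ?_, ?_⟩
  · refine le_of_re_inner_le (.zero _) hTsa fun ξ => ?_
    rw [hform]
    have := (abs_le.1 (hbd ξ)).1
    simp only [_root_.zero_apply, inner_zero_left, Complex.zero_re]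
    linarith
  · refine le_of_re_inner_le hTsa (.one _) fun ξ => ?_
    rw [hform, one_apply_eq_self, re_inner_self]
    have := (abs_le.1 (hbd ξ)).2
    linarith
  · have h1 : T + T - 1 = ((n : ℂ)⁻¹) • w := by
      rw [hT]
      have : (((2 * n : ℝ)⁻¹ : ℝ) : ℂ) = 2⁻¹ * (n : ℂ)⁻¹ := by
        push_cast
        rw [mul_inv]
      rw [this, ← two_smul ℂ, smul_add, smul_smul, smul_smul, ← mul_assoc,
        mul_inv_cancel₀ (two_ne_zero), one_mul, one_smul, add_sub_cancel_right]
    rw [h1, smul_smul, mul_inv_cancel₀ hnC, one_smul]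

/-- A property stable under linear combinations that holds for the positive contractions of a star
subalgebra holds for all its elements. -/
theorem positive_induction (N : StarSubalgebra ℂ (H →L[ℂ] H)) {P : (H →L[ℂ] H) → Prop}
    (hpos : ∀ v ∈ N, 0 ≤ v → v ≤ 1 → P v) (hadd : ∀ u v, P u → P v → P (u + v))
    (hsmul : ∀ (c : ℂ) u, P u → P (c • u)) {w : H →L[ℂ] H} (hw : w ∈ N) : P w := by
  refine selfAdjoint_induction N (fun v hv hvsa => ?_) hadd hsmul hw
  obtain ⟨n, hn⟩ := exists_nat_gt ‖v‖
  have hn0 : 0 < n := by exact_mod_cast (norm_nonneg v).trans_lt hn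
  obtain ⟨T, hT, h0, h1, rfl⟩ := exists_affine_positive N hv hvsa hn.le hn0
  have hPT := hpos T hT h0 h1
  have hP1 := hsmul (-1) _ (hpos 1 (one_mem N) (zero_le_one' (H →L[ℂ] H)) le_rfl)
  have := hadd _ _ (hadd _ _ hPT hPT) hP1
  rw [neg_one_smul, ← sub_eq_add_neg] at this
  exact hsmul _ _ this

/-- Affiliation speaks of unitaries of the commutant only; they span it, and the graph is a linear
subspace. -/
theorem graph_invariant (hx : IsAffiliated M x) {w : H →L[ℂ] H} (hw : w ∈ M.commutant) :
    ∀ ξ ζ, (ξ, ζ) ∈ x.graph → (w ξ, w ζ) ∈ x.graph := by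
  refine unitary_induction M.commutant (P := fun w => ∀ ξ ζ, (ξ, ζ) ∈ x.graph →
    (w ξ, w ζ) ∈ x.graph) ?_ ?_ ?_ hw
  · intro u huM huU ξ ζ h
    obtain ⟨ξ', rfl, rfl⟩ := (LinearPMap.mem_graph_iff _).1 h
    obtain ⟨h1, h2⟩ := hx u huM huU ξ'
    exact (LinearPMap.mem_graph_iff _).2 ⟨⟨_, h1⟩, rfl, h2.symm⟩
  · intro u v hu hv ξ ζ h
    exact add_mem (hu ξ ζ h) (hv ξ ζ h)
  · intro c u hu ξ ζ h
    exact Submodule.smul_mem _ c (hu ξ ζ h)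

/-- The kernel of a closed affiliated operator. -/
def graphKer (hx : x ∈ measurableOps M τ) : InvSubspace M where
  space := x.graph.comap (LinearMap.inl ℂ H H)
  isClosed := (isClosed_of_mem hx).preimage (continuous_id.prodMk continuous_const)
  inv w hw ξ hξ := by
    have h := graph_invariant hx.2.1 hw ξ 0 hξ
    rw [map_zero] at h
    exact h

theorem mem_graphKer (hx : x ∈ measurableOps M τ) {ξ : H} :
    ξ ∈ (graphKer hx).space ↔ (ξ, (0 : H)) ∈ x.graph := Iff.rfl

theorem exists_invSubspace_le_domain (hx : x ∈ measurableOps M τ) {ε : ℝ} (hε : 0 < ε) :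
    ∃ K : InvSubspace M, (∀ ξ ∈ K.space, ∃ ζ, (ξ, ζ) ∈ x.graph) ∧ rank τ K.compl < ε := by
  obtain ⟨p, hp, hdom, hlt⟩ := hx.2.2 ε hε
  refine ⟨InvSubspace.ofProj p, fun ξ hξ => ?_, ?_⟩
  · have h := hdom ξ
    rw [InvSubspace.mem_ofProj.1 hξ] at h
    exact ⟨_, x.mem_graph ⟨ξ, h⟩⟩
  · rwa [rank, InvSubspace.proj_compl, InvSubspace.proj_ofProj hp]

theorem space_eq_top_of_forall_rank_compl_le {K : InvSubspace M}
    (h : ∀ ε, 0 < ε → rank τ K.compl ≤ ε) : K.space = ⊤ := by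
  have h0 : rank τ K.compl = 0 :=
    le_antisymm (le_of_forall_pos_le_add fun ε hε => by simpa using h ε hε) (rank_nonneg τ _)
  exact Submodule.orthogonal_eq_bot_iff.1 ((rank_eq_zero_iff τ _).1 h0)

/-- The closure of the domain is invariant under the commutant and contains invariant subspaces of
arbitrarily small codimension, so faithfulness of the trace makes it everything. -/
theorem dense_domain (hx : x ∈ measurableOps M τ) : Dense (x.domain : Set H) := by
  let K : InvSubspace M :=
    { space := x.domain.topologicalClosure
      isClosed := x.domain.isClosed_topologicalClosure
      inv := fun w hw ξ hξ => by
        refine map_mem_closure w.continuous hξ fun η hη => ?_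
        exact LinearPMap.mem_domain_of_mem_graph
          (graph_invariant hx.2.1 hw _ _ (x.mem_graph ⟨η, hη⟩)) }
  refine Submodule.dense_iff_topologicalClosure_eq_top.2 ?_
  refine space_eq_top_of_forall_rank_compl_le (τ := τ) (K := K) fun ε hε => ?_
  obtain ⟨L, hL, hlt⟩ := exists_invSubspace_le_domain hx hε
  refine (rank_mono τ (Submodule.orthogonal_le fun ξ hξ => ?_)).trans hlt.le
  obtain ⟨ζ, hζ⟩ := hL ξ hξ
  exact x.domain.le_topologicalClosure (LinearPMap.mem_domain_of_mem_graph hζ)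

end Measurable

/-! ### Spectral cuts of the modulus -/

section Modulus

variable {M : VonNeumannAlgebra H} {a : H →ₗ.[ℂ] H} {E : SpectralFamily M}

theorem SpectralFamily.e_mul_self (E : SpectralFamily M) (t : ℝ) (ξ : H) :
    (E.e t : H →L[ℂ] H) ((E.e t : H →L[ℂ] H) ξ) = (E.e t : H →L[ℂ] H) ξ :=
  E.e_mul_of_le le_rfl ξ

theorem SpectralFamily.e_isSelfAdjoint (E : SpectralFamily M) (t : ℝ) :
    IsSelfAdjoint (E.e t : H →L[ℂ] H) := congrArg Subtype.val (E.isProj t).isSelfAdjoint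

theorem SpectralFamily.e_mul_of_ge (E : SpectralFamily M) {s t : ℝ} (h : s ≤ t) (ξ : H) :
    (E.e s : H →L[ℂ] H) ((E.e t : H →L[ℂ] H) ξ) = (E.e s : H →L[ℂ] H) ξ := by
  have h4 : E.e t * E.e s = E.e s := by
    apply Subtype.ext
    ext η
    exact E.e_mul_of_le h η
  have h3 := congrArg star h4
  rw [star_mul, (E.isProj s).isSelfAdjoint.star_eq, (E.isProj t).isSelfAdjoint.star_eq] at h3
  exact congrArg (fun X : M.toStarSubalgebra => (X : H →L[ℂ] H) ξ) h3

theorem isSymmetric_of_isSelfAdjoint (ha : IsSelfAdjoint a) (ξ η : a.domain) :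
    ⟪a ξ, (η : H)⟫_ℂ = ⟪(ξ : H), a η⟫_ℂ := by
  have h := LinearPMap.adjoint_isFormalAdjoint (T := a) ha.dense_domain
  rw [LinearPMap.isSelfAdjoint_def.1 ha] at h
  exact h ξ η

/-- For r < t < 0, on the range of e_t − e_r the form of a is at most t‖ζ‖², yet it is nonnegative;
so that range is zero. Hence e_r does not change for r below t, and it tends to 0 at −∞. -/
theorem e_eq_zero_of_neg (hpos : ∀ ξ : a.domain, 0 ≤ (⟪a ξ, (ξ : H)⟫_ℂ).re)
    (hE : IsSpectralFamilyOf E a) {t : ℝ} (ht : t < 0) (ξ : H) :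
    (E.e t : H →L[ℂ] H) ξ = 0 := by
  set η := (E.e t : H →L[ℂ] H) ξ
  have hη : (E.e t : H →L[ℂ] H) η = η := E.e_mul_self t ξ
  have h1 : ∀ r, r < t → (E.e r : H →L[ℂ] H) η = η := by
    intro r hr
    set ζ := η - (E.e r : H →L[ℂ] H) η with hζ
    have h2 : (E.e r : H →L[ℂ] H) ζ = 0 := by rw [hζ, map_sub, E.e_mul_self, sub_self]
    have h3 : (E.e t : H →L[ℂ] H) ζ = ζ := by rw [hζ, map_sub, E.e_mul_of_le hr.le, hη]
    have hdom : ζ ∈ a.domain := (hE.1 ζ).2 (E.lintegral_sq_lt_top h2 h3)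
    have h4 := hpos ⟨ζ, hdom⟩
    rw [hE.2 ⟨ζ, hdom⟩, Complex.ofReal_re] at h4
    have h5 := h4.trans (E.integral_mem_Icc h2 h3).2
    have h6 : ζ = 0 := by
      rw [← norm_eq_zero]
      by_contra h
      have : 0 < ‖ζ‖ ^ 2 := by positivity
      nlinarith
    rw [hζ, sub_eq_zero] at h6
    exact h6.symm
  refine tendsto_nhds_unique (tendsto_const_nhds.congr' ?_) (E.atBot η)
  filter_upwards [eventually_lt_atBot t] with r hr using (h1 r hr).symm

theorem integrable_form_of_mem_domain (hE : IsSpectralFamilyOf E a) {ξ : H}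
    (hξ : ξ ∈ a.domain) : Integrable (fun u : ℝ => u) (E.form ξ).measure := by
  have h2 : Integrable (fun u : ℝ => u ^ 2) (E.form ξ).measure := by
    refine ⟨(measurable_id.pow_const 2).aestronglyMeasurable, ?_⟩
    rw [hasFiniteIntegral_iff_ofReal (Eventually.of_forall fun u => sq_nonneg u)]
    exact (hE.1 ξ).1 hξ
  refine (h2.add (integrable_const 1)).mono' measurable_id.aestronglyMeasurable
    (Eventually.of_forall fun u => ?_)
  simp only [Pi.add_apply, Real.norm_eq_abs]
  nlinarith [sq_abs u, sq_nonneg (|u| - 1), abs_nonneg u]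

/-- `IsSpectralFamilyOf` controls only the quadratic form of a; this lemma extracts from it that e_s
reduces a. The spectral measure of η + ζ is the sum of those of η and ζ, so the form has no cross
term, and the real part of ⟨aη, ζ⟩ vanishes. Replacing ζ by iζ gives the imaginary part. -/
theorem inner_eq_zero_of_e (ha : IsSelfAdjoint a) (hE : IsSpectralFamilyOf E a) {s : ℝ}
    (η ζ : a.domain) (hη : (E.e s : H →L[ℂ] H) η = η) (hζ : (E.e s : H →L[ℂ] H) ζ = 0) :
    ⟪a η, (ζ : H)⟫_ℂ = 0 := by
  have key : ∀ ζ : a.domain, (E.e s : H →L[ℂ] H) ζ = 0 → (⟪a η, (ζ : H)⟫_ℂ).re = 0 := by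
    intro ζ hζ
    have horth : ∀ t, ⟪(E.e t : H →L[ℂ] H) η, (ζ : H)⟫_ℂ = 0 := by
      intro t
      have h1 : (E.e s : H →L[ℂ] H) ((E.e t : H →L[ℂ] H) η) = (E.e t : H →L[ℂ] H) η := by
        rcases le_total t s with h | h
        · exact E.e_mul_of_le h _
        · rw [E.e_mul_of_ge h, hη, ← hη, E.e_mul_of_le h, hη]
      rw [← h1, adjoint_inner_eq_of_isSelfAdjoint (E.e_isSelfAdjoint s), hζ, inner_zero_right]
    have hform : E.form ((η + ζ : a.domain) : H) = E.form η + E.form ζ := by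
      ext t
      rw [StieltjesFunction.add_apply, E.form_apply, E.form_apply, E.form_apply]
      have h2 : ⟪(E.e t : H →L[ℂ] H) ζ, (η : H)⟫_ℂ = 0 := by
        rw [adjoint_inner_eq_of_isSelfAdjoint (E.e_isSelfAdjoint t), ← inner_conj_symm, horth,
          map_zero]
      rw [Submodule.coe_add, map_add, inner_add_left, inner_add_right, inner_add_right, horth, h2]
      simp
    have hq := hE.2 (η + ζ)
    rw [hform, StieltjesFunction.measure_add, integral_add_measure
      (integrable_form_of_mem_domain hE η.2) (integrable_form_of_mem_domain hE ζ.2),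
      Complex.ofReal_add, ← hE.2 η, ← hE.2 ζ, LinearPMap.map_add, Submodule.coe_add,
      inner_add_left, inner_add_right, inner_add_right] at hq
    have hsym : ⟪a ζ, (η : H)⟫_ℂ = starRingEnd ℂ ⟪a η, (ζ : H)⟫_ℂ := by
      rw [isSymmetric_of_isSelfAdjoint ha, inner_conj_symm]
    rw [hsym] at hq
    have := congrArg Complex.re hq
    simp only [Complex.add_re, Complex.conj_re] at this
    linarith
  apply Complex.ext
  · exact key ζ hζ
  · have h := key (Complex.I • ζ) (by rw [Submodule.coe_smul, map_smul, hζ, smul_zero])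
    rw [Submodule.coe_smul, inner_smul_right] at h
    simpa using h

theorem apply_mem_of_e (ha : IsSelfAdjoint a) (hE : IsSpectralFamilyOf E a) {s : ℝ}
    (hdom : ∀ η, (E.e s : H →L[ℂ] H) η = η → η ∈ a.domain)
    (η : a.domain) (hη : (E.e s : H →L[ℂ] H) η = η) : (E.e s : H →L[ℂ] H) (a η) = a η := by
  have h : a η - (E.e s : H →L[ℂ] H) (a η) = 0 := by
    refine ha.dense_domain.eq_zero_of_inner_left ℂ fun ζ hζ => ?_
    have h1 : (E.e s : H →L[ℂ] H) ζ ∈ a.domain := hdom _ (E.e_mul_self s ζ)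
    have h2 := inner_eq_zero_of_e ha hE η ⟨ζ - (E.e s : H →L[ℂ] H) ζ, sub_mem hζ h1⟩ hη
      (by rw [map_sub, E.e_mul_self, sub_self])
    rw [inner_sub_left, adjoint_inner_eq_of_isSelfAdjoint (E.e_isSelfAdjoint s), ← inner_sub_right]
    exact h2
  exact (sub_eq_zero.1 h).symm

theorem mem_domain_of_e (hpos : ∀ ξ : a.domain, 0 ≤ (⟪a ξ, (ξ : H)⟫_ℂ).re)
    (hE : IsSpectralFamilyOf E a) {s : ℝ} {η : H} (hη : (E.e s : H →L[ℂ] H) η = η) :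
    η ∈ a.domain :=
  (hE.1 η).2 (E.lintegral_sq_lt_top
    (e_eq_zero_of_neg hpos hE (show (-1 : ℝ) < 0 by norm_num) η) hη)

theorem re_inner_mem_Icc_of_e (hE : IsSpectralFamilyOf E a) {r s : ℝ} (η : a.domain)
    (hr : (E.e r : H →L[ℂ] H) η = 0) (hη : (E.e s : H →L[ℂ] H) η = η) :
    (⟪a η, (η : H)⟫_ℂ).re ∈ Icc (r * ‖(η : H)‖ ^ 2) (s * ‖(η : H)‖ ^ 2) := by
  rw [hE.2 η, Complex.ofReal_re]
  exact E.integral_mem_Icc hr hη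

theorem norm_apply_le_of_e (ha : IsSelfAdjoint a)
    (hpos : ∀ ξ : a.domain, 0 ≤ (⟪a ξ, (ξ : H)⟫_ℂ).re)
    (hE : IsSpectralFamilyOf E a) {s : ℝ} (hs : 0 < s) (η : a.domain)
    (hη : (E.e s : H →L[ℂ] H) η = η) : ‖a η‖ ≤ s * ‖(η : H)‖ := by
  have hdom : ∀ η, (E.e s : H →L[ℂ] H) η = η → η ∈ a.domain := fun η h =>
    mem_domain_of_e hpos hE h
  have hneg : ∀ η, (E.e (-1) : H →L[ℂ] H) η = 0 := fun η =>
    e_eq_zero_of_neg hpos hE (by norm_num) η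
  have haη := apply_mem_of_e ha hE hdom η hη
  set θ : a.domain := ⟨a η, hdom _ haη⟩ with hθ
  -- A Cauchy–Schwarz argument: expand the form of a at η − s⁻¹aη, which is nonnegative, and use
  -- that the form is at most s times the squared norm at η and at aη. This leaves s⁻¹‖aη‖² ≤ s‖η‖².
  have h1 := hpos (η - ((s⁻¹ : ℝ) : ℂ) • θ)
  have h2 := (re_inner_mem_Icc_of_e hE η (hneg _) hη).2
  have h3 := (re_inner_mem_Icc_of_e hE θ (hneg _) haη).2
  have e1 : (⟪a η, (θ : H)⟫_ℂ).re = ‖a η‖ ^ 2 := re_inner_self _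
  have e2 : (⟪a θ, (η : H)⟫_ℂ).re = ‖a η‖ ^ 2 := by
    rw [isSymmetric_of_isSelfAdjoint ha]
    exact re_inner_self _
  have e3 : ‖(θ : H)‖ = ‖a η‖ := rfl
  rw [LinearPMap.map_sub, LinearPMap.map_smul, Submodule.coe_sub, Submodule.coe_smul,
    inner_sub_left, inner_sub_right, inner_sub_right, inner_smul_left, inner_smul_left,
    inner_smul_right, inner_smul_right, Complex.conj_ofReal] at h1
  simp only [Complex.sub_re, Complex.re_ofReal_mul, e1, e2] at h1
  rw [e3] at h3
  have hs' : s⁻¹ * s = 1 := inv_mul_cancel₀ hs.ne'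
  have hsp : 0 < s⁻¹ := inv_pos.2 hs
  have h4 : s⁻¹ * (s⁻¹ * (⟪a θ, (θ : H)⟫_ℂ).re) ≤ s⁻¹ * ‖a η‖ ^ 2 := by
    refine mul_le_mul_of_nonneg_left ?_ hsp.le
    calc s⁻¹ * (⟪a θ, (θ : H)⟫_ℂ).re ≤ s⁻¹ * (s * ‖a η‖ ^ 2) :=
          mul_le_mul_of_nonneg_left h3 hsp.le
      _ = ‖a η‖ ^ 2 := by rw [← mul_assoc, hs', one_mul]
  have h5 : s⁻¹ * ‖a η‖ ^ 2 ≤ s * ‖(η : H)‖ ^ 2 := by linarith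
  have h6 : ‖a η‖ ^ 2 ≤ (s * ‖(η : H)‖) ^ 2 := by
    have := mul_le_mul_of_nonneg_left h5 hs.le
    rw [← mul_assoc, mul_inv_cancel₀ hs.ne', one_mul] at this
    linarith [this, mul_pow s ‖(η : H)‖ 2, sq s]
  exact le_of_sq_le_sq h6 (by positivity)

theorem le_norm_apply_of_e (hE : IsSpectralFamilyOf E a) {r s : ℝ} (η : a.domain)
    (hr : (E.e r : H →L[ℂ] H) η = 0) (hη : (E.e s : H →L[ℂ] H) η = η) :
    r * ‖(η : H)‖ ≤ ‖a η‖ := by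
  have h := (re_inner_mem_Icc_of_e hE η hr hη).1
  have h2 : (⟪a η, (η : H)⟫_ℂ).re ≤ ‖a η‖ * ‖(η : H)‖ :=
    (Complex.re_le_norm _).trans (norm_inner_le_norm _ _)
  rcases (norm_nonneg (η : H)).eq_or_lt with h0 | h0
  · rw [← h0, mul_zero]
    exact norm_nonneg _
  · refine le_of_mul_le_mul_right ?_ h0
    nlinarith

/-- The range of e_s is invariant under a, so η lies in the domain of a² = x*x, hence in that of x.
There ‖xη‖² = ⟨x*xη, η⟩ = ⟨a²η, η⟩ = ‖aη‖², and the bounds for a apply to x. -/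
theorem exists_mem_graph_of_modulus {x : H →ₗ.[ℂ] H} (hdense : Dense (x.domain : Set H))
    (hx : IsModulus x a) (hE : IsSpectralFamilyOf E a) {s : ℝ} (hs : 0 < s) {η : H}
    (hη : (E.e s : H →L[ℂ] H) η = η) : ∃ ζ, (η, ζ) ∈ x.graph ∧ ‖ζ‖ ≤ s * ‖η‖ ∧
      ∀ r, (E.e r : H →L[ℂ] H) η = 0 → r * ‖η‖ ≤ ‖ζ‖ := by
  obtain ⟨ha, hpos, hmod⟩ := hx
  have hdom : ∀ η, (E.e s : H →L[ℂ] H) η = η → η ∈ a.domain := fun η h =>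
    mem_domain_of_e hpos hE h
  set η' : a.domain := ⟨η, hdom η hη⟩
  have haη := apply_mem_of_e ha hE hdom η' hη
  set θ : a.domain := ⟨a η', hdom _ haη⟩
  have hg : (η, a θ) ∈ (pmul a a).graph :=
    mem_graph_pmul.2 ⟨a η', a.mem_graph η', a.mem_graph θ⟩
  rw [hmod] at hg
  obtain ⟨ζ, hζ, hζ'⟩ := mem_graph_pmul.1 hg
  have hnorm : ‖ζ‖ = ‖a η'‖ := by
    obtain ⟨ξ, hξ, hξ'⟩ := (LinearPMap.mem_graph_iff _).1 hζ
    obtain ⟨ω, hω, hω'⟩ := (LinearPMap.mem_graph_iff _).1 hζ'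
    have h1 := LinearPMap.adjoint_isFormalAdjoint hdense ω ξ
    rw [hω', hξ', hω, hξ] at h1
    have h2 : ⟪a θ, η⟫_ℂ = ⟪a η', a η'⟫_ℂ := isSymmetric_of_isSelfAdjoint ha θ η'
    simp only at h1
    rw [h2] at h1
    have h3 := congrArg Complex.re h1
    rw [re_inner_self, re_inner_self] at h3
    exact ((sq_eq_sq₀ (norm_nonneg _) (norm_nonneg _)).1 h3).symm
  refine ⟨ζ, hζ, ?_, fun r hr => ?_⟩
  · rw [hnorm]
    exact norm_apply_le_of_e ha hpos hE hs η' hη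
  · rw [hnorm]
    exact le_norm_apply_of_e hE η' hr hη

theorem SpectralFamily.trace_tendsto_atTop (τ : FiniteTrace M) (E : SpectralFamily M) :
    Tendsto (E.trace τ) Filter.atTop (𝓝 (τ.val 1)) := by
  have hlub : IsLUB (range E.e) 1 := by
    constructor
    · rintro _ ⟨t, rfl⟩
      have := InvSubspace.proj_nonneg (InvSubspace.ofProj (E.e t)).compl
      rw [InvSubspace.proj_compl, InvSubspace.proj_ofProj (E.isProj t)] at this
      exact sub_nonneg.1 this
    · intro b hb
      have hb' : ∀ s, (E.e s : H →L[ℂ] H) ≤ (b : H →L[ℂ] H) := fun s => hb ⟨s, rfl⟩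
      have hbsa : IsSelfAdjoint (b : H →L[ℂ] H) := by
        have := ((ContinuousLinearMap.le_def _ _).1 (hb' 0)).isSelfAdjoint
        simpa using this.add (E.e_isSelfAdjoint 0)
      change (1 : H →L[ℂ] H) ≤ (b : H →L[ℂ] H)
      refine le_of_re_inner_le (.one _) hbsa fun ξ => ?_
      have h := E.form_tendsto_atTop ξ
      rw [one_apply_eq_self, re_inner_self]
      exact le_of_tendsto' h fun s => re_inner_le_of_le (hb' s) ξ
  have hn := τ.normal _ _ (range_nonempty _) E.mono.directed_le.directedOn_range
    (by
      rintro _ ⟨t, rfl⟩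
      rw [← InvSubspace.proj_ofProj (E.isProj t)]
      exact InvSubspace.proj_nonneg _) hlub
  rw [← range_comp] at hn
  exact tendsto_atTop_isLUB (E.trace τ).mono hn

/-- Chebyshev's inequality for the measure dτ(e_t) on (s, ∞). -/
theorem SpectralFamily.mul_rank_compl_le {τ : FiniteTrace M} {φ : ℝ → ℝ}
    (hφ : MonotoneOn φ (Ici 0)) (h : traceFun τ φ E ≤ 1) {s : ℝ} (hs : 0 ≤ s) :
    φ s * rank τ (InvSubspace.ofProj (E.e s)).compl ≤ 1 := by
  have e1 : rank τ (InvSubspace.ofProj (E.e s)).compl = τ.val 1 - τ.val (E.e s) := by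
    rw [rank_compl, rank, InvSubspace.proj_ofProj (E.isProj s)]
  have h0 := rank_nonneg τ (InvSubspace.ofProj (E.e s)).compl
  rw [e1] at h0 ⊢
  rw [← ENNReal.ofReal_le_one, ENNReal.ofReal_mul' h0]
  refine le_trans ?_ h
  rw [traceFun]
  calc ENNReal.ofReal (φ s) * ENNReal.ofReal (τ.val 1 - τ.val (E.e s))
      = ENNReal.ofReal (φ s) * (E.trace τ).measure (Ioi s) := by
        rw [StieltjesFunction.measure_Ioi _ (E.trace_tendsto_atTop τ)]
        rfl
    _ = ∫⁻ _ in Ioi s, ENNReal.ofReal (φ s) ∂(E.trace τ).measure := by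
        rw [lintegral_const, Measure.restrict_apply_univ]
    _ ≤ ∫⁻ t in Ioi s, ENNReal.ofReal (φ t) ∂(E.trace τ).measure := by
        refine lintegral_mono_ae ?_
        filter_upwards [ae_restrict_mem measurableSet_Ioi] with t ht
        exact ENNReal.ofReal_le_ofReal (hφ (mem_Ici.2 hs)
          (mem_Ici.2 (hs.trans (le_of_lt ht))) (le_of_lt ht))
    _ ≤ _ := lintegral_mono_set fun t ht => mem_Ici.2 (hs.trans (le_of_lt ht))

end Modulus

/-! ### Spectral cuts for elements of Orlicz spaces -/

section Orlicz

variable {M : VonNeumannAlgebra H} {τ : FiniteTrace M} {φ : ℝ → ℝ} {x : H →ₗ.[ℂ] H}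

theorem mem_measurableOps_smul (hx : x ∈ measurableOps M τ) {c : ℂ} (hc : c ≠ 0) :
    c • x ∈ measurableOps M τ := by
  refine ⟨?_, fun w hw hu ξ => ?_, hx.2.2⟩
  · have : ((c • x).graph : Set (H × H)) = (fun p : H × H => (p.1, c⁻¹ • p.2)) ⁻¹' x.graph := by
      ext ⟨ξ, ζ⟩
      rw [SetLike.mem_coe, mem_graph_smul]
      constructor
      · rintro ⟨a, ha, rfl⟩
        simpa [smul_smul, inv_mul_cancel₀ hc] using ha
      · intro h
        exact ⟨_, h, by simp [smul_smul, mul_inv_cancel₀ hc]⟩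
    rw [LinearPMap.IsClosed, this]
    exact (isClosed_of_mem hx).preimage
      (continuous_fst.prodMk (continuous_const.smul continuous_snd))
  · obtain ⟨h1, h2⟩ := hx.2.1 w hw hu ξ
    refine ⟨h1, ?_⟩
    rw [LinearPMap.smul_apply, LinearPMap.smul_apply, map_smul]
    exact congrArg _ h2

theorem exists_eq_smul_of_mem_orliczSpace (hx : x ∈ orliczSpace M τ φ) :
    ∃ n : ℕ, 1 ≤ n ∧ ∃ y ∈ orliczBall M τ φ, x = (n : ℂ) • y := by
  obtain ⟨n, hn, y, hy, rfl⟩ := hx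
  exact ⟨n, hn, y, hy, closure_of_mem (mem_measurableOps_smul hy.1
    (by exact_mod_cast (Nat.one_le_iff_ne_zero.1 hn)))⟩

theorem mem_measurableOps_of_mem_orliczSpace (hx : x ∈ orliczSpace M τ φ) :
    x ∈ measurableOps M τ := by
  obtain ⟨n, hn, y, hy, rfl⟩ := exists_eq_smul_of_mem_orliczSpace hx
  exact mem_measurableOps_smul hy.1 (by exact_mod_cast (Nat.one_le_iff_ne_zero.1 hn))

/-- An element of an Orlicz space has spectral cuts on which it is bounded above and below, and
the Chebyshev inequality bounds their codimension. -/
theorem exists_spectralFamily_of_mem_orliczSpace (hφ : IsYoung φ) (hx : x ∈ orliczSpace M τ φ) :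
    ∃ (E : SpectralFamily M) (n : ℕ), 1 ≤ n ∧
      (∀ s, 0 < s → φ s * rank τ (InvSubspace.ofProj (E.e s)).compl ≤ 1) ∧
      ∀ s, 0 < s → ∀ η, (E.e s : H →L[ℂ] H) η = η → ∃ ζ, (η, ζ) ∈ x.graph ∧
        ‖ζ‖ ≤ n * s * ‖η‖ ∧ ∀ r, 0 < r → (E.e r : H →L[ℂ] H) η = 0 → r * ‖η‖ ≤ ‖ζ‖ := by
  obtain ⟨n, hn, y, hy, rfl⟩ := exists_eq_smul_of_mem_orliczSpace hx
  obtain ⟨hym, a, ha, E, hE, htr⟩ := hy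
  have hn1 : (1 : ℝ) ≤ n := by exact_mod_cast hn
  refine ⟨E, n, hn, fun s hs => E.mul_rank_compl_le hφ.monotoneOn htr hs.le, fun s hs η hη => ?_⟩
  obtain ⟨ζ, h1, h2, h3⟩ := exists_mem_graph_of_modulus (dense_domain hym) ha hE hs hη
  have hnorm : ‖(n : ℂ) • ζ‖ = n * ‖ζ‖ := by rw [norm_smul, Complex.norm_natCast]
  refine ⟨(n : ℂ) • ζ, mem_graph_smul.2 ⟨ζ, h1, rfl⟩, ?_, fun r hr hr0 => ?_⟩
  · rw [hnorm, mul_assoc]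
    exact mul_le_mul_of_nonneg_left h2 (by positivity)
  · rw [hnorm]
    exact (h3 r hr0).trans (le_mul_of_one_le_left (norm_nonneg _) hn1)

/-- A nonzero element of an Orlicz space is bounded below on some nonzero spectral subspace. -/
theorem exists_bounded_below (hφ : IsYoung φ) (hx : x ∈ orliczSpace M τ φ) (h0 : x ≠ 0) :
    ∃ (Z : InvSubspace M) (β : ℝ), 0 < β ∧ Z.space ≠ ⊥ ∧
      ∀ η ∈ Z.space, ∃ ζ, (η, ζ) ∈ x.graph ∧ β * ‖η‖ ≤ ‖ζ‖ := by
  obtain ⟨E, n, hn, -, hE⟩ := exists_spectralFamily_of_mem_orliczSpace hφ hx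
  by_contra! hcon
  -- If no such subspace exists, the range of e_t − e_β is zero whenever 0 < β ≤ t. Then e_β = 1 for
  -- every β > 0, so x has norm at most n·s for every s > 0, which forces x = 0.
  have hstep : ∀ β t, 0 < β → β ≤ t → ∀ ξ, (E.e β : H →L[ℂ] H) ξ = (E.e t : H →L[ℂ] H) ξ := by
    intro β t hβ hβt ξ
    set Z : InvSubspace M := (InvSubspace.ofProj (E.e t)).inf (InvSubspace.ker (E.e β))
    have hZ : Z.space = ⊥ := by
      by_contra hne
      obtain ⟨η, hη, h⟩ := hcon Z β hβ hne
      obtain ⟨ζ, h1, -, h3⟩ := hE t (hβ.trans_le hβt) η (InvSubspace.mem_ofProj.1 hη.1)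
      exact absurd (h3 β hβ hη.2) (not_le.2 (h ζ h1))
    have hmem : (E.e t : H →L[ℂ] H) ξ - (E.e β : H →L[ℂ] H) ξ ∈ Z.space := by
      refine ⟨InvSubspace.mem_ofProj.2 ?_, InvSubspace.mem_ker.2 ?_⟩
      · rw [map_sub, E.e_mul_self, E.e_mul_of_le hβt]
      · rw [map_sub, E.e_mul_self, E.e_mul_of_ge hβt, sub_self]
    rw [hZ, Submodule.mem_bot, sub_eq_zero] at hmem
    exact hmem.symm
  have hone : ∀ β, 0 < β → ∀ ξ, (E.e β : H →L[ℂ] H) ξ = ξ := by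
    intro β hβ ξ
    refine tendsto_nhds_unique (tendsto_const_nhds.congr' ?_) (E.atTop ξ)
    filter_upwards [eventually_ge_atTop β] with t ht using hstep β t hβ ht ξ
  refine h0 (eq_zero_of_forall_mem_graph fun η => ?_)
  obtain ⟨ζ, hζ, -, -⟩ := hE 1 one_pos η (hone 1 one_pos η)
  have hle : ∀ s : ℝ, 0 < s → ‖ζ‖ ≤ n * s * ‖η‖ := fun s hs => by
    obtain ⟨ζ', h1, h2, -⟩ := hE s hs η (hone s hs η)
    rwa [graph_unique hζ h1]
  have hlim : Tendsto (fun s : ℝ => n * s * ‖η‖) (𝓝[>] 0) (𝓝 (n * 0 * ‖η‖)) :=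
    (((continuous_const.mul continuous_id).mul continuous_const).tendsto 0).mono_left
      nhdsWithin_le_nhds
  have h2 : ‖ζ‖ ≤ n * 0 * ‖η‖ := by
    refine ge_of_tendsto hlim ?_
    filter_upwards [self_mem_nhdsWithin] with s hs using hle s hs
  have h3 : ζ = 0 := by
    rw [← norm_eq_zero]
    refine le_antisymm ?_ (norm_nonneg _)
    simpa using h2
  rwa [h3] at hζ

end Orlicz

/-! ### Dyadic expansions -/

section Dyadic

variable {M : VonNeumannAlgebra H}

/-- The projection of the first binary digit of `T`. -/
def digit (T : M.toStarSubalgebra) : M.toStarSubalgebra := (specSpace T (1 / 2)).compl.proj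

/-- The remainders of the binary expansion of `T`. -/
def dyadic (T : M.toStarSubalgebra) : ℕ → M.toStarSubalgebra
  | 0 => T
  | n + 1 => dyadic T n + dyadic T n - digit (dyadic T n)

theorem dyadic_mem_Icc {T : M.toStarSubalgebra} (h0 : 0 ≤ T) (h1 : T ≤ 1) (n : ℕ) :
    0 ≤ dyadic T n ∧ dyadic T n ≤ 1 := by
  induction n with
  | zero => exact ⟨h0, h1⟩
  | succ n ih => exact dyadic_step ih.1 ih.2

/-- The digit depends on the operator alone, so forming it inside the commutant gives the same
projection. -/
theorem digit_mem_commutant {T : M.toStarSubalgebra} (hT : (T : H →L[ℂ] H) ∈ M.commutant) :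
    (digit T : H →L[ℂ] H) ∈ M.commutant :=
  (digit (M := M.commutant) ⟨T, hT⟩).2

theorem dyadic_mem_commutant {T : M.toStarSubalgebra} (hT : (T : H →L[ℂ] H) ∈ M.commutant)
    (n : ℕ) : (dyadic T n : H →L[ℂ] H) ∈ M.commutant := by
  induction n with
  | zero => exact hT
  | succ n ih => exact sub_mem (add_mem ih ih) (digit_mem_commutant ih)

/-- For T ≥ 0 and t ≥ 0 the positive part of T − t is dominated by T. So the digits of T live on the
support of T. -/
theorem mem_specSpace_of_apply_eq_zero {T : M.toStarSubalgebra} (h0 : 0 ≤ T) {ξ : H}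
    (h : (T : H →L[ℂ] H) ξ = 0) {t : ℝ} (ht : 0 ≤ t) : ξ ∈ (specSpace T t).space := by
  have h0' : (0 : H →L[ℂ] H) ≤ T := h0
  have hle : posCut (T : H →L[ℂ] H) t ≤ T := by
    conv_rhs => rw [← cfc_id ℝ (T : H →L[ℂ] H) (IsSelfAdjoint.of_nonneg h0')]
    exact cfc_mono fun x hx => max_le (by simpa using ht) (spectrum_nonneg_of_nonneg h0' hx)
  rw [mem_specSpace]
  refine apply_eq_zero_of_re_inner_nonpos (posCut_nonneg _ _) ?_
  refine (re_inner_le_of_le hle ξ).trans ?_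
  simp [h]

theorem norm_le_one_of_mem_Icc {T : H →L[ℂ] H} (h0 : 0 ≤ T) (h1 : T ≤ 1) : ‖T‖ ≤ 1 :=
  (CStarAlgebra.norm_le_one_iff_of_nonneg T h0).2 h1

/-! ### Splitting projections in type II algebras -/

theorem eq_zero_of_forall_two_pow_mul_le {E : Type*} [NormedAddCommGroup E] {c : E} {C : ℝ}
    (h : ∀ n : ℕ, 2 ^ n * ‖c‖ ≤ C) : c = 0 := by
  rw [← norm_eq_zero]
  by_contra hc
  have hpos : 0 < ‖c‖ := lt_of_le_of_ne (norm_nonneg _) (Ne.symm hc)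
  obtain ⟨n, hn⟩ := pow_unbounded_of_one_lt (C / ‖c‖) (one_lt_two)
  rw [div_lt_iff₀ hpos] at hn
  exact absurd (h n) (not_le.2 hn)

/-- If Z is minimal, every digit of T is 0 or the projection onto Z, and both commute with y. Thus
the commutator of y with the n-th remainder is 2ⁿ[T, y], but its norm is at most 2‖y‖; so [T, y] =
0. -/
theorem commute_of_forall_eq_bot_or_eq {Z : InvSubspace M}
    (hZ : ∀ L : InvSubspace M, L.space ≤ Z.space → L.space = ⊥ ∨ L.space = Z.space)
    {T y : M.toStarSubalgebra} (h0 : 0 ≤ T) (h1 : T ≤ 1)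
    (hT : ∀ ξ ∈ Z.spaceᗮ, (T : H →L[ℂ] H) ξ = 0) (hy : Z.proj * y = y) (hy' : y * Z.proj = y) :
    T * y = y * T := by
  have key : ∀ n : ℕ, (∀ ξ ∈ Z.spaceᗮ, (dyadic T n : H →L[ℂ] H) ξ = 0) ∧
      dyadic T n * y - y * dyadic T n = (2 ^ n : ℂ) • (T * y - y * T) := by
    intro n
    induction n with
    | zero => exact ⟨hT, by simp [dyadic]⟩
    | succ n ih =>
      have hle : (specSpace (dyadic T n) (1 / 2)).compl.space ≤ Z.space := by
        rw [← Z.compl_compl_space]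
        exact Submodule.orthogonal_le fun ξ hξ =>
          mem_specSpace_of_apply_eq_zero (dyadic_mem_Icc h0 h1 n).1 (ih.1 ξ hξ) (by norm_num)
      have hd : digit (dyadic T n) = 0 ∨ digit (dyadic T n) = Z.proj := by
        rcases hZ _ hle with h | h
        · exact Or.inl ((InvSubspace.proj_eq_zero_iff _).2 h)
        · exact Or.inr (InvSubspace.proj_congr h)
      have hcomm : digit (dyadic T n) * y - y * digit (dyadic T n) = 0 := by
        rcases hd with h | h
        · rw [h, zero_mul, mul_zero, sub_zero]
        · rw [h, hy, hy', sub_self]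
      constructor
      · intro ξ hξ
        have hdξ : (digit (dyadic T n) : H →L[ℂ] H) ξ = 0 := by
          rcases hd with h | h
          · rw [h]
            rfl
          · rw [h]
            exact (Submodule.starProjection_apply_eq_zero_iff Z.space).2 hξ
        change (dyadic T n : H →L[ℂ] H) ξ + (dyadic T n : H →L[ℂ] H) ξ
          - (digit (dyadic T n) : H →L[ℂ] H) ξ = 0
        rw [ih.1 ξ hξ, hdξ, add_zero, sub_zero]
      · have e : dyadic T (n + 1) * y - y * dyadic T (n + 1)
            = (dyadic T n * y - y * dyadic T n) + (dyadic T n * y - y * dyadic T n)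
              - (digit (dyadic T n) * y - y * digit (dyadic T n)) := by
          simp only [dyadic, sub_mul, mul_sub, add_mul, mul_add]
          abel
        rw [e, hcomm, sub_zero, ih.2, ← add_smul, pow_succ]
        congr 1
        ring
  have hc : ((T * y - y * T : M.toStarSubalgebra) : H →L[ℂ] H) = 0 := by
    refine eq_zero_of_forall_two_pow_mul_le (C := 2 * ‖(y : H →L[ℂ] H)‖) fun n => ?_
    have h2 : (2 ^ n : ℂ) • ((T * y - y * T : M.toStarSubalgebra) : H →L[ℂ] H)
        = (dyadic T n : H →L[ℂ] H) * y - y * (dyadic T n : H →L[ℂ] H) :=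
      (congrArg Subtype.val (key n).2).symm
    have h3 : 2 ^ n * ‖((T * y - y * T : M.toStarSubalgebra) : H →L[ℂ] H)‖
        = ‖(dyadic T n : H →L[ℂ] H) * y - y * (dyadic T n : H →L[ℂ] H)‖ := by
      rw [← h2, norm_smul]
      simp
    have hn : ‖(dyadic T n : H →L[ℂ] H)‖ ≤ 1 :=
      norm_le_one_of_mem_Icc (dyadic_mem_Icc h0 h1 n).1 (dyadic_mem_Icc h0 h1 n).2
    rw [h3]
    refine (norm_sub_le _ _).trans ?_
    have e1 := norm_mul_le (dyadic T n : H →L[ℂ] H) (y : H →L[ℂ] H)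
    have e2 := norm_mul_le (y : H →L[ℂ] H) (dyadic T n : H →L[ℂ] H)
    nlinarith [norm_nonneg (y : H →L[ℂ] H)]
  exact sub_eq_zero.1 (Subtype.ext hc)

/-- If Z were minimal, positive contractions of pMp, with p the projection onto Z, would commute
with all of pMp. They span pMp, so p would be a nonzero abelian projection. -/
theorem exists_proper_invSubspace (hM : ∀ p, IsAbelianProj M p → p = 0) {Z : InvSubspace M}
    (hZ : Z.space ≠ ⊥) :
    ∃ L : InvSubspace M, L.space ≤ Z.space ∧ L.space ≠ ⊥ ∧ L.space ≠ Z.space := by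
  by_contra! hcon
  refine hZ ((InvSubspace.proj_eq_zero_iff _).1 (hM _ ⟨Z.isProj, fun x y => ?_⟩))
  have hZ' : ∀ L : InvSubspace M, L.space ≤ Z.space → L.space = ⊥ ∨ L.space = Z.space :=
    fun L hL => (em (L.space = ⊥)).imp_right (hcon L hL)
  set p := Z.proj with hp
  have hpp : p * p = p := Z.isProj.isIdempotentElem.eq
  have hpsa : IsSelfAdjoint (p : H →L[ℂ] H) := isStarProjection_starProjection.isSelfAdjoint
  have h : ∀ x : H →L[ℂ] H, x ∈ M.toStarSubalgebra →
      ((p : H →L[ℂ] H) * x * p) * (p * y * p) = (p * y * p) * (p * x * p) := by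
    intro x hx
    refine positive_induction M.toStarSubalgebra
      (P := fun x => ((p : H →L[ℂ] H) * x * p) * (p * y * p) = (p * y * p) * (p * x * p))
      (fun v hv h0 h1 => ?_) (fun u v hu hv => ?_) (fun c u hu => ?_) hx
    · refine congrArg Subtype.val (commute_of_forall_eq_bot_or_eq hZ' (T := p * ⟨v, hv⟩ * p)
        (y := p * y * p) (hpsa.conjugate_nonneg h0) ?_ ?_ ?_ ?_)
      · have h2 : (p : H →L[ℂ] H) * v * p ≤ p * 1 * p := hpsa.conjugate_le_conjugate h1
        refine h2.trans ?_
        rw [mul_one]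
        have h3 : (p : H →L[ℂ] H) * p = p := congrArg Subtype.val hpp
        rw [h3]
        exact (isStarProjection_starProjection (U := Z.space)).le_one
      · intro ξ hξ
        have : (p : H →L[ℂ] H) ξ = 0 := (Submodule.starProjection_apply_eq_zero_iff Z.space).2 hξ
        change (p : H →L[ℂ] H) (v ((p : H →L[ℂ] H) ξ)) = 0
        rw [this, map_zero, map_zero]
      · rw [← hp, ← mul_assoc, ← mul_assoc, hpp]
      · rw [← hp, mul_assoc, hpp]
    · simp only [mul_add, add_mul, hu, hv]
    · simp only [mul_smul_comm, smul_mul_assoc, hu]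
  exact Subtype.ext (h x x.2)

/-- In an algebra without abelian projections, every nonzero projection dominates an infinite
sequence of orthogonal nonzero projections. -/
theorem exists_orthogonal_seq (hM : ∀ p, IsAbelianProj M p → p = 0) {Z : InvSubspace M}
    (hZ : Z.space ≠ ⊥) : ∃ L : ℕ → InvSubspace M, (∀ n, (L n).space ≠ ⊥) ∧
      (∀ n, (L n).space ≤ Z.space) ∧
      ∀ m n, m ≠ n → ∀ ξ ∈ (L m).space, ∀ η ∈ (L n).space, ⟪ξ, η⟫_ℂ = 0 := by
  choose! f hf1 hf2 hf3 using fun (Y : InvSubspace M) (hY : Y.space ≠ ⊥) =>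
    exists_proper_invSubspace hM hY
  -- Iterating the choice of a proper nonzero subspace gives a strictly decreasing sequence; the
  -- differences K n ⊖ K (n + 1) are orthogonal and nonzero.
  let K : ℕ → InvSubspace M := fun n => f^[n] Z
  have hK : ∀ n, K (n + 1) = f (K n) := fun n => Function.iterate_succ_apply' f n Z
  have hne : ∀ n, (K n).space ≠ ⊥ := by
    intro n
    induction n with
    | zero => exact hZ
    | succ n ih =>
      rw [hK]
      exact hf2 _ ih
  have hanti : Antitone fun n => (K n).space := antitone_nat_of_succ_le fun n => by
    rw [hK]
    exact hf1 _ (hne n)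
  have horth : ∀ m n, m < n → ∀ ξ ∈ ((K m).inf (K (m + 1)).compl).space,
      ∀ η ∈ ((K n).inf (K (n + 1)).compl).space, ⟪ξ, η⟫_ℂ = 0 := fun m n hmn ξ hξ η hη =>
    Submodule.inner_left_of_mem_orthogonal (hanti (Nat.succ_le_of_lt hmn) hη.1) hξ.2
  refine ⟨fun n => (K n).inf (K (n + 1)).compl, fun n h => ?_, fun n => ?_, fun m n hmn ξ hξ η hη => ?_⟩
  · have hle : (K (n + 1)).space ≤ (K n).space := hanti (Nat.le_succ n)
    refine hf3 _ (hne n) ?_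
    rw [← hK]
    refine le_antisymm hle fun ξ hξ => ?_
    have h1 : ξ - ((K (n + 1)).proj : H →L[ℂ] H) ξ ∈ ((K n).inf (K (n + 1)).compl).space :=
      ⟨sub_mem hξ (hle ((K (n + 1)).proj_apply_mem ξ)),
        (K (n + 1)).space.sub_starProjection_mem_orthogonal ξ⟩
    rw [h, Submodule.mem_bot, sub_eq_zero] at h1
    rw [h1]
    exact (K (n + 1)).proj_apply_mem ξ
  · exact inf_le_left.trans (hanti (Nat.zero_le n))
  · rcases lt_or_gt_of_ne hmn with h | h
    · exact horth m n h ξ hξ η hη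
    · rw [← inner_conj_symm, horth n m h η hη ξ hξ, map_zero]

/-- The strong sum `∑ T n * p n` of central contractions cut by orthogonal projections. -/
theorem exists_strong_sum {L : ℕ → InvSubspace M}
    (hL : ∀ m n, m ≠ n → ∀ ξ ∈ (L m).space, ∀ η ∈ (L n).space, ⟪ξ, η⟫_ℂ = 0)
    {T : ℕ → M.toStarSubalgebra} (hT : ∀ n, (T n : H →L[ℂ] H) ∈ M.commutant)
    (hT1 : ∀ n, ‖(T n : H →L[ℂ] H)‖ ≤ 1) : ∃ X : M.toStarSubalgebra, ∀ n,
      X * (L n).proj = T n * (L n).proj ∧ (L n).proj * X = T n * (L n).proj := by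
  -- T n lies in the commutant, so it commutes with the projection onto L n; the summands therefore
  -- stay in orthogonal subspaces.
  have hcomm : ∀ n ξ, (T n : H →L[ℂ] H) (((L n).proj : H →L[ℂ] H) ξ) ∈ (L n).space := fun n ξ => by
    have h := VonNeumannAlgebra.mem_commutant_iff.1 (hT n) _ (L n).proj.2
    have h2 : ((L n).proj : H →L[ℂ] H) ((T n : H →L[ℂ] H) ξ)
      = (T n : H →L[ℂ] H) (((L n).proj : H →L[ℂ] H) ξ) := congrArg (fun X => X ξ) h
    rw [← h2]
    exact (L n).proj_apply_mem _
  have hfam : OrthogonalFamily ℂ (fun n => (L n).space) fun n => (L n).space.subtypeₗᵢ :=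
    fun m n hmn ξ η => hL m n hmn ξ ξ.2 η η.2
  let g : ∀ (ξ : H) (n : ℕ), (L n).space := fun ξ n => ⟨_, hcomm n ξ⟩
  -- Bessel's inequality for the orthogonal projections of ξ, since each T n is a contraction.
  have hg : ∀ ξ (s : Finset ℕ), ∑ n ∈ s, ‖g ξ n‖ ^ 2 ≤ ‖ξ‖ ^ 2 := by
    intro ξ s
    let v : ∀ n : ℕ, (L n).space := fun n => ⟨_, (L n).proj_apply_mem ξ⟩
    have h1 : ∑ n ∈ s, ‖g ξ n‖ ^ 2 ≤ ∑ n ∈ s, ‖v n‖ ^ 2 := by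
      refine Finset.sum_le_sum fun n _ => pow_le_pow_left₀ (norm_nonneg _) ?_ 2
      exact ((T n : H →L[ℂ] H).le_opNorm _).trans
        (mul_le_of_le_one_left (norm_nonneg _) (hT1 n))
    refine h1.trans ?_
    set σ : H := ∑ n ∈ s, (v n : H) with hσ
    have h2 : ‖σ‖ ^ 2 = ∑ n ∈ s, ‖v n‖ ^ 2 := hfam.norm_sum v s
    have h3 : ∑ n ∈ s, ‖v n‖ ^ 2 = (⟪σ, ξ⟫_ℂ).re := by
      rw [hσ, sum_inner, Complex.re_sum]
      refine Finset.sum_congr rfl fun n _ => ?_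
      have : ⟪(v n : H), (v n : H)⟫_ℂ = ⟪(v n : H), ξ⟫_ℂ := by
        have h4 : ⟪(v n : H), ((L n).proj : H →L[ℂ] H) ξ⟫_ℂ = ⟪((L n).proj : H →L[ℂ] H) (v n), ξ⟫_ℂ :=
          (adjoint_inner_eq_of_isSelfAdjoint (A := ((L n).proj : H →L[ℂ] H))
            isStarProjection_starProjection.isSelfAdjoint _ _).symm
        rw [(L n).proj_apply_eq_self_iff.2 (v n).2] at h4
        exact h4
      rw [← this, re_inner_self]
      rfl
    have h4 : ‖σ‖ ^ 2 ≤ ‖σ‖ * ‖ξ‖ := by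
      rw [h2, h3]
      exact (Complex.re_le_norm _).trans (norm_inner_le_norm _ _)
    rw [← h2]
    nlinarith [norm_nonneg σ, norm_nonneg ξ, sq_nonneg (‖σ‖ - ‖ξ‖)]
  have hsum : ∀ ξ, Summable fun n => (T n : H →L[ℂ] H) (((L n).proj : H →L[ℂ] H) ξ) := fun ξ =>
    (hfam.summable_iff_norm_sq_summable (g ξ)).2
      (summable_of_sum_le (fun n => sq_nonneg _) (hg ξ))
  let X₀ : H →ₗ[ℂ] H :=
    { toFun := fun ξ => ∑' n, (T n : H →L[ℂ] H) (((L n).proj : H →L[ℂ] H) ξ)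
      map_add' := fun ξ η => by
        rw [← (hsum ξ).tsum_add (hsum η)]
        simp only [map_add]
      map_smul' := fun c ξ => by
        rw [RingHom.id_apply, ← (hsum ξ).tsum_const_smul c]
        simp only [map_smul] }
  have hbd : ∀ ξ, ‖X₀ ξ‖ ≤ 1 * ‖ξ‖ := by
    intro ξ
    rw [one_mul]
    refine le_of_tendsto (hsum ξ).hasSum.norm (Eventually.of_forall fun s => ?_)
    have h1 : ‖∑ n ∈ s, (g ξ n : H)‖ ^ 2 = ∑ n ∈ s, ‖g ξ n‖ ^ 2 := hfam.norm_sum (g ξ) s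
    exact le_of_sq_le_sq (h1.trans_le (hg ξ s)) (norm_nonneg _)
  let X : H →L[ℂ] H := X₀.mkContinuous 1 hbd
  have hXapp : ∀ ξ, X ξ = ∑' n, (T n : H →L[ℂ] H) (((L n).proj : H →L[ℂ] H) ξ) := fun ξ => rfl
  have hXM : X ∈ M := by
    rw [← M.commutant_commutant, VonNeumannAlgebra.mem_commutant_iff]
    intro w hw
    have hcw : ∀ (A : M.toStarSubalgebra) (ξ : H), (A : H →L[ℂ] H) (w ξ) = w ((A : H →L[ℂ] H) ξ) :=
      fun A ξ => congrArg (fun X => X ξ) (VonNeumannAlgebra.mem_commutant_iff.1 hw A A.2)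
    ext ξ
    change w (X ξ) = X (w ξ)
    rw [hXapp, hXapp, w.map_tsum (hsum ξ)]
    simp only [hcw]
  refine ⟨⟨X, hXM⟩, fun n => ⟨Subtype.ext ?_, Subtype.ext ?_⟩⟩
  · ext ξ
    change X (((L n).proj : H →L[ℂ] H) ξ) = (T n : H →L[ℂ] H) (((L n).proj : H →L[ℂ] H) ξ)
    rw [hXapp, tsum_eq_single n]
    · congr 1
      exact (L n).proj_apply_eq_self_iff.2 ((L n).proj_apply_mem ξ)
    · intro m hm
      have : ((L m).proj : H →L[ℂ] H) (((L n).proj : H →L[ℂ] H) ξ) = 0 := by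
        refine (Submodule.starProjection_apply_eq_zero_iff _).2 ?_
        rw [Submodule.mem_orthogonal]
        exact fun η hη => hL m n hm η hη _ ((L n).proj_apply_mem ξ)
      rw [this, map_zero]
  · ext ξ
    change ((L n).proj : H →L[ℂ] H) (X ξ) = (T n : H →L[ℂ] H) (((L n).proj : H →L[ℂ] H) ξ)
    rw [hXapp, ContinuousLinearMap.map_tsum _ (hsum ξ), tsum_eq_single n]
    · exact (L n).proj_apply_eq_self_iff.2 (hcomm n ξ)
    · intro m hm
      refine (Submodule.starProjection_apply_eq_zero_iff _).2 ?_
      rw [Submodule.mem_orthogonal]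
      exact fun η hη => hL n m hm.symm η hη _ (hcomm m ξ)

end Dyadic

/-! ### The projection onto the graph of a closed operator -/

section Graph

variable {x : H →ₗ.[ℂ] H}

/-- The entries `R = (1 + x* x)⁻¹` and `S = x R` of the projection onto the graph of `x`. -/
theorem exists_graph_projection (hx : x.IsClosed) : ∃ R S : H →L[ℂ] H,
    (∀ η, (R η, S η) ∈ x.graph) ∧
      ∀ η ξ ζ, (ξ, ζ) ∈ x.graph → ⟪η - R η, ξ⟫_ℂ = ⟪S η, ζ⟫_ℂ := by
  -- The product carries the ℓ² norm, so that the graph is a closed subspace of a Hilbert space; R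
  -- and S are the components of the projection of (η, 0).
  let F : Submodule ℂ (WithLp 2 (H × H)) :=
    x.graph.comap ((WithLp.prodContinuousLinearEquiv 2 ℂ H H : WithLp 2 (H × H) →L[ℂ] H × H) :
      WithLp 2 (H × H) →ₗ[ℂ] H × H)
  have hF : IsClosed (F : Set (WithLp 2 (H × H))) :=
    IsClosed.preimage (WithLp.prodContinuousLinearEquiv 2 ℂ H H).continuous hx
  have : CompleteSpace F := hF.completeSpace_coe
  let ι : H →L[ℂ] WithLp 2 (H × H) :=
    ((WithLp.prodContinuousLinearEquiv 2 ℂ H H).symm : H × H →L[ℂ] WithLp 2 (H × H)).comp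
      (ContinuousLinearMap.inl ℂ H H)
  refine ⟨(WithLp.fstL 2 ℂ H H).comp (F.starProjection.comp ι),
    (WithLp.sndL 2 ℂ H H).comp (F.starProjection.comp ι), fun η => ?_, fun η ξ ζ h => ?_⟩
  · exact F.starProjection_apply_mem (ι η)
  · have hmem : (WithLp.toLp 2 (ξ, ζ) : WithLp 2 (H × H)) ∈ F := h
    have h2 := F.starProjection_inner_eq_zero (ι η) _ hmem
    rw [WithLp.prod_inner_apply] at h2
    have e1 : (ι η - F.starProjection (ι η)).snd = - (F.starProjection (ι η)).snd := by
      change (0 : H) - (F.starProjection (ι η)).snd = _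
      rw [zero_sub]
    change ⟪η - (F.starProjection (ι η)).fst, ξ⟫_ℂ = ⟪(F.starProjection (ι η)).snd, ζ⟫_ℂ
    change ⟪η - (F.starProjection (ι η)).fst, ξ⟫_ℂ
      + ⟪(ι η - F.starProjection (ι η)).snd, ζ⟫_ℂ = 0 at h2
    rw [e1, inner_neg_left] at h2
    exact add_neg_eq_zero.1 h2

theorem graph_projection_unique {R S : H →L[ℂ] H} (h1 : ∀ η, (R η, S η) ∈ x.graph)
    (h2 : ∀ η ξ ζ, (ξ, ζ) ∈ x.graph → ⟪η - R η, ξ⟫_ℂ = ⟪S η, ζ⟫_ℂ) {η u v : H}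
    (huv : (u, v) ∈ x.graph) (horth : ∀ ξ ζ, (ξ, ζ) ∈ x.graph → ⟪η - u, ξ⟫_ℂ = ⟪v, ζ⟫_ℂ) :
    u = R η ∧ v = S η := by
  have hmem : (u - R η, v - S η) ∈ x.graph := sub_mem huv (h1 η)
  have e1 := h2 η _ _ hmem
  have e2 := horth _ _ hmem
  have e3 : ⟪u - R η, u - R η⟫_ℂ + ⟪v - S η, v - S η⟫_ℂ = 0 := by
    have : ⟪u - R η, u - R η⟫_ℂ = ⟪η - R η, u - R η⟫_ℂ - ⟪η - u, u - R η⟫_ℂ := by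
      rw [← inner_sub_left]
      congr 1
      abel
    rw [this, e1, e2, ← inner_sub_left, ← inner_add_left]
    simp
  have e4 := congrArg Complex.re e3
  rw [Complex.add_re, re_inner_self, re_inner_self, Complex.zero_re] at e4
  constructor
  · rw [← sub_eq_zero, ← norm_eq_zero]
    nlinarith [sq_nonneg ‖u - R η‖, sq_nonneg ‖v - S η‖]
  · rw [← sub_eq_zero, ← norm_eq_zero]
    nlinarith [sq_nonneg ‖u - R η‖, sq_nonneg ‖v - S η‖]

/-- As w and w* preserve the graph, (wRη, wSη) has the property that characterises the projection of
(wη, 0). -/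
theorem graph_projection_commute {R S : H →L[ℂ] H} (h1 : ∀ η, (R η, S η) ∈ x.graph)
    (h2 : ∀ η ξ ζ, (ξ, ζ) ∈ x.graph → ⟪η - R η, ξ⟫_ℂ = ⟪S η, ζ⟫_ℂ) {w : H →L[ℂ] H}
    (hw : ∀ ξ ζ, (ξ, ζ) ∈ x.graph → (w ξ, w ζ) ∈ x.graph)
    (hw' : ∀ ξ ζ, (ξ, ζ) ∈ x.graph → (star w ξ, star w ζ) ∈ x.graph) :
    w * R = R * w ∧ w * S = S * w := by
  have key : ∀ η, w (R η) = R (w η) ∧ w (S η) = S (w η) := fun η =>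
    graph_projection_unique h1 h2 (hw _ _ (h1 η)) fun ξ ζ h => by
      rw [← map_sub]
      have := h2 η _ _ (hw' ξ ζ h)
      rwa [ContinuousLinearMap.star_eq_adjoint, ContinuousLinearMap.adjoint_inner_right,
        ContinuousLinearMap.adjoint_inner_right] at this
  exact ⟨by ext η; exact (key η).1, by ext η; exact (key η).2⟩

/-- If Rη = 0 then Sη = 0, since (0, Sη) lies on a graph; hence η is orthogonal to the dense domain.
-/
theorem graph_projection_injective (hd : Dense (x.domain : Set H)) {R S : H →L[ℂ] H}
    (h1 : ∀ η, (R η, S η) ∈ x.graph)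
    (h2 : ∀ η ξ ζ, (ξ, ζ) ∈ x.graph → ⟪η - R η, ξ⟫_ℂ = ⟪S η, ζ⟫_ℂ) {η : H} (h : R η = 0) :
    η = 0 := by
  have h3 := h1 η
  rw [h] at h3
  have h4 : S η = 0 := graph_unique h3 (zero_mem x.graph)
  refine hd.eq_zero_of_inner_left ℂ fun ξ hξ => ?_
  have := h2 η _ _ (x.mem_graph ⟨ξ, hξ⟩)
  rwa [h, h4, sub_zero, inner_zero_left] at this

end Graph

/-! ### Strong operations on bounded and zero operators -/

theorem sadd_ofOp (S T : H →L[ℂ] H) : sadd (ofOp S) (ofOp T) = ofOp (S + T) := by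
  rw [sadd, add_ofOp, closure_ofOp]

theorem sprod_ofOp (S T : H →L[ℂ] H) : sprod (ofOp S) (ofOp T) = ofOp (S * T) := by
  rw [sprod, pmul_ofOp, closure_ofOp]

theorem closure_closure (x : H →ₗ.[ℂ] H) : x.closure.closure = x.closure := by
  by_cases h : x.IsClosable
  · exact closure_eq_of_isClosed h.closure_isClosed
  -- A non-closable operator is its own closure by convention.
  · rw [LinearPMap.closure_def' h, LinearPMap.closure_def' h]

theorem eq_zero_of_mem_graph_zero {ξ ζ : H} (h : (ξ, ζ) ∈ (0 : H →ₗ.[ℂ] H).graph) : ζ = 0 := by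
  rw [zero_eq_ofOp] at h
  exact mem_graph_ofOp.1 h

/-! ### Derivations on bounded elements -/

section Derivation

variable {M : VonNeumannAlgebra H} {τ : FiniteTrace M} {Λ : Set (ℝ → ℝ)} {x : H →ₗ.[ℂ] H}

theorem mem_measurableOps_of_mem_arens (hΛ : IsQuadraticFamily Λ) (hx : x ∈ arens M τ Λ) :
    x ∈ measurableOps M τ := by
  obtain ⟨φ, hφ⟩ := hΛ.nonempty
  exact mem_measurableOps_of_mem_orliczSpace (mem_iInter₂.1 hx φ hφ)

/-- The kernel of a closed operator is closed and here contains the dense domain. So identities for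
the values of `D` need testing only on vectors of the graph. -/
theorem eq_zero_of_apply_eq_zero (hx : x ∈ measurableOps M τ)
    (h : ∀ ξ ζ, (ξ, ζ) ∈ x.graph → ζ = 0) : x = 0 := by
  refine eq_zero_of_forall_mem_graph fun ξ => ?_
  have hc : IsClosed {ξ : H | (ξ, (0 : H)) ∈ x.graph} :=
    (isClosed_of_mem hx).preimage (continuous_id.prodMk continuous_const)
  have hsub : (x.domain : Set H) ⊆ {ξ : H | (ξ, (0 : H)) ∈ x.graph} := fun η hη => by
    have h1 := x.mem_graph ⟨η, hη⟩
    rwa [h _ _ h1] at h1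
  exact hc.closure_subset_iff.2 hsub (dense_domain hx ξ)

theorem sprod_zero_left (hx : x ∈ measurableOps M τ) : sprod 0 x = 0 := by
  have hle : pmul 0 x ≤ 0 := by
    refine LinearPMap.le_of_le_graph fun p hp => ?_
    obtain ⟨η, -, h2⟩ := mem_graph_pmul.1 (show (p.1, p.2) ∈ (pmul 0 x).graph from hp)
    have : p = (p.1, 0) := Prod.ext rfl (eq_zero_of_mem_graph_zero h2)
    rw [this, zero_eq_ofOp]
    exact mem_graph_ofOp.2 rfl
  have hcl : (pmul 0 x).IsClosable := by
    refine LinearPMap.IsClosable.leIsClosable (LinearPMap.IsClosed.isClosable ?_) hle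
    rw [zero_eq_ofOp]
    exact ofOp_isClosed 0
  refine eq_zero_of_forall_mem_graph fun ξ => ?_
  rw [sprod, ← hcl.graph_closure_eq_closure_graph]
  refine map_mem_closure (f := fun η : H => (η, (0 : H))) (t := ((pmul 0 x).graph : Set (H × H)))
    (continuous_id.prodMk continuous_const) (dense_domain hx ξ) fun η hη => ?_
  refine mem_graph_pmul.2 ⟨x ⟨η, hη⟩, x.mem_graph ⟨η, hη⟩, ?_⟩
  rw [zero_eq_ofOp]
  exact mem_graph_ofOp.2 rfl

variable {D : (H →ₗ.[ℂ] H) → (H →ₗ.[ℂ] H)}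

/-- The derivation vanishes at the bounded operator `T`. -/
def Kills (D : (H →ₗ.[ℂ] H) → (H →ₗ.[ℂ] H)) (T : M.toStarSubalgebra) : Prop :=
  D (ofOp (T : H →L[ℂ] H)) = 0

variable (hΛ : IsQuadraticFamily Λ) (hD : IsAdditiveDerivation (arens M τ Λ) D)

include hΛ hD

theorem map_ofOp_mem (T : M.toStarSubalgebra) : D (ofOp (T : H →L[ℂ] H)) ∈ arens M τ Λ :=
  hD.mapsTo (ofOp_mem_arens τ hΛ.young T)

theorem map_ofOp_mem_measurableOps (T : M.toStarSubalgebra) :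
    D (ofOp (T : H →L[ℂ] H)) ∈ measurableOps M τ :=
  mem_measurableOps_of_mem_arens hΛ (map_ofOp_mem hΛ hD T)

theorem map_ofOp_add (S T : M.toStarSubalgebra) :
    D (ofOp ((S + T : M.toStarSubalgebra) : H →L[ℂ] H))
      = sadd (D (ofOp (S : H →L[ℂ] H))) (D (ofOp (T : H →L[ℂ] H))) := by
  rw [← hD.map_add _ (ofOp_mem_arens τ hΛ.young S) _ (ofOp_mem_arens τ hΛ.young T), sadd_ofOp]
  rfl

theorem map_ofOp_mul (S T : M.toStarSubalgebra) :
    D (ofOp ((S * T : M.toStarSubalgebra) : H →L[ℂ] H))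
      = sadd (sprod (D (ofOp (S : H →L[ℂ] H))) (ofOp (T : H →L[ℂ] H)))
        (sprod (ofOp (S : H →L[ℂ] H)) (D (ofOp (T : H →L[ℂ] H)))) := by
  rw [← hD.leibniz _ (ofOp_mem_arens τ hΛ.young S) _ (ofOp_mem_arens τ hΛ.young T), sprod_ofOp]
  rfl

theorem Kills.add {S T : M.toStarSubalgebra} (hS : Kills D S) (hT : Kills D T) :
    Kills D (S + T) := by
  rw [Kills, map_ofOp_add hΛ hD, hS, hT, zero_eq_ofOp, sadd_ofOp, add_zero]

theorem Kills.mul {S T : M.toStarSubalgebra} (hS : Kills D S) (hT : Kills D T) :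
    Kills D (S * T) := by
  rw [Kills, map_ofOp_mul hΛ hD, hS, hT, zero_eq_ofOp, sprod_ofOp, sprod_ofOp, sadd_ofOp,
    zero_mul, mul_zero, add_zero]

theorem kills_zero : Kills D (0 : M.toStarSubalgebra) := by
  refine eq_zero_of_apply_eq_zero (map_ofOp_mem_measurableOps hΛ hD 0) fun ξ ζ h => ?_
  have h1 := mem_graph_sadd h h
  rw [← map_ofOp_add hΛ hD, add_zero] at h1
  exact left_eq_add.1 (graph_unique h h1)

omit hΛ hD in
theorem mem_graph_of_mem_commutant (hx : x ∈ measurableOps M τ) {T : H →L[ℂ] H}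
    (hT : T ∈ M.commutant) {ξ ζ : H} (h : (ξ, ζ) ∈ x.graph) :
    (ξ, T ζ) ∈ (sprod x (ofOp T)).graph ∧ (ξ, T ζ) ∈ (sprod (ofOp T) x).graph :=
  ⟨mem_graph_sprod (mem_graph_ofOp.2 rfl) (graph_invariant hx.2.1 hT _ _ h),
    mem_graph_sprod h (mem_graph_ofOp.2 rfl)⟩

/-- T is in the commutant, so it commutes with the affiliated operator D(T), and D(T²) = 2T D(T). -/
theorem mem_graph_map_sq {T : M.toStarSubalgebra} (hT : (T : H →L[ℂ] H) ∈ M.commutant) {ξ ζ : H}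
    (h : (ξ, ζ) ∈ (D (ofOp (T : H →L[ℂ] H))).graph) :
    (ξ, (T : H →L[ℂ] H) ζ + (T : H →L[ℂ] H) ζ)
      ∈ (D (ofOp ((T * T : M.toStarSubalgebra) : H →L[ℂ] H))).graph := by
  obtain ⟨h1, h2⟩ := mem_graph_of_mem_commutant (map_ofOp_mem_measurableOps hΛ hD T) hT h
  rw [map_ofOp_mul hΛ hD]
  exact mem_graph_sadd h1 h2

/-- De = 2eDe; applying e gives eDe = 2eDe, so eDe = 0 and then De = 0. -/
theorem kills_of_isIdempotentElem {e : M.toStarSubalgebra} (he : e * e = e)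
    (hec : (e : H →L[ℂ] H) ∈ M.commutant) : Kills D e := by
  refine eq_zero_of_apply_eq_zero (map_ofOp_mem_measurableOps hΛ hD e) fun ξ ζ h => ?_
  have h1 := mem_graph_map_sq hΛ hD hec h
  rw [he] at h1
  have h2 : ζ = (e : H →L[ℂ] H) ζ + (e : H →L[ℂ] H) ζ := graph_unique h h1
  have h3 : (e : H →L[ℂ] H) ((e : H →L[ℂ] H) ζ) = (e : H →L[ℂ] H) ζ :=
    congrArg (fun X : M.toStarSubalgebra => (X : H →L[ℂ] H) ζ) he
  have h4 : (e : H →L[ℂ] H) ζ = (e : H →L[ℂ] H) ζ + (e : H →L[ℂ] H) ζ := by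
    conv_lhs => rw [h2, map_add, h3]
  rw [h2, ← h4]
  exact left_eq_add.1 h4

theorem kills_one : Kills D (1 : M.toStarSubalgebra) :=
  kills_of_isIdempotentElem hΛ hD (mul_one 1) (one_mem M.commutant)

theorem Kills.of_add {S T : M.toStarSubalgebra} (hS : Kills D S) (hST : Kills D (S + T)) :
    Kills D T := by
  refine eq_zero_of_apply_eq_zero (map_ofOp_mem_measurableOps hΛ hD T) fun ξ ζ h => ?_
  have h1 : (ξ, (0 : H)) ∈ (D (ofOp (S : H →L[ℂ] H))).graph := by
    rw [show D (ofOp (S : H →L[ℂ] H)) = 0 from hS, zero_eq_ofOp]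
    exact mem_graph_ofOp.2 rfl
  have h2 := mem_graph_sadd h1 h
  rw [← map_ofOp_add hΛ hD, show D _ = 0 from hST, zero_add] at h2
  exact eq_zero_of_mem_graph_zero h2

theorem kills_neg_one : Kills D (-1 : M.toStarSubalgebra) := by
  refine Kills.of_add hΛ hD (kills_one hΛ hD) ?_
  rw [add_neg_cancel]
  exact kills_zero hΛ hD

theorem kills_natCast (n : ℕ) : Kills D (n : M.toStarSubalgebra) := by
  induction n with
  | zero => simpa using kills_zero hΛ hD
  | succ n ih =>
    rw [Nat.cast_succ]
    exact Kills.add hΛ hD ih (kills_one hΛ hD)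

theorem kills_half : Kills D ((2⁻¹ : ℂ) • (1 : M.toStarSubalgebra)) := by
  refine eq_zero_of_apply_eq_zero (map_ofOp_mem_measurableOps hΛ hD _) fun ξ ζ h => ?_
  have h1 := mem_graph_sadd h h
  rw [← map_ofOp_add hΛ hD, ← add_smul, show (2⁻¹ : ℂ) + 2⁻¹ = 1 by norm_num, one_smul,
    show D _ = 0 from kills_one hΛ hD] at h1
  have h2 := eq_zero_of_mem_graph_zero h1
  rw [← two_smul ℂ] at h2
  exact (smul_eq_zero_iff_right two_ne_zero).1 h2

/-- From i² = −1 one gets 2i D(i) = D(−1) = 0. -/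
theorem kills_I : Kills D (Complex.I • (1 : M.toStarSubalgebra)) := by
  refine eq_zero_of_apply_eq_zero (map_ofOp_mem_measurableOps hΛ hD _) fun ξ ζ h => ?_
  have h1 := mem_graph_map_sq hΛ hD
    (M.commutant.toStarSubalgebra.smul_mem (one_mem M.commutant) Complex.I) h
  have e : (Complex.I • (1 : M.toStarSubalgebra)) * (Complex.I • (1 : M.toStarSubalgebra)) = -1 := by
    rw [smul_mul_smul_comm, Complex.I_mul_I, mul_one, neg_one_smul]
  rw [e, show D _ = 0 from kills_neg_one hΛ hD] at h1
  have h2 : Complex.I • ζ + Complex.I • ζ = 0 := eq_zero_of_mem_graph_zero h1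
  rw [← two_smul ℂ, smul_smul] at h2
  exact (smul_eq_zero_iff_right (mul_ne_zero two_ne_zero Complex.I_ne_zero)).1 h2

/-! ### Vanishing on the center -/

theorem mem_graph_map_dyadic {T : M.toStarSubalgebra} (hT : (T : H →L[ℂ] H) ∈ M.commutant) (n : ℕ)
    {ξ ζ : H} (h : (ξ, ζ) ∈ (D (ofOp (T : H →L[ℂ] H))).graph) :
    (ξ, (2 ^ n : ℂ) • ζ) ∈ (D (ofOp (dyadic T n : H →L[ℂ] H))).graph := by
  induction n with
  | zero => simpa [dyadic] using h
  | succ n ih =>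
    have hdig : Kills D (digit (dyadic T n)) := kills_of_isIdempotentElem hΛ hD
      (InvSubspace.isProj _).isIdempotentElem.eq (digit_mem_commutant (dyadic_mem_commutant hT n))
    have e : dyadic T (n + 1) + digit (dyadic T n) = dyadic T n + dyadic T n := sub_add_cancel _ _
    have h1 := mem_graph_sadd ih ih
    rw [← map_ofOp_add hΛ hD, ← e, map_ofOp_add hΛ hD,
      show D (ofOp ((digit (dyadic T n) : M.toStarSubalgebra) : H →L[ℂ] H)) = 0 from hdig, sadd, add_zero, closure_of_mem (map_ofOp_mem_measurableOps hΛ hD _),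
      ← add_smul] at h1
    rwa [pow_succ, mul_two]

theorem kills_of_positive (hM : ∀ p, IsAbelianProj M p → p = 0) {T : M.toStarSubalgebra}
    (hT : (T : H →L[ℂ] H) ∈ M.commutant) (h0 : 0 ≤ T) (h1 : T ≤ 1) : Kills D T := by
  by_contra hne
  obtain ⟨φ, hφΛ⟩ := hΛ.nonempty
  have hφ := hΛ.young φ hφΛ
  obtain ⟨Z, β, hβ, hZ, hbelow⟩ := exists_bounded_below hφ
    (mem_iInter₂.1 (map_ofOp_mem hΛ hD T) φ hφΛ) hne
  obtain ⟨L, hLne, hLZ, hLorth⟩ := exists_orthogonal_seq hM hZ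
  -- D(X) will be N times an element of the unit ball, with N unknown until X is built. The divisor
  -- 2(n + 1) prepares every index n for the case N = n, in which it absorbs the factor N.
  have hk : ∀ n : ℕ, ∃ k : ℕ, 1 < φ (2 ^ k * (β / (2 * (n + 1)))) * rank τ (L n) := by
    intro n
    have hr : 0 < rank τ (L n) := lt_of_le_of_ne (rank_nonneg τ _)
      fun h => hLne n ((rank_eq_zero_iff τ _).1 h.symm)
    have hlim : Tendsto (fun k : ℕ => φ (2 ^ k * (β / (2 * (n + 1)))) * rank τ (L n))
        Filter.atTop Filter.atTop :=
      (hφ.tendsto_atTop.comp ((tendsto_pow_atTop_atTop_of_one_lt one_lt_two).atTop_mul_const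
        (by positivity))).atTop_mul_const hr
    exact (hlim.eventually_gt_atTop 1).exists
  choose k hk using hk
  obtain ⟨X, hX⟩ := exists_strong_sum hLorth (T := fun n => dyadic T (k n))
    (fun n => dyadic_mem_commutant hT (k n))
    (fun n => norm_le_one_of_mem_Icc (dyadic_mem_Icc h0 h1 _).1 (dyadic_mem_Icc h0 h1 _).2)
  obtain ⟨E, N, hN, hcheb, hE⟩ := exists_spectralFamily_of_mem_orliczSpace hφ
    (mem_iInter₂.1 (map_ofOp_mem hΛ hD X) φ hφΛ)
  obtain ⟨hXp, hpX⟩ := hX N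
  set p := (L N).proj with hp
  set S := dyadic T (k N) with hS
  set s : ℝ := 2 ^ k N * (β / (2 * (N + 1))) with hs
  have hs0 : 0 < s := by positivity
  have hNs : N * s < 2 ^ k N * β := by
    rw [hs]
    have : (N : ℝ) * (2 ^ k N * (β / (2 * (N + 1)))) = 2 ^ k N * β * (N / (2 * (N + 1))) := by
      field_simp
    rw [this]
    refine mul_lt_of_lt_one_right (by positivity) ?_
    rw [div_lt_one (by positivity)]
    have : (0 : ℝ) ≤ N := Nat.cast_nonneg N
    linarith
  have hSc : (S : H →L[ℂ] H) ∈ M.commutant := dyadic_mem_commutant hT _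
  -- A nonzero vector of L N cannot lie in both e_s and the domain of D(p): there 2^k D(T)η = p
  -- D(X)η would be at least 2^k β‖η‖ and at most N s‖η‖ < 2^k β‖η‖ in norm. The domain of D(p)
  -- costs only ε in dimension.
  have hrank : rank τ (L N) ≤ rank τ (InvSubspace.ofProj (E.e s)).compl := by
    refine le_of_forall_pos_le_add fun ε hε => ?_
    obtain ⟨K, hK, hKε⟩ := exists_invSubspace_le_domain (map_ofOp_mem_measurableOps hΛ hD p) hε
    refine (rank_le_add_of_disjoint τ (L := InvSubspace.ofProj (E.e s)) (N := K)
      fun η hηL hηE hηK => ?_).trans (add_le_add_right hKε.le _)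
    obtain ⟨ζb, hb, hbβ⟩ := hbelow η (hLZ N hηL)
    obtain ⟨ζd, hd⟩ := hK η hηK
    obtain ⟨ζy, hy, hys, -⟩ := hE s hs0 η (InvSubspace.mem_ofProj.1 hηE)
    have hpη : (p : H →L[ℂ] H) η = η := (L N).proj_apply_eq_self_iff.2 hηL
    have hXη : (X : H →L[ℂ] H) η = (S : H →L[ℂ] H) η := by
      have := congrArg (fun Y : M.toStarSubalgebra => (Y : H →L[ℂ] H) η) hXp
      change (X : H →L[ℂ] H) ((p : H →L[ℂ] H) η) = (S : H →L[ℂ] H) ((p : H →L[ℂ] H) η) at this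
      rwa [hpη] at this
    -- The Leibniz rule for Sp and for pX, which are the same element. The term S D(p)η occurs in
    -- both, since on η one has D(p)Xη = D(p)Sη = S D(p)η; it cancels.
    have g1 : (η, (2 ^ k N : ℂ) • ζb + (S : H →L[ℂ] H) ζd)
        ∈ (D (ofOp ((S * p : M.toStarSubalgebra) : H →L[ℂ] H))).graph := by
      rw [map_ofOp_mul hΛ hD]
      exact mem_graph_sadd (mem_graph_sprod (mem_graph_ofOp.2 hpη.symm)
        (mem_graph_map_dyadic hΛ hD hT _ hb)) (mem_graph_sprod hd (mem_graph_ofOp.2 rfl))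
    have g2 : (η, (S : H →L[ℂ] H) ζd + (p : H →L[ℂ] H) ζy)
        ∈ (D (ofOp ((S * p : M.toStarSubalgebra) : H →L[ℂ] H))).graph := by
      rw [← hpX, map_ofOp_mul hΛ hD]
      refine mem_graph_sadd (mem_graph_sprod (mem_graph_ofOp.2 hXη.symm) ?_)
        (mem_graph_sprod hy (mem_graph_ofOp.2 rfl))
      exact graph_invariant (map_ofOp_mem_measurableOps hΛ hD p).2.1 hSc _ _ hd
    have h3 : (2 ^ k N : ℂ) • ζb = (p : H →L[ℂ] H) ζy := by
      have := graph_unique g1 g2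
      rw [add_comm] at this
      exact add_left_cancel this
    have h4 : 2 ^ k N * ‖ζb‖ ≤ ‖ζy‖ := by
      have h5 : ‖(2 ^ k N : ℂ) • ζb‖ = 2 ^ k N * ‖ζb‖ := by
        rw [norm_smul]
        simp
      rw [← h5, h3]
      exact (L N).space.norm_starProjection_apply_le ζy
    by_contra hη
    have hηpos : 0 < ‖η‖ := norm_pos_iff.2 hη
    have h6 : 2 ^ k N * (β * ‖η‖) ≤ N * s * ‖η‖ :=
      (mul_le_mul_of_nonneg_left hbβ (by positivity)).trans (h4.trans hys)
    have h7 := mul_lt_mul_of_pos_right hNs hηpos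
    linarith
  have h8 := hk N
  have hφs : 0 < φ s := by
    by_contra h
    have := mul_nonpos_of_nonpos_of_nonneg (not_lt.1 h) (rank_nonneg τ (L N))
    linarith
  have h9 := mul_le_mul_of_nonneg_left hrank hφs.le
  linarith [hcheb s hs0]

theorem kills_of_isSelfAdjoint (hM : ∀ p, IsAbelianProj M p → p = 0) {T : M.toStarSubalgebra}
    (hT : (T : H →L[ℂ] H) ∈ M.commutant) (hsa : IsSelfAdjoint (T : H →L[ℂ] H)) : Kills D T := by
  obtain ⟨n, hn⟩ := exists_nat_gt ‖(T : H →L[ℂ] H)‖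
  have hn0 : 0 < n := by exact_mod_cast (norm_nonneg _).trans_lt hn
  obtain ⟨S, hS, h0, h1, hTS⟩ := exists_affine_positive
    (M.toStarSubalgebra ⊓ M.commutant.toStarSubalgebra) (w := (T : H →L[ℂ] H)) ⟨T.2, hT⟩ hsa
    hn.le hn0
  have hK : Kills D (⟨S, hS.1⟩ : M.toStarSubalgebra) := kills_of_positive hΛ hD hM hS.2 h0 h1
  have e : T = (n : M.toStarSubalgebra) * (⟨S, hS.1⟩ + ⟨S, hS.1⟩ + -1) := by
    apply Subtype.ext
    rw [hTS, ← sub_eq_add_neg]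
    change (n : ℂ) • (S + S - 1) = ((n : M.toStarSubalgebra) : H →L[ℂ] H) * (S + S - 1)
    rw [Nat.cast_smul_eq_nsmul, nsmul_eq_mul]
    rfl
  rw [e]
  exact Kills.mul hΛ hD (kills_natCast hΛ hD n)
    (Kills.add hΛ hD (Kills.add hΛ hD hK hK) (kills_neg_one hΛ hD))

theorem kills_of_mem_commutant (hM : ∀ p, IsAbelianProj M p → p = 0) {T : M.toStarSubalgebra}
    (hT : (T : H →L[ℂ] H) ∈ M.commutant) : Kills D T := by
  have hT' : ((star T : M.toStarSubalgebra) : H →L[ℂ] H) ∈ M.commutant := star_mem hT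
  have hI : star Complex.I = -Complex.I := Complex.conj_I
  have h1 : Kills D (T + star T) := kills_of_isSelfAdjoint hΛ hD hM (add_mem hT hT')
    (congrArg Subtype.val (show star (T + star T) = T + star T by
      rw [star_add, star_star, add_comm]))
  have h2 : Kills D (Complex.I • (star T - T)) := kills_of_isSelfAdjoint hΛ hD hM
    (M.commutant.toStarSubalgebra.smul_mem (sub_mem hT' hT) _)
    (congrArg Subtype.val (show star (Complex.I • (star T - T)) = Complex.I • (star T - T) by
      rw [star_smul, star_sub, star_star, hI, neg_smul, ← smul_neg, neg_sub]))
  -- Since `D` is only additive and multiplicative, the decomposition into self-adjoint parts is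
  -- written with the operators 1/2 and i, which are already killed.
  have e : T = ((2⁻¹ : ℂ) • (1 : M.toStarSubalgebra)) *
      ((T + star T) + (Complex.I • (1 : M.toStarSubalgebra)) * (Complex.I • (star T - T))) := by
    rw [smul_mul_smul_comm, Complex.I_mul_I, one_mul, neg_one_smul, neg_sub, smul_mul_assoc,
      one_mul]
    have : T + star T + (T - star T) = (2 : ℂ) • T := by
      rw [two_smul]
      abel
    rw [this, smul_smul]
    norm_num
  rw [e]
  exact Kills.mul hΛ hD (kills_half hΛ hD) (Kills.add hΛ hD h1 (Kills.mul hΛ hD (kills_I hΛ hD) h2))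

theorem map_eq_zero_of_mem_centerOf (hM : ∀ p, IsAbelianProj M p → p = 0) {a : H →ₗ.[ℂ] H}
    (ha : a ∈ centerOf (arens M τ Λ)) : D a = 0 := by
  obtain ⟨haA, hcenter⟩ := ha
  have ham := mem_measurableOps_of_mem_arens hΛ haA
  obtain ⟨R, S, hRS, horth⟩ := exists_graph_projection ham.1
  -- The product a w with w bounded is already closed, so no closure intervenes: a commuting with w
  -- in the strong sense means that w maps the graph of a into itself.
  have hinv : ∀ w ∈ M, ∀ ξ ζ, (ξ, ζ) ∈ a.graph → (w ξ, w ζ) ∈ a.graph := by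
    intro w hw ξ ζ h
    have h1 : (ξ, w ζ) ∈ (sprod (ofOp w) a).graph := mem_graph_sprod h (mem_graph_ofOp.2 rfl)
    rw [← hcenter (ofOp w) (ofOp_mem_arens τ hΛ.young ⟨w, hw⟩)] at h1
    have hg : ∀ ξ ζ, (ξ, ζ) ∈ (pmul a (ofOp w)).graph ↔ (w ξ, ζ) ∈ a.graph := fun ξ ζ => by
      rw [mem_graph_pmul]
      exact ⟨fun ⟨η, h2, h3⟩ => by rwa [mem_graph_ofOp.1 h2] at h3,
        fun h2 => ⟨_, mem_graph_ofOp.2 rfl, h2⟩⟩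
    have hcl : (pmul a (ofOp w)).IsClosed := by
      have : ((pmul a (ofOp w)).graph : Set (H × H)) = (fun q : H × H => (w q.1, q.2)) ⁻¹' a.graph := by
        ext ⟨ξ, ζ⟩
        exact hg ξ ζ
      rw [LinearPMap.IsClosed, this]
      exact (isClosed_of_mem ham).preimage ((w.continuous.comp continuous_fst).prodMk continuous_snd)
    rw [sprod, closure_eq_of_isClosed hcl] at h1
    exact (hg _ _).1 h1
  have hM' : ∀ w ∈ M.commutant, w * R = R * w ∧ w * S = S * w := fun w hw =>
    graph_projection_commute hRS horth (graph_invariant ham.2.1 hw)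
      (graph_invariant ham.2.1 (star_mem hw))
  have hMc : ∀ w ∈ M, w * R = R * w ∧ w * S = S * w := fun w hw =>
    graph_projection_commute hRS horth (hinv w hw) (hinv _ (star_mem hw))
  have hRM : R ∈ M := by
    rw [← M.commutant_commutant, VonNeumannAlgebra.mem_commutant_iff]
    exact fun w hw => (hM' w hw).1
  have hSM : S ∈ M := by
    rw [← M.commutant_commutant, VonNeumannAlgebra.mem_commutant_iff]
    exact fun w hw => (hM' w hw).2
  have hkR : Kills D (⟨R, hRM⟩ : M.toStarSubalgebra) := kills_of_mem_commutant hΛ hD hM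
    (VonNeumannAlgebra.mem_commutant_iff.2 fun w hw => (hMc w hw).1)
  have hkS : Kills D (⟨S, hSM⟩ : M.toStarSubalgebra) := kills_of_mem_commutant hΛ hD hM
    (VonNeumannAlgebra.mem_commutant_iff.2 fun w hw => (hMc w hw).2)
  have hprod : sprod a (ofOp R) = ofOp S := by
    have : pmul a (ofOp R) = ofOp S := by
      apply LinearPMap.eq_of_eq_graph
      ext ⟨ξ, ζ⟩
      rw [mem_graph_pmul, mem_graph_ofOp]
      constructor
      · rintro ⟨η, h2, h3⟩
        rw [mem_graph_ofOp.1 h2] at h3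
        exact graph_unique h3 (hRS ξ)
      · rintro rfl
        exact ⟨_, mem_graph_ofOp.2 rfl, hRS ξ⟩
    rw [sprod, this, closure_ofOp]
  have hbm := mem_measurableOps_of_mem_arens hΛ (hD.mapsTo haA)
  -- The Leibniz rule for S = aR, in which D(R) and D(S) vanish, leaves D(a)R = 0.
  have hker : ∀ ξ ζ, (R ξ, ζ) ∈ (D a).graph → ζ = 0 := by
    intro ξ ζ h
    have h1 : (ξ, ζ) ∈ (sprod (D a) (ofOp R)).graph := mem_graph_sprod (mem_graph_ofOp.2 rfl) h
    have h2 : (ξ, (0 : H)) ∈ (sprod a (D (ofOp R))).graph := by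
      rw [show D (ofOp R) = 0 from hkR, zero_eq_ofOp]
      exact mem_graph_sprod (mem_graph_ofOp.2 rfl) (zero_mem a.graph)
    have h3 := mem_graph_sadd h1 h2
    rw [← hD.leibniz a haA _ (ofOp_mem_arens τ hΛ.young ⟨R, hRM⟩), hprod,
      show D (ofOp S) = 0 from hkS, add_zero] at h3
    exact eq_zero_of_mem_graph_zero h3
  have htop : (graphKer hbm).space = ⊤ := by
    refine space_eq_top_of_forall_rank_compl_le (τ := τ) fun ε hε => ?_
    obtain ⟨K, hK, hlt⟩ := exists_invSubspace_le_domain hbm hε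
    -- R is injective and maps the preimage of a large part of the domain of D(a) into ker D(a). So
    -- this kernel has codimension less than ε.
    have h1 : rank τ (K.comap ⟨R, hRM⟩) ≤ rank τ (graphKer hbm) :=
      rank_le_of_injOn τ ⟨R, hRM⟩
        (fun ξ _ h0 => graph_projection_injective (dense_domain ham) hRS horth h0) fun ξ hξ => by
          obtain ⟨ζ, hζ⟩ := hK _ (InvSubspace.mem_comap.1 hξ)
          rw [mem_graphKer]
          rwa [hker ξ ζ hζ] at hζ
    have h2 := rank_compl_comap_le τ K ⟨R, hRM⟩
    rw [rank_compl] at h2 ⊢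
    linarith
  refine eq_zero_of_forall_mem_graph fun ξ => ?_
  rw [← mem_graphKer hbm, htop]
  trivial

/-- Scaling by c is multiplication by the central element c·1, which `D` kills. -/
theorem map_sscal (hM : ∀ p, IsAbelianProj M p → p = 0) (c : ℂ) (hx : x ∈ arens M τ Λ) :
    D (sscal c x) = sscal c (D x) := by
  have hsc : ∀ y : H →ₗ.[ℂ] H, sprod (ofOp (c • (1 : H →L[ℂ] H))) y = sscal c y := fun y => by
    rw [sprod, sscal]
    congr 1
    apply LinearPMap.eq_of_eq_graph
    ext ⟨ξ, ζ⟩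
    rw [mem_graph_pmul, mem_graph_smul]
    refine exists_congr fun η => and_congr_right fun _ => ?_
    rw [mem_graph_ofOp]
    rfl
  have hk : Kills D (c • (1 : M.toStarSubalgebra)) := kills_of_mem_commutant hΛ hD hM
    (M.commutant.toStarSubalgebra.smul_mem (one_mem M.commutant) c)
  have hk' : D (ofOp (c • (1 : H →L[ℂ] H))) = 0 := hk
  have hmem : ofOp (c • (1 : H →L[ℂ] H)) ∈ arens M τ Λ :=
    ofOp_mem_arens τ hΛ.young (c • (1 : M.toStarSubalgebra))
  rw [← hsc, hD.leibniz _ hmem _ hx, hk',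
    sprod_zero_left (mem_measurableOps_of_mem_arens hΛ hx), hsc, sadd, zero_add, sscal,
    closure_closure]

end Derivation

end ArensAlgebra

end

theorem lemma3p4 {H : Type*} [NormedAddCommGroup H] [InnerProductSpace ℂ H] [CompleteSpace H]
    (M : VonNeumannAlgebra H) (hM : ArensAlgebra.IsTypeII M) (τ : ArensAlgebra.FiniteTrace M)
    (Λ : Set (ℝ → ℝ)) (hΛ : ArensAlgebra.IsQuadraticFamily Λ)
    (D : (H →ₗ.[ℂ] H) → (H →ₗ.[ℂ] H))
    (hD : ArensAlgebra.IsAdditiveDerivation (ArensAlgebra.arens M τ Λ) D) :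
    (∀ a ∈ ArensAlgebra.centerOf (ArensAlgebra.arens M τ Λ), D a = 0) ∧
      ArensAlgebra.IsLinearOperator (ArensAlgebra.arens M τ Λ) D :=
  ⟨fun _ ha => ArensAlgebra.map_eq_zero_of_mem_centerOf hΛ hD hM.1 ha,
    hD.mapsTo, hD.map_add, fun c _ hx => ArensAlgebra.map_sscal hΛ hD hM.1 c hx⟩
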